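/- Let $A\in\mathbb R^{n\times n}$, $B\in\mathbb R^{n\times m}$, $C\in\mathbb R^{p\times n}$, $E\in\mathbb R^{n\times p}$ and let $\Theta\subset\mathbb R^p$ be a compact convex set. For a closed convex set $S$ let $N_S(u)=\{s:\ s^{T}(v-u)\ge 0\ \text{for all } v\in S\}$ be the cone of inward normals at $u$ and let $P_S$ be the metric projection onto $S$. A trajectory of the system with input $w:[0,\infty)\to\mathbb R^m$ is a pair $(x,z)$ of locally absolutely continuous functions on $[0,\infty)$ such that, with $y=Cx$ and $q=z-y$, one has $q(t)\in\Theta$ for all $t\ge 0$ and, for almost all $t\ge0$, $$\dot x=Ax+Bw+Ez,\qquad \dot z=P_{N_\Theta(q)}(\dot y).$$ Assume that $\Theta$ is strongly convex with constant $R>0$, that is, $R$ is the (finite) infimum of those $r\ge0$ for which $\Theta\subset \overline B_r(u+rv)$ for all $u\in\partial\Theta$ and all unit vectors $v\in N_\Theta(u)$. Assume that $F=A+EC$ is Hurwitz, let $\mu<0$ be the largest real part of its eigenvalues, let $0<\lambda<|\mu|$, and let $\Pi=\Pi^{T}\succ0$ satisfy $\mathbf S(\Pi F)\preccurlyeq-\lambda\Pi$,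 where $\mathbf S(M)=\frac12(M+M^{T})$. Put $H=\frac12(\Pi E-F^{T}C^{T})$, $\alpha=\lambda_{\min}(\mathbf S(CE))$, $\beta=\lambda_{\max}(H^{T}\Pi^{-1}H)$ and $$\psi(u)=\sqrt{\beta+\tfrac14(\alpha-\lambda+u)^2}-\tfrac12(\alpha+\lambda+u),\qquad u\ge0.$$ For two trajectories $(x_k,z_k)$, $k=1,2$, with the same input, put $V=(x_1-x_2)^{T}\Pi(x_1-x_2)+|q_1-q_2|^2$ and $\gamma=\frac1{2R}(|\dot z_1|+|\dot z_2|)$. Then the following holds. 1. $\psi$ is convex and nonincreasing on $[0,\infty)$. For every locally integrable input $w$ and any two trajectories driven by $w$, the function $\psi(\gamma)$ is integrable on $[0,t]$ and $$\sqrt{V(t)}\le\sqrt{V(0)}\,\exp\Big(\int_0^t\psi(\gamma(s))\,ds\Big)\qquad\text{for all } t\ge 0.$$ 2. Suppose in addition that $0\in\Theta$, that $T>0$, and that $w$ is $T$-periodic and essentially bounded. Let $\sigma_\Theta(u)=\max_{v\in\Theta}u^{T}v$; let $\Xi(t)$, $t\ge 0$, be the convex compact set with support function $u\mapsto\int_0^t\sigma_\Theta(E^{T}e^{sF^{T}}u)\,ds$,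 and let $\Xi_\infty$ be the closure of $\bigcup_{t\ge0}\Xi(t)$. Let $\xi_T$ be the $T$-periodic solution of $\dot\xi=F\xi+Bw$, namely $$\xi_T(t)=e^{tF}(I-e^{TF})^{-1}\int_0^Te^{(T-s)F}Bw(s)\,ds+\int_0^te^{(t-s)F}Bw(s)\,ds,$$ and let $\eta_T=C\xi_T$. Put $$\gamma_1=\frac1{TR}\max\big(\operatorname{diam}\eta_T([0,T])-\operatorname{diam}(C\Xi_\infty+\Theta),\,0\big),$$ $$\gamma_\infty=\frac1R\Big(\operatorname*{ess\,sup}_{[0,T]}|\dot\eta_T|+\sup\{|v|:\ v\in C(F\Xi_\infty+E\Theta)\}\Big),$$ $$\theta=\psi(0)-\frac{\gamma_1}{\gamma_\infty}\big(\psi(0)-\psi(\gamma_\infty)\big),$$ with $\theta=\psi(0)$ if $\gamma_\infty=0$. Then, for any two trajectories driven by $w$, $$\limsup_{\tau\to\infty}\frac1T\int_\tau^{\tau+T}\psi(\gamma(t))\,dt\le\theta,$$ $$\frac12\limsup_{t\to\infty}\Big(\frac1t\ln V(t)\Big)\le\limsup_{t\to\infty}\Big(\frac1t\int_0^t\psi(\gamma(s))\,ds\Big)\le\theta,$$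 where $\ln0=-\infty$. Moreover, if $\theta<0$, then there is a unique $T$-periodic trajectory $(x_T,z_T)$ driven by $w$, and for every trajectory $(x,z)$ driven by $w$ and every $\kappa>\theta$ there is a constant $K$ such that $|x(t)-x_T(t)|+|z(t)-z_T(t)|\le Ke^{\kappa t}$ for all $t\ge0$. -/

import Mathlib

open Set Filter Topology MeasureTheory
open scoped Pointwise

noncomputable section

/-- Euclidean space `ℝ^r` with the standard inner product. -/
abbrev Vec (r : ℕ) : Type := EuclideanSpace ℝ (Fin r)

/-- The action of a real matrix on Euclidean vectors. -/
abbrev mact {r s : ℕ} (M : Matrix (Fin r) (Fin s) ℝ) (v : Vec s) : Vec r :=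
  Matrix.toEuclideanLin M v

/-! ### Matrices -/

/-- The complex spectrum of a real square matrix. -/
def complexSpectrum {n : ℕ} (F : Matrix (Fin n) (Fin n) ℝ) : Set ℂ :=
  spectrum ℂ (F.map (algebraMap ℝ ℂ))

/-- All complex eigenvalues have negative real parts. -/
def IsHurwitz {n : ℕ} (F : Matrix (Fin n) (Fin n) ℝ) : Prop :=
  ∀ z ∈ complexSpectrum F, z.re < 0

/-- The largest real part of the eigenvalues. -/
def spectralAbscissa {n : ℕ} (F : Matrix (Fin n) (Fin n) ℝ) : ℝ :=
  sSup (Complex.re '' complexSpectrum F)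

/-- The symmetrizer `S(M) = (M + Mᵀ) / 2`. -/
def symmetrizer {n : ℕ} (M : Matrix (Fin n) (Fin n) ℝ) : Matrix (Fin n) (Fin n) ℝ :=
  (1 / 2 : ℝ) • (M + M.transpose)

/-- Smallest eigenvalue (used for symmetric matrices of positive order). -/
def lambdaMin {n : ℕ} (M : Matrix (Fin n) (Fin n) ℝ) : ℝ := sInf (spectrum ℝ M)

/-- Largest eigenvalue (used for symmetric matrices of positive order). -/
def lambdaMax {n : ℕ} (M : Matrix (Fin n) (Fin n) ℝ) : ℝ := sSup (spectrum ℝ M)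

/-! ### Convex sets -/

/-- The cone of inward normals to `S` at `u`. -/
def inwardNormalCone {r : ℕ} (S : Set (Vec r)) (u : Vec r) : Set (Vec r) :=
  {s | ∀ v ∈ S, 0 ≤ inner ℝ s (v - u)}

/-- `v` is a metric projection of `u` onto `S`, a minimizer of the distance to `u` over `S`
(it is unique if `S` is closed and convex). -/
def IsMetricProjection {r : ℕ} (S : Set (Vec r)) (u v : Vec r) : Prop :=
  v ∈ S ∧ ∀ s ∈ S, ‖u - v‖ ≤ ‖u - s‖

/-- The radii `r ≥ 0` such that `S` lies in each closed ball of radius `r` which is supported, at a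
boundary point `u` of `S`, by the hyperplane with a unit inward normal `v` to `S` at `u`. -/
def supportingBallRadii {k : ℕ} (S : Set (Vec k)) : Set ℝ :=
  {r | 0 ≤ r ∧ ∀ u ∈ frontier S, ∀ v ∈ inwardNormalCone S u, ‖v‖ = 1 →
    S ⊆ Metric.closedBall (u + r • v) r}

/-- `S` is strongly convex with the constant `R`: the infimum of the radii above is
finite (that is, there is such a radius) and is equal to `R`. -/
def IsStronglyConvexWith {k : ℕ} (S : Set (Vec k)) (R : ℝ) : Prop :=
  IsGLB (supportingBallRadii S) R

/-- The support function of `S`. -/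
def supportFun {r : ℕ} (S : Set (Vec r)) (u : Vec r) : ℝ :=
  sSup ((fun v => inner ℝ u v) '' S)

/-- The Hausdorff deviation of `L` from `M`. -/
def hausdorffDeviation {r : ℕ} (L M : Set (Vec r)) : ℝ :=
  sSup ((fun u => Metric.infDist u M) '' L)

/-! ### The system -/

/-- The data of the closed-loop system: the matrices of the linear part and the backlash set. -/
structure BacklashSystem (m n p : ℕ) where
  A : Matrix (Fin n) (Fin n) ℝ
  B : Matrix (Fin n) (Fin m) ℝ
  C : Matrix (Fin p) (Fin n) ℝ
  E : Matrix (Fin n) (Fin p) ℝ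
  Theta : Set (Vec p)

namespace BacklashSystem

variable {m n p : ℕ} (sys : BacklashSystem m n p)

/-- The dynamics matrix `F = A + E C` of the linearised system. -/
def F : Matrix (Fin n) (Fin n) ℝ := sys.A + sys.E * sys.C

/-- The output `y = C x` of the linear part. -/
def y (x : ℝ → Vec n) (t : ℝ) : Vec p := mact sys.C (x t)

/-- The signal `q = z - y`. -/
def q (x : ℝ → Vec n) (z : ℝ → Vec p) (t : ℝ) : Vec p := z t - sys.y x t

/-- `(x, z)` is a trajectory on `[0, ∞)` of the system driven by the input `w`: `x` and `z` are
absolutely continuous on bounded intervals, `z ∈ y + Θ` at all times, and, at almost all times,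
`x' = A x + B w + E z` and `z'` is the metric projection of `y'` onto the cone of inward
normals to `Θ` at `q`. -/
structure IsTrajectory (w : ℝ → Vec m) (x : ℝ → Vec n) (z : ℝ → Vec p) : Prop where
  ac_x : ∀ t : ℝ, 0 ≤ t → AbsolutelyContinuousOnInterval x 0 t
  ac_z : ∀ t : ℝ, 0 ≤ t → AbsolutelyContinuousOnInterval z 0 t
  mem_theta : ∀ t : ℝ, 0 ≤ t → sys.q x z t ∈ sys.Theta
  linear_part : ∀ᵐ t ∂(volume.restrict (Ici (0 : ℝ))),
    HasDerivAt x (mact sys.A (x t) + mact sys.B (w t) + mact sys.E (z t)) t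
  backlash_part : ∀ᵐ t ∂(volume.restrict (Ici (0 : ℝ))),
    DifferentiableAt ℝ z t ∧
      IsMetricProjection (inwardNormalCone sys.Theta (sys.q x z t))
        (deriv (sys.y x) t) (deriv z t)

/-! ### The Lyapunov function and its rate -/

/-- `V = ‖x₁ - x₂‖_P² + |q₁ - q₂|²`. -/
def V (P : Matrix (Fin n) (Fin n) ℝ) (x₁ : ℝ → Vec n) (z₁ : ℝ → Vec p)
    (x₂ : ℝ → Vec n) (z₂ : ℝ → Vec p) (t : ℝ) : ℝ :=
  inner ℝ (x₁ t - x₂ t) (mact P (x₁ t - x₂ t)) + ‖sys.q x₁ z₁ t - sys.q x₂ z₂ t‖ ^ 2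

/-- `H = (P E - Fᵀ Cᵀ) / 2`. -/
def H (P : Matrix (Fin n) (Fin n) ℝ) : Matrix (Fin n) (Fin p) ℝ :=
  (1 / 2 : ℝ) • (P * sys.E - sys.F.transpose * sys.C.transpose)

/-- `α = λ_min(S(C E))`. -/
def alpha : ℝ := lambdaMin (symmetrizer (sys.C * sys.E))

/-- `β = λ_max(Hᵀ P⁻¹ H)`. -/
def beta (P : Matrix (Fin n) (Fin n) ℝ) : ℝ :=
  lambdaMax ((sys.H P).transpose * P⁻¹ * sys.H P)

/-- `ψ(u) = √(β + (α - λ + u)² / 4) - (α + λ + u) / 2`. -/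
def psi (P : Matrix (Fin n) (Fin n) ℝ) (lam u : ℝ) : ℝ :=
  Real.sqrt (sys.beta P + (1 / 4) * (sys.alpha - lam + u) ^ 2)
    - (1 / 2) * (sys.alpha + lam + u)

/-! ### The linearised system under a periodic input -/

/-- The initial value `(I - exp(T F))⁻¹ ∫₀ᵀ exp((T - s) F) B w(s) ds` of the periodic solution. -/
def xiT0 (T : ℝ) (w : ℝ → Vec m) : Vec n :=
  mact (1 - NormedSpace.exp (T • sys.F))⁻¹
    (∫ s in (0 : ℝ)..T, mact (NormedSpace.exp ((T - s) • sys.F) * sys.B) (w s))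

/-- The `T`-periodic solution of the linearised system `ξ' = F ξ + B w`. -/
def xiT (T : ℝ) (w : ℝ → Vec m) (t : ℝ) : Vec n :=
  mact (NormedSpace.exp (t • sys.F)) (sys.xiT0 T w)
    + ∫ s in (0 : ℝ)..t, mact (NormedSpace.exp ((t - s) • sys.F) * sys.B) (w s)

/-- The `T`-periodic output of the linearised system. -/
def etaT (T : ℝ) (w : ℝ → Vec m) (t : ℝ) : Vec p := mact sys.C (sys.xiT T w t)

/-- The convex compact whose support function is `u ↦ ∫₀ᵗ σ_Θ(Eᵀ exp(s Fᵀ) u) ds`. -/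
def Xi (t : ℝ) : Set (Vec n) :=
  {v | ∀ u : Vec n, inner ℝ u v ≤ ∫ s in (0 : ℝ)..t,
    supportFun sys.Theta (mact (sys.E.transpose * NormedSpace.exp (s • sys.F.transpose)) u)}

/-- The closure of the union of the sets `Ξ(t)`, `t ≥ 0`. -/
def XiInf : Set (Vec n) := closure (⋃ t ∈ Ici (0 : ℝ), sys.Xi t)

/-- The oscillation of the output of the periodic linearised regime over `[0, T]`. -/
def mho (T : ℝ) (w : ℝ → Vec m) : ℝ := Metric.diam (sys.etaT T w '' Icc 0 T)

/-- `d = diam(C Ξ_∞ + Θ)`. -/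
def d : ℝ := Metric.diam (mact sys.C '' sys.XiInf + sys.Theta)

/-- `γ₁ = (℧ - d)₊ / (T R)`. -/
def gamma1 (R T : ℝ) (w : ℝ → Vec m) : ℝ := 1 / (T * R) * max (sys.mho T w - sys.d) 0

/-- `γ_∞ = (‖η_T'‖_∞ + D(C (F Ξ_∞ + E Θ), {0})) / R`. -/
def gammaInf (R T : ℝ) (w : ℝ → Vec m) : ℝ :=
  1 / R * ((eLpNorm (deriv (sys.etaT T w)) ⊤ (volume.restrict (Icc 0 T))).toReal
    + hausdorffDeviation
        (mact sys.C '' (mact sys.F '' sys.XiInf + mact sys.E '' sys.Theta)) {0})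

/-- `θ = ψ(0) - (γ₁ / γ_∞) (ψ(0) - ψ(γ_∞))`; it is equal to `ψ(0)` if `γ_∞ = 0`. -/
def theta (P : Matrix (Fin n) (Fin n) ℝ) (lam R T : ℝ) (w : ℝ → Vec m) : ℝ :=
  sys.psi P lam 0 - sys.gamma1 R T w / sys.gammaInf R T w
    * (sys.psi P lam 0 - sys.psi P lam (sys.gammaInf R T w))

end BacklashSystem

/-- `γ = (|z₁'| + |z₂'|) / (2 R)`. -/
def gammaRate {p : ℕ} (R : ℝ) (z₁ z₂ : ℝ → Vec p) (t : ℝ) : ℝ :=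
  1 / (2 * R) * (‖deriv z₁ t‖ + ‖deriv z₂ t‖)

/-- `z` is `T`-periodic on `[0, ∞)`. -/
def IsPeriodicOnHalfLine {k : ℕ} (T : ℝ) (z : ℝ → Vec k) : Prop :=
  ∀ t : ℝ, 0 ≤ t → z (t + T) = z t

end

/-! ### Absolutely continuous functions -/

namespace AbsolutelyContinuousOnInterval

/-! Contraction. Let `dx`, `dq` be the differences of the states and of `q`. Since `z = q + C x`,
the state equation is `x' = F x + B w + E q`, and the common input cancels in `dx' = F dx + E dq`.
Half the derivative of `V` is then a quadratic form in `dx`, `dq` plus the inner product of `dq`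
with `z₁' - z₂'`. Each `z_k'` is an inward normal at `q_k`, and a ball of radius `R` supported at
`q_k` contains `Θ`, so this product is at most `-γ |dq|²`. The Lyapunov inequality and
Cauchy–Schwarz bound the rest by a form in `a = |dx|_Π` and `b = |dq|`; in total `-λ a² + 2 √β a b -
(α + γ) b²`, whose largest eigenvalue is `ψ(γ)`. Gronwall's inequality gives the bound on `√V`.

Mean rate. Variation of constants gives `x = ξ_T + transient + r` with `r` in `Ξ_∞`, hence `z = η_T
+ transient + (C r + q)`. Over a period `z` must therefore travel at least `diam η_T - diam(C Ξ_∞ +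
Θ)`, up to a vanishing error, so the mean of `γ` is asymptotically at least `γ₁`. In the other
direction `z'` is orthogonal to `q' = z' - y'`, because `q` stays in `Θ`; hence `|z'| ≤ |y'|`, and
the same decomposition of `y'` bounds `γ` asymptotically by `γ_∞`. The convex `ψ` lies below its
chord over `[0, γ_∞]`; averaging this affine bound produces `θ`.

Periodic regime. The differential inclusion does not obviously pass to limits, so trajectories are
recast through two-point estimates with errors quadratic in the time increment
(`IsQuadraticSolution`). These are closed under pointwise limits and imply the equations almost
everywhere. They serve twice: the catching-up scheme satisfies them uniformly in its step, which
yields a trajectory by compactness; and for `θ < 0` the shifts of that trajectory by multiples of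
`T` form a Cauchy sequence, by the contraction between the trajectory and its own shift, whose limit
is the periodic trajectory. Contraction also gives its uniqueness and attraction. -/

theorem comp_lipschitzOnWith {X Y : Type*} [PseudoMetricSpace X] [PseudoMetricSpace Y]
    {f : ℝ → X} {a b : ℝ} (hf : AbsolutelyContinuousOnInterval f a b) {φ : X → Y} {K : NNReal}
    {s : Set X} (hφ : LipschitzOnWith K φ s) (hs : MapsTo f (uIcc a b) s) :
    AbsolutelyContinuousOnInterval (fun t => φ (f t)) a b := by
  rw [absolutelyContinuousOnInterval_iff] at hf ⊢
  intro ε hε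
  obtain ⟨δ, hδ, h⟩ := hf (ε / (K + 1)) (by positivity)
  refine ⟨δ, hδ, fun I hI hlen => ?_⟩
  have h1 := h I hI hlen
  calc ∑ i ∈ Finset.range I.1, dist (φ (f (I.2 i).1)) (φ (f (I.2 i).2))
      ≤ ∑ i ∈ Finset.range I.1, K * dist (f (I.2 i).1) (f (I.2 i).2) :=
        Finset.sum_le_sum fun i hi =>
          hφ.dist_le_mul _ (hs (hI.1 i hi).1) _ (hs (hI.1 i hi).2)
    _ = K * ∑ i ∈ Finset.range I.1, dist (f (I.2 i).1) (f (I.2 i).2) := by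
        rw [Finset.mul_sum]
    _ ≤ (K + 1) * ∑ i ∈ Finset.range I.1, dist (f (I.2 i).1) (f (I.2 i).2) := by
        gcongr
        linarith
    _ < (K + 1) * (ε / (K + 1)) := by gcongr
    _ = ε := by field_simp

theorem prodMk {X Y : Type*} [PseudoMetricSpace X] [PseudoMetricSpace Y]
    {f : ℝ → X} {g : ℝ → Y} {a b : ℝ} (hf : AbsolutelyContinuousOnInterval f a b)
    (hg : AbsolutelyContinuousOnInterval g a b) :
    AbsolutelyContinuousOnInterval (fun t => (f t, g t)) a b := by
  have := Tendsto.add hf hg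
  rw [add_zero] at this
  refine squeeze_zero (fun E => Finset.sum_nonneg fun i _ => dist_nonneg) (fun E => ?_) this
  rw [← Finset.sum_add_distrib]
  refine Finset.sum_le_sum fun i _ => ?_
  rw [Prod.dist_eq]
  exact max_le_add_of_nonneg dist_nonneg dist_nonneg

/-- The curve stays in a closed ball, which is compact and convex, and a `C¹` map is Lipschitz
there. -/
theorem comp_contDiff {X Y : Type*} [NormedAddCommGroup X] [NormedSpace ℝ X] [ProperSpace X]
    [NormedAddCommGroup Y] [NormedSpace ℝ Y] {f : ℝ → X} {a b : ℝ}
    (hf : AbsolutelyContinuousOnInterval f a b) {φ : X → Y} (hφ : ContDiff ℝ 1 φ) :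
    AbsolutelyContinuousOnInterval (fun t => φ (f t)) a b := by
  obtain ⟨c, hc⟩ := hf.exists_bound
  obtain ⟨K, hK⟩ := (hφ.contDiffOn (s := Metric.closedBall (0 : X) c)).exists_lipschitzOnWith
    (by decide) (convex_closedBall _ _) (isCompact_closedBall _ _)
  exact hf.comp_lipschitzOnWith hK fun t ht => by simpa using hc t ht

theorem ae_differentiableAt_vec {r : ℕ} {f : ℝ → Vec r} {a b : ℝ}
    (hf : AbsolutelyContinuousOnInterval f a b) :
    ∀ᵐ t, t ∈ uIcc a b → DifferentiableAt ℝ f t :=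
  hf.boundedVariationOn.ae_differentiableAt_of_mem_uIcc

theorem component {r : ℕ} {f : ℝ → Vec r} {a b : ℝ}
    (hf : AbsolutelyContinuousOnInterval f a b) (i : Fin r) :
    AbsolutelyContinuousOnInterval (fun t => f t i) a b :=
  hf.comp_contDiff (φ := fun v : Vec r => v i) (by fun_prop)

theorem deriv_component {r : ℕ} {f : ℝ → Vec r} {t : ℝ} (h : DifferentiableAt ℝ f t) (i : Fin r) :
    deriv (fun t => f t i) t = deriv f t i :=
  ((EuclideanSpace.proj (𝕜 := ℝ) i).hasFDerivAt.comp_hasDerivAt t h.hasDerivAt).deriv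

theorem intervalIntegrable_deriv_vec {r : ℕ} {f : ℝ → Vec r} {a b : ℝ}
    (hf : AbsolutelyContinuousOnInterval f a b) : IntervalIntegrable (deriv f) volume a b := by
  have h : ∀ i, IntervalIntegrable (fun t => deriv f t i) volume a b := fun i => by
    refine (hf.component i).intervalIntegrable_deriv.congr_ae ?_
    rw [EventuallyEq, ae_restrict_iff' measurableSet_uIoc]
    filter_upwards [hf.ae_differentiableAt_vec] with t ht hmem
    exact deriv_component (ht (uIoc_subset_uIcc hmem)) i
  rw [intervalIntegrable_iff]
  exact Integrable.of_eval_piLp fun i => (intervalIntegrable_iff.1 (h i))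

theorem integral_deriv_vec {r : ℕ} {f : ℝ → Vec r} {a b : ℝ}
    (hf : AbsolutelyContinuousOnInterval f a b) : ∫ t in a..b, deriv f t = f b - f a := by
  ext i
  have h := (EuclideanSpace.proj (𝕜 := ℝ) i).intervalIntegral_comp_comm
    hf.intervalIntegrable_deriv_vec
  change ∫ t in a..b, deriv f t i = (∫ t in a..b, deriv f t) i at h
  rw [← h, PiLp.sub_apply, ← (hf.component i).integral_deriv_eq_sub]
  refine intervalIntegral.integral_congr_ae ?_
  filter_upwards [hf.ae_differentiableAt_vec] with t ht hmem
  exact (deriv_component (ht (uIoc_subset_uIcc hmem)) i).symm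

theorem le_of_ae_deriv_nonpos {f : ℝ → ℝ} {a b : ℝ} (hab : a ≤ b)
    (hf : AbsolutelyContinuousOnInterval f a b)
    (hd : ∀ᵐ t ∂volume.restrict (Icc a b), deriv f t ≤ 0) : f b ≤ f a := by
  have h := hf.integral_deriv_eq_sub
  have h' : ∫ t in a..b, deriv f t ≤ ∫ t in a..b, (0 : ℝ) :=
    intervalIntegral.integral_mono_ae_restrict hab hf.intervalIntegrable_deriv
      intervalIntegrable_const hd
  simp only [intervalIntegral.integral_zero] at h'
  linarith

/-- Gronwall's inequality for absolutely continuous functions. -/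
theorem le_mul_exp_integral {f φ : ℝ → ℝ} {a b : ℝ} (hab : a ≤ b)
    (hf : AbsolutelyContinuousOnInterval f a b) (hφ : IntervalIntegrable φ volume a b)
    (hd : ∀ᵐ t ∂volume.restrict (Icc a b), deriv f t ≤ φ t * f t) :
    f b ≤ f a * Real.exp (∫ t in a..b, φ t) := by
  have hΦ := hφ.absolutelyContinuousOnInterval_intervalIntegral (c := a) left_mem_uIcc
  set Φ : ℝ → ℝ := fun t => ∫ s in a..t, φ s with hΦdef
  have hg : AbsolutelyContinuousOnInterval (fun t => f t * Real.exp (-Φ t)) a b :=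
    (hf.prodMk hΦ).comp_contDiff (φ := fun u : ℝ × ℝ => u.1 * Real.exp (-u.2)) (by fun_prop)
  have key : f b * Real.exp (-Φ b) ≤ f a * Real.exp (-Φ a) := by
    refine hg.le_of_ae_deriv_nonpos hab ?_
    have h1 := hφ.ae_hasDerivAt_integral
    have h2 := hf.ae_differentiableAt
    rw [uIcc_of_le hab] at h1 h2
    rw [ae_restrict_iff' measurableSet_Icc] at hd ⊢
    filter_upwards [h1, h2, hd] with t h1 h2 h3 ht
    have hΦ' : HasDerivAt Φ (φ t) t := h1 ht a ⟨le_rfl, hab⟩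
    have hf' := (h2 ht).hasDerivAt
    have hd' : HasDerivAt (fun t => f t * Real.exp (-Φ t)) _ t := hf'.mul hΦ'.neg.exp
    rw [hd'.deriv]
    have := h3 ht
    simp only [Pi.neg_apply]
    have he := Real.exp_pos (-Φ t)
    nlinarith
  have h0 : Φ a = 0 := by simp [hΦdef]
  rw [h0, neg_zero, Real.exp_zero, mul_one] at key
  calc f b = f b * Real.exp (-Φ b) * Real.exp (Φ b) := by
        rw [mul_assoc, ← Real.exp_add, neg_add_cancel, Real.exp_zero, mul_one]
    _ ≤ f a * Real.exp (Φ b) := by gcongr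

end AbsolutelyContinuousOnInterval

/-! ### Matrices acting on Euclidean vectors -/

/-- The action of a real matrix on Euclidean vectors as a continuous linear map. -/
noncomputable def mactL {r s : ℕ} (M : Matrix (Fin r) (Fin s) ℝ) : Vec s →L[ℝ] Vec r :=
  LinearMap.toContinuousLinearMap (Matrix.toEuclideanLin M)

theorem mactL_apply {r s : ℕ} (M : Matrix (Fin r) (Fin s) ℝ) (v : Vec s) :
    mactL M v = mact M v := rfl

theorem mact_mul {r s k : ℕ} (M : Matrix (Fin r) (Fin s) ℝ) (N : Matrix (Fin s) (Fin k) ℝ)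
    (v : Vec k) : mact (M * N) v = mact M (mact N v) := by
  simp [mact, Matrix.toLpLin_apply, Matrix.mulVec_mulVec]

theorem mact_one {r : ℕ} (v : Vec r) : mact 1 v = v := by
  simp [mact]

theorem mact_add {r s : ℕ} (M N : Matrix (Fin r) (Fin s) ℝ) (v : Vec s) :
    mact (M + N) v = mact M v + mact N v := by
  simp [mact]

theorem mact_sub {r s : ℕ} (M N : Matrix (Fin r) (Fin s) ℝ) (v : Vec s) :
    mact (M - N) v = mact M v - mact N v := by
  simp [mact]

theorem mact_smul {r s : ℕ} (c : ℝ) (M : Matrix (Fin r) (Fin s) ℝ) (v : Vec s) :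
    mact (c • M) v = c • mact M v := by
  simp [mact]

theorem inner_mact {r s : ℕ} (M : Matrix (Fin r) (Fin s) ℝ) (u : Vec r) (v : Vec s) :
    inner ℝ u (mact M v) = inner ℝ (mact M.transpose u) v := by
  simp only [mact, Matrix.toLpLin_apply, EuclideanSpace.inner_eq_star_dotProduct,
    star_trivial]
  rw [Matrix.mulVec_transpose, dotProduct_comm, Matrix.dotProduct_mulVec, dotProduct_comm]

theorem Matrix.PosSemidef.inner_mact_nonneg {r : ℕ} {M : Matrix (Fin r) (Fin r) ℝ}
    (hM : M.PosSemidef) (v : Vec r) : 0 ≤ inner ℝ v (mact M v) := by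
  have h := hM.dotProduct_mulVec_nonneg v.ofLp
  simpa [mact, Matrix.toLpLin_apply, EuclideanSpace.inner_eq_star_dotProduct,
    dotProduct_comm] using h

theorem inner_mact_symmetrizer {r : ℕ} (M : Matrix (Fin r) (Fin r) ℝ) (v : Vec r) :
    inner ℝ v (mact (symmetrizer M) v) = inner ℝ v (mact M v) := by
  rw [symmetrizer, mact_smul, mact_add, inner_smul_right, inner_add_right,
    inner_mact M.transpose, Matrix.transpose_transpose, real_inner_comm v (mact M v)]
  ring

theorem symmetrizer_isHermitian {r : ℕ} (M : Matrix (Fin r) (Fin r) ℝ) :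
    (symmetrizer M).IsHermitian := by
  rw [Matrix.IsHermitian, Matrix.conjTranspose_eq_transpose_of_trivial, symmetrizer,
    Matrix.transpose_smul, Matrix.transpose_add, Matrix.transpose_transpose, add_comm]

theorem Matrix.IsHermitian.inner_mact_nonneg_of_spectrum {r : ℕ} {M : Matrix (Fin r) (Fin r) ℝ}
    (hM : M.IsHermitian) (h : ∀ c ∈ spectrum ℝ M, 0 ≤ c) (v : Vec r) :
    0 ≤ inner ℝ v (mact M v) :=
  (hM.posSemidef_iff_eigenvalues_nonneg.2 fun i =>
    h _ (hM.eigenvalues_mem_spectrum_real i)).inner_mact_nonneg v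

/-- Subtracting `lambdaMin M` from the diagonal shifts the spectrum into the nonnegative half-line.
-/
theorem Matrix.IsHermitian.lambdaMin_mul_le {r : ℕ} {M : Matrix (Fin r) (Fin r) ℝ}
    (hM : M.IsHermitian) (v : Vec r) : lambdaMin M * ‖v‖ ^ 2 ≤ inner ℝ v (mact M v) := by
  have hH : (M - algebraMap ℝ _ (lambdaMin M)).IsHermitian := by
    refine hM.sub ?_
    rw [Matrix.IsHermitian, Matrix.conjTranspose_eq_transpose_of_trivial,
      Matrix.algebraMap_eq_diagonal, Matrix.diagonal_transpose]
  have h := hH.inner_mact_nonneg_of_spectrum (fun c hc => by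
    rw [sub_eq_add_neg, add_comm, ← spectrum.add_mem_iff] at hc
    have : lambdaMin M ≤ c + lambdaMin M :=
      csInf_le (Matrix.finite_real_spectrum (A := M)).bddBelow hc
    linarith) v
  rw [mact_sub, inner_sub_right, Algebra.algebraMap_eq_smul_one, mact_smul, mact_one,
    inner_smul_right, real_inner_self_eq_norm_sq] at h
  linarith

theorem lambdaMax_eq_neg_lambdaMin {r : ℕ} (M : Matrix (Fin r) (Fin r) ℝ) :
    lambdaMax M = -lambdaMin (-M) := by
  rw [lambdaMax, lambdaMin, ← spectrum.neg_eq, Real.sInf_def, neg_neg, neg_neg]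

theorem Matrix.IsHermitian.le_lambdaMax_mul {r : ℕ} {M : Matrix (Fin r) (Fin r) ℝ}
    (hM : M.IsHermitian) (v : Vec r) : inner ℝ v (mact M v) ≤ lambdaMax M * ‖v‖ ^ 2 := by
  have h := hM.neg.lambdaMin_mul_le v
  rw [← zero_sub M, mact_sub, inner_sub_right, zero_sub] at h
  rw [lambdaMax_eq_neg_lambdaMin]
  have h0 : mact (0 : Matrix (Fin r) (Fin r) ℝ) v = 0 := by simp [mact]
  rw [h0, inner_zero_right] at h
  linarith

/-- Order zero is included: the supremum of the empty spectrum is `0`. -/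
theorem Matrix.PosSemidef.lambdaMax_nonneg {r : ℕ} {M : Matrix (Fin r) (Fin r) ℝ}
    (hM : M.PosSemidef) : 0 ≤ lambdaMax M := by
  refine Real.sSup_nonneg fun c hc => ?_
  rw [hM.1.spectrum_real_eq_range_eigenvalues] at hc
  obtain ⟨i, rfl⟩ := hc
  exact hM.eigenvalues_nonneg i

theorem inner_mact_comm {r : ℕ} {P : Matrix (Fin r) (Fin r) ℝ} (hP : P.IsHermitian)
    (u v : Vec r) : inner ℝ u (mact P v) = inner ℝ v (mact P u) := by
  rw [Matrix.IsHermitian, Matrix.conjTranspose_eq_transpose_of_trivial] at hP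
  rw [inner_mact, hP, real_inner_comm]

/-- The Cauchy-Schwarz inequality for the form of a positive semidefinite matrix. -/
theorem Matrix.PosSemidef.inner_mact_sq_le {r : ℕ} {P : Matrix (Fin r) (Fin r) ℝ}
    (hP : P.PosSemidef) (u v : Vec r) :
    inner ℝ u (mact P v) ^ 2 ≤ inner ℝ u (mact P u) * inner ℝ v (mact P v) := by
  have h : ∀ c : ℝ, 0 ≤ inner ℝ v (mact P v) * (c * c) + (2 * inner ℝ u (mact P v)) * c
      + inner ℝ u (mact P u) := fun c => by
    have := hP.inner_mact_nonneg (u + c • v)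
    simp only [mact, map_add, map_smul, inner_add_left, inner_add_right, inner_smul_left,
      inner_smul_right, conj_trivial] at this
    have hc := inner_mact_comm hP.1 u v
    simp only [mact] at hc ⊢
    rw [← hc] at this
    linarith
  have := discrim_le_zero h
  rw [discrim] at this
  nlinarith

/-- Cauchy–Schwarz in the form of `P`, applied to `v` and `P⁻¹ v`, bounds `|v|⁴` by the product of
the forms of `P` and `P⁻¹` at `v`; the latter is at most `‖P⁻¹‖ |v|²`. The added `1` keeps the
constant positive. -/
theorem Matrix.PosDef.exists_norm_sq_le {r : ℕ} {P : Matrix (Fin r) (Fin r) ℝ} (hP : P.PosDef) :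
    ∃ c : ℝ, 0 < c ∧ ∀ v : Vec r, ‖v‖ ^ 2 ≤ c * inner ℝ v (mact P v) := by
  refine ⟨‖mactL P⁻¹‖ + 1, by positivity, fun v => ?_⟩
  have hinv : mact P (mact P⁻¹ v) = v := by
    rw [← mact_mul, Matrix.mul_nonsing_inv _ ((Matrix.isUnit_iff_isUnit_det _).1 hP.isUnit),
      mact_one]
  have h := hP.posSemidef.inner_mact_sq_le v (mact P⁻¹ v)
  rw [hinv, real_inner_self_eq_norm_sq] at h
  have h1 : inner ℝ (mact P⁻¹ v) v ≤ (‖mactL P⁻¹‖ + 1) * ‖v‖ ^ 2 := by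
    have h2 := real_inner_le_norm (mact P⁻¹ v) v
    have h3 := (mactL P⁻¹).le_opNorm v
    rw [mactL_apply] at h3
    nlinarith [norm_nonneg v, sq_nonneg ‖v‖]
  have h4 := hP.posSemidef.inner_mact_nonneg v
  rcases (sq_nonneg ‖v‖).eq_or_lt with h0 | h0
  · rw [← h0]; positivity
  · nlinarith

namespace BacklashSystem

variable {m n p : ℕ} (sys : BacklashSystem m n p)

/-! ### The rate function -/

theorem posSemidef_beta {P : Matrix (Fin n) (Fin n) ℝ} (hP : P.PosDef) :
    ((sys.H P).transpose * P⁻¹ * sys.H P).PosSemidef := by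
  have := hP.inv.posSemidef.conjTranspose_mul_mul_same (sys.H P)
  rwa [Matrix.conjTranspose_eq_transpose_of_trivial] at this

theorem beta_nonneg {P : Matrix (Fin n) (Fin n) ℝ} (hP : P.PosDef) : 0 ≤ sys.beta P :=
  (sys.posSemidef_beta hP).lambdaMax_nonneg

theorem alpha_mul_le (v : Vec p) :
    sys.alpha * ‖v‖ ^ 2 ≤ inner ℝ v (mact (sys.C * sys.E) v) := by
  rw [← inner_mact_symmetrizer]
  exact (symmetrizer_isHermitian _).lambdaMin_mul_le v

/-- Cauchy–Schwarz in the form of `P`, applied to `x` and `P⁻¹ H v`; the second factor is the form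
of `Hᵀ P⁻¹ H` at `v`. -/
theorem inner_H_le {P : Matrix (Fin n) (Fin n) ℝ} (hP : P.PosDef) (x : Vec n) (v : Vec p) :
    inner ℝ x (mact (sys.H P) v)
      ≤ Real.sqrt (sys.beta P) * (Real.sqrt (inner ℝ x (mact P x)) * ‖v‖) := by
  have hinv : mact P (mact P⁻¹ (mact (sys.H P) v)) = mact (sys.H P) v := by
    rw [← mact_mul P, Matrix.mul_nonsing_inv _ ((Matrix.isUnit_iff_isUnit_det _).1 hP.isUnit),
      mact_one]
  have h := hP.posSemidef.inner_mact_sq_le x (mact P⁻¹ (mact (sys.H P) v))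
  rw [hinv] at h
  have hb := (sys.posSemidef_beta hP).1.le_lambdaMax_mul v
  rw [mact_mul, mact_mul, inner_mact, Matrix.transpose_transpose, real_inner_comm] at hb
  have hx := hP.posSemidef.inner_mact_nonneg x
  have hβ := sys.beta_nonneg hP
  have h' : inner ℝ x (mact (sys.H P) v) ^ 2 ≤ sys.beta P * (inner ℝ x (mact P x) * ‖v‖ ^ 2) := by
    rw [beta]
    nlinarith [mul_le_mul_of_nonneg_left hb hx]
  refine le_trans (le_abs_self _) ((Real.abs_le_sqrt h').trans (le_of_eq ?_))
  rw [Real.sqrt_mul hβ, Real.sqrt_mul hx, Real.sqrt_sq (norm_nonneg _)]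

/-- The square root is the Euclidean norm of `(√β, X / 2)` with `X` affine in `u`, hence convex; the
rest of `ψ` is affine. -/
theorem psi_convexOn {P : Matrix (Fin n) (Fin n) ℝ} (hP : P.PosDef) (lam : ℝ) :
    ConvexOn ℝ (Ici 0) (sys.psi P lam) := by
  refine ⟨convex_Ici 0, fun u _ v _ a b ha hb hab => ?_⟩
  simp only [psi, smul_eq_mul]
  have hβ := sys.beta_nonneg hP
  set β := sys.beta P
  set X := sys.alpha - lam + u
  set Y := sys.alpha - lam + v
  have hXY : sys.alpha - lam + (a * u + b * v) = a * X + b * Y := by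
    simp only [X, Y]; linear_combination (-sys.alpha + lam) * hab
  have key : Real.sqrt (β + 1 / 4 * (a * X + b * Y) ^ 2)
      ≤ a * Real.sqrt (β + 1 / 4 * X ^ 2) + b * Real.sqrt (β + 1 / 4 * Y ^ 2) := by
    have hX := Real.sq_sqrt (show 0 ≤ β + 1 / 4 * X ^ 2 by positivity)
    have hY := Real.sq_sqrt (show 0 ≤ β + 1 / 4 * Y ^ 2 by positivity)
    have hX0 := Real.sqrt_nonneg (β + 1 / 4 * X ^ 2)
    have hY0 := Real.sqrt_nonneg (β + 1 / 4 * Y ^ 2)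
    set p := Real.sqrt (β + 1 / 4 * X ^ 2)
    set q := Real.sqrt (β + 1 / 4 * Y ^ 2)
    -- Cauchy–Schwarz for the plane vectors `(√β, X / 2)` and `(√β, Y / 2)`; it controls the cross
    -- term of the square below.
    have hpq : β + 1 / 4 * (X * Y) ≤ p * q := by
      refine (abs_le_of_sq_le_sq' ?_ (mul_nonneg hX0 hY0)).2
      rw [mul_pow, hX, hY]
      nlinarith [mul_nonneg hβ (sq_nonneg (X - Y))]
    refine Real.sqrt_le_iff.2 ⟨by positivity, ?_⟩
    have h2 : (a * p + b * q) ^ 2 = a ^ 2 * (β + 1 / 4 * X ^ 2) + b ^ 2 * (β + 1 / 4 * Y ^ 2)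
        + 2 * (a * b) * (p * q) := by rw [← hX, ← hY]; ring
    have h3 : β = (a + b) ^ 2 * β := by rw [hab]; ring
    rw [h2]
    nlinarith [mul_le_mul_of_nonneg_left hpq (mul_nonneg ha hb)]
  rw [hXY]
  have : 1 / 2 * (sys.alpha + lam + (a * u + b * v))
      = a * (1 / 2 * (sys.alpha + lam + u)) + b * (1 / 2 * (sys.alpha + lam + v)) := by
    linear_combination (-(1 / 2) * sys.alpha - (1 / 2) * lam) * hab
  rw [this]
  linarith

/-- The norm of `(√β, X / 2)` is `1/2`-Lipschitz in `X`. Together with the linear term of slope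
`-1/2` this confines the slope of `ψ` to `[-1, 0]`. -/
theorem abs_sqrt_sub_sqrt_le {β : ℝ} (hβ : 0 ≤ β) (X Y : ℝ) :
    Real.sqrt (β + 1 / 4 * Y ^ 2) ≤ Real.sqrt (β + 1 / 4 * X ^ 2) + 1 / 2 * |Y - X| := by
  have hX := Real.sq_sqrt (show 0 ≤ β + 1 / 4 * X ^ 2 by positivity)
  have hX1 : |X| / 2 ≤ Real.sqrt (β + 1 / 4 * X ^ 2) :=
    Real.le_sqrt_of_sq_le (by rw [div_pow, sq_abs]; linarith)
  refine Real.sqrt_le_iff.2 ⟨by positivity, ?_⟩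
  have h2 : Y * Y ≤ X ^ 2 + 2 * (|X| * |Y - X|) + |Y - X| ^ 2 := by
    rw [sq_abs, ← abs_mul]; nlinarith [le_abs_self (X * (Y - X))]
  nlinarith [mul_le_mul_of_nonneg_right hX1 (abs_nonneg (Y - X))]

theorem psi_antitone {P : Matrix (Fin n) (Fin n) ℝ} (hP : P.PosDef) (lam : ℝ) :
    Antitone (sys.psi P lam) := by
  intro u v huv
  simp only [psi]
  have h := abs_sqrt_sub_sqrt_le (sys.beta_nonneg hP) (sys.alpha - lam + u) (sys.alpha - lam + v)
  rw [show sys.alpha - lam + v - (sys.alpha - lam + u) = v - u by ring,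
    abs_of_nonneg (sub_nonneg.2 huv)] at h
  linarith

theorem psi_sub_le {P : Matrix (Fin n) (Fin n) ℝ} (hP : P.PosDef) (lam : ℝ) {u v : ℝ}
    (huv : u ≤ v) : sys.psi P lam u - sys.psi P lam v ≤ v - u := by
  simp only [psi]
  have h := abs_sqrt_sub_sqrt_le (sys.beta_nonneg hP) (sys.alpha - lam + v) (sys.alpha - lam + u)
  rw [show sys.alpha - lam + u - (sys.alpha - lam + v) = u - v by ring,
    abs_of_nonpos (sub_nonpos.2 huv)] at h
  linarith

theorem continuous_psi (P : Matrix (Fin n) (Fin n) ℝ) (lam : ℝ) :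
    Continuous (sys.psi P lam) := by
  unfold psi
  fun_prop

/-- `ψ(u)` bounds the form of the symmetric matrix with the diagonal `(-lam, -(α + u))` and the
off-diagonal entry `√β`. -/
theorem form_le_psi {P : Matrix (Fin n) (Fin n) ℝ} (hP : P.PosDef) (lam u a b : ℝ) :
    -lam * a ^ 2 + 2 * (Real.sqrt (sys.beta P) * (a * b)) - (sys.alpha + u) * b ^ 2
      ≤ sys.psi P lam u * (a ^ 2 + b ^ 2) := by
  simp only [psi]
  have hβ := Real.sq_sqrt (sys.beta_nonneg hP)
  have hs := Real.sq_sqrt (show 0 ≤ sys.beta P + 1 / 4 * (sys.alpha - lam + u) ^ 2 by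
    have := sys.beta_nonneg hP; positivity)
  have hs0 := Real.sqrt_nonneg (sys.beta P + 1 / 4 * (sys.alpha - lam + u) ^ 2)
  rw [← hβ] at hs ⊢
  simp only [Real.sqrt_sq (Real.sqrt_nonneg _)] at *
  set g := Real.sqrt (sys.beta P)
  set s := Real.sqrt (g ^ 2 + 1 / 4 * (sys.alpha - lam + u) ^ 2)
  set d := 1 / 2 * (sys.alpha - lam + u) with hd
  have hs' : s ^ 2 = g ^ 2 + d ^ 2 := by rw [hs, hd]; ring
  -- Cauchy–Schwarz for `(g, d)`, of length `s`, and `(2ab, a² - b²)`, of length `a² + b²`; the hint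
  -- is the square in Lagrange's identity.
  have h1 : 2 * g * (a * b) + d * (a ^ 2 - b ^ 2) ≤ s * (a ^ 2 + b ^ 2) := by
    refine (abs_le_of_sq_le_sq' ?_ (by positivity)).2
    rw [mul_pow, hs']
    nlinarith [sq_nonneg (g * (a ^ 2 - b ^ 2) - d * (2 * (a * b)))]
  have h2 : -lam * a ^ 2 + 2 * (g * (a * b)) - (sys.alpha + u) * b ^ 2
      = 2 * g * (a * b) + d * (a ^ 2 - b ^ 2) - 1 / 2 * (sys.alpha + lam + u) * (a ^ 2 + b ^ 2) := by
    rw [hd]; ring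
  rw [h2]
  linarith

end BacklashSystem

/-! ### Strongly convex sets -/

/-- The infimum is attained, since the ball inclusions pass to the limit along admissible radii
tending to `R`. -/
theorem IsStronglyConvexWith.mem_supportingBallRadii {k : ℕ} {S : Set (Vec k)} {R : ℝ}
    (h : IsStronglyConvexWith S R) : R ∈ supportingBallRadii S := by
  obtain ⟨r, -, -, hr, hmem⟩ := h.exists_seq_antitone_tendsto h.nonempty
  refine ⟨ge_of_tendsto' hr fun i => (hmem i).1, fun u hu v hv hv1 s hs => ?_⟩
  have h1 : ∀ i, dist s (u + r i • v) ≤ r i := fun i => (hmem i).2 u hu v hv hv1 hs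
  exact le_of_tendsto_of_tendsto'
    (tendsto_const_nhds.dist (tendsto_const_nhds.add (hr.smul_const v))) hr h1

/-- A nonzero normal exists only at a boundary point, since from an interior point one could move a
little along `-s`. The ball of radius `R` supported at `u` along `s / ‖s‖` contains `v`; squaring
this inclusion cancels `R²` and leaves the estimate. -/
theorem IsStronglyConvexWith.inner_normal_le {k : ℕ} {S : Set (Vec k)} {R : ℝ} (hR : 0 < R)
    (h : IsStronglyConvexWith S R) (hS : IsClosed S) {u v s : Vec k} (hu : u ∈ S) (hv : v ∈ S)
    (hs : s ∈ inwardNormalCone S u) :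
    inner ℝ (u - v) s ≤ -(1 / (2 * R) * ‖s‖ * ‖u - v‖ ^ 2) := by
  rcases eq_or_ne s 0 with rfl | hs0
  · simp
  have hn : 0 < ‖s‖ := norm_pos_iff.2 hs0
  have hfr : u ∈ frontier S := by
    rw [hS.frontier_eq]
    refine ⟨hu, fun hint => ?_⟩
    have hc : Tendsto (fun ε : ℝ => u - ε • s) (𝓝[>] 0) (𝓝 u) := by
      refine tendsto_nhdsWithin_of_tendsto_nhds ?_
      have : Continuous fun ε : ℝ => u - ε • s := by fun_prop
      simpa using this.tendsto 0
    obtain ⟨ε, hε, hε0⟩ := ((hc.eventually (mem_interior_iff_mem_nhds.1 hint)).and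
      self_mem_nhdsWithin).exists
    have h1 := hs _ hε
    rw [sub_sub_cancel_left, inner_neg_right, inner_smul_right, real_inner_self_eq_norm_sq] at h1
    have : 0 < ε * ‖s‖ ^ 2 := mul_pos hε0 (by positivity)
    linarith
  have hunit : ‖‖s‖⁻¹ • s‖ = 1 := by
    rw [norm_smul, norm_inv, norm_norm, inv_mul_cancel₀ hn.ne']
  have hcone : ‖s‖⁻¹ • s ∈ inwardNormalCone S u := fun v hv => by
    rw [inner_smul_left]
    exact mul_nonneg (by simp) (hs v hv)
  have hball := h.mem_supportingBallRadii.2 u hfr _ hcone hunit hv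
  rw [Metric.mem_closedBall, dist_eq_norm] at hball
  have h2 : ‖v - (u + R • ‖s‖⁻¹ • s)‖ ^ 2 ≤ R ^ 2 :=
    pow_le_pow_left₀ (norm_nonneg _) hball 2
  rw [show v - (u + R • ‖s‖⁻¹ • s) = -((u - v) + R • ‖s‖⁻¹ • s) by abel, norm_neg,
    norm_add_sq_real, norm_smul R, hunit, inner_smul_right, inner_smul_right, mul_one,
    Real.norm_eq_abs, sq_abs] at h2
  have h3 : ‖u - v‖ ^ 2 + 2 * (R * (‖s‖⁻¹ * inner ℝ (u - v) s)) ≤ 0 := by linarith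
  have h4 : inner ℝ (u - v) s = ‖s‖ * (‖s‖⁻¹ * inner ℝ (u - v) s) := by field_simp
  rw [h4]
  have h5 : ‖s‖⁻¹ * inner ℝ (u - v) s ≤ -(1 / (2 * R) * ‖u - v‖ ^ 2) := by
    rw [← sub_nonneg] at h3 ⊢
    have : -(1 / (2 * R) * ‖u - v‖ ^ 2) - ‖s‖⁻¹ * inner ℝ (u - v) s
      = (0 - (‖u - v‖ ^ 2 + 2 * (R * (‖s‖⁻¹ * inner ℝ (u - v) s)))) / (2 * R) := by
      field_simp
      ring
    rw [this]
    positivity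
  nlinarith

/-- As `f` stays in `S` on both sides of `t`, its inner product with the normal `v` has a local
minimum at `t`. -/
theorem inwardNormalCone_orthogonal_deriv {k : ℕ} {S : Set (Vec k)} {f : ℝ → Vec k} {f' : Vec k}
    {t : ℝ} (hf : HasDerivAt f f' t) (hmem : ∀ᶠ s in 𝓝 t, f s ∈ S) {v : Vec k}
    (hv : v ∈ inwardNormalCone S (f t)) : inner ℝ v f' = 0 := by
  have hd : HasDerivAt (fun s => inner ℝ v (f s)) (inner ℝ v f') t :=
    ((innerSL ℝ v).hasFDerivAt.comp_hasDerivAt t hf)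
  refine IsLocalMin.hasDerivAt_eq_zero ?_ hd
  filter_upwards [hmem] with s hs
  have := hv _ hs
  rw [inner_sub_right] at this
  linarith

namespace BacklashSystem

variable {m n p : ℕ} {sys : BacklashSystem m n p}

/-! ### Trajectories -/

theorem hasDerivAt_y {x : ℝ → Vec n} {x' : Vec n} {t : ℝ} (h : HasDerivAt x x' t) :
    HasDerivAt (sys.y x) (mact sys.C x') t :=
  (mactL sys.C).hasFDerivAt.comp_hasDerivAt t h

namespace IsTrajectory

variable {w : ℝ → Vec m} {x : ℝ → Vec n} {z : ℝ → Vec p}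

/-- Substituting `z = q + C x` turns `A x + E z` into `F x + E q`. The time `0` is discarded so that
`q` lies in `Θ` on a two-sided neighbourhood. -/
theorem ae_regular (h : sys.IsTrajectory w x z) :
    ∀ᵐ t ∂volume.restrict (Ici (0 : ℝ)), 0 < t ∧
      HasDerivAt x (mact sys.F (x t) + mact sys.B (w t) + mact sys.E (sys.q x z t)) t ∧
      HasDerivAt z (deriv z t) t ∧
      deriv z t ∈ inwardNormalCone sys.Theta (sys.q x z t) := by
  have h0 : ∀ᵐ t ∂volume.restrict (Ici (0 : ℝ)), 0 < t := by
    rw [← restrict_Ioi_eq_restrict_Ici]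
    exact ae_restrict_mem measurableSet_Ioi
  filter_upwards [h0, h.linear_part, h.backlash_part] with t h0 h1 h2
  refine ⟨h0, ?_, h2.1.hasDerivAt, h2.2.1⟩
  convert h1 using 1
  simp only [F, mact_add, mact_mul, q, y, map_sub]
  abel

theorem hasDerivAt_q {x' : Vec n} {t : ℝ} (hx : HasDerivAt x x' t)
    (hz : HasDerivAt z (deriv z t) t) :
    HasDerivAt (sys.q x z) (deriv z t - mact sys.C x') t :=
  hz.sub (hasDerivAt_y hx)

/-- The normal `z'` is orthogonal to `q' = z' - y'`, so `|z'|²` is the inner product of `z'` and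
`y'`. -/
theorem ae_norm_deriv_z_le (h : sys.IsTrajectory w x z) :
    ∀ᵐ t ∂volume.restrict (Ici (0 : ℝ)),
      ‖deriv z t‖
        ≤ ‖mact sys.C (mact sys.F (x t) + mact sys.B (w t) + mact sys.E (sys.q x z t))‖ := by
  filter_upwards [h.ae_regular] with t ht
  obtain ⟨h0, h1, h2, h3⟩ := ht
  have horth := inwardNormalCone_orthogonal_deriv (hasDerivAt_q h1 h2)
    ((eventually_gt_nhds h0).mono fun s hs => h.mem_theta s hs.le) h3
  rw [inner_sub_right, real_inner_self_eq_norm_sq, sub_eq_zero] at horth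
  have h4 := real_inner_le_norm (deriv z t)
    (mact sys.C (mact sys.F (x t) + mact sys.B (w t) + mact sys.E (sys.q x z t)))
  rw [← horth] at h4
  rcases (norm_nonneg (deriv z t)).eq_or_lt with h5 | h5
  · rw [← h5]; positivity
  · nlinarith

end IsTrajectory

/-! ### Decay of the Lyapunov function along pairs of trajectories. -/

theorem absolutelyContinuousOnInterval_V {w₁ w₂ : ℝ → Vec m} {x₁ x₂ : ℝ → Vec n}
    {z₁ z₂ : ℝ → Vec p} (h₁ : sys.IsTrajectory w₁ x₁ z₁) (h₂ : sys.IsTrajectory w₂ x₂ z₂)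
    (P : Matrix (Fin n) (Fin n) ℝ) {t : ℝ} (ht : 0 ≤ t) :
    AbsolutelyContinuousOnInterval (sys.V P x₁ z₁ x₂ z₂) 0 t :=
  (((h₁.ac_x t ht).prodMk (h₁.ac_z t ht)).prodMk
    ((h₂.ac_x t ht).prodMk (h₂.ac_z t ht))).comp_contDiff
    (φ := fun u : (Vec n × Vec p) × Vec n × Vec p =>
      inner ℝ (u.1.1 - u.2.1) (mactL P (u.1.1 - u.2.1))
        + ‖(u.1.2 - mactL sys.C u.1.1) - (u.2.2 - mactL sys.C u.2.1)‖ ^ 2)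
    (by
      refine ContDiff.add (ContDiff.inner ℝ (by fun_prop) (by fun_prop))
        (ContDiff.norm_sq ℝ (by fun_prop)))

theorem V_nonneg {P : Matrix (Fin n) (Fin n) ℝ} (hP : P.PosDef) (x₁ x₂ : ℝ → Vec n)
    (z₁ z₂ : ℝ → Vec p) (t : ℝ) : 0 ≤ sys.V P x₁ z₁ x₂ z₂ t :=
  add_nonneg (hP.posSemidef.inner_mact_nonneg _) (sq_nonneg _)

theorem inner_mact_F_le {P : Matrix (Fin n) (Fin n) ℝ} {lam : ℝ}
    (hLyap : (-lam • P - symmetrizer (P * sys.F)).PosSemidef) (v : Vec n) :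
    inner ℝ v (mact P (mact sys.F v)) ≤ -lam * inner ℝ v (mact P v) := by
  have h := hLyap.inner_mact_nonneg v
  rw [mact_sub, mact_smul, inner_sub_right, inner_mact_symmetrizer, inner_smul_right,
    mact_mul] at h
  linarith

/-- `H` collects the two cross terms of the derivative of `V`: `E dq` acting on `dx`, and `C F dx`
acting on `dq`. -/
theorem inner_H_eq {P : Matrix (Fin n) (Fin n) ℝ} (x : Vec n) (v : Vec p) :
    2 * inner ℝ x (mact (sys.H P) v)
      = inner ℝ x (mact P (mact sys.E v)) - inner ℝ v (mact sys.C (mact sys.F x)) := by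
  rw [H, mact_smul, mact_sub, inner_smul_right, inner_sub_right, mact_mul, mact_mul,
    inner_mact sys.F.transpose, inner_mact sys.C.transpose, Matrix.transpose_transpose,
    Matrix.transpose_transpose, real_inner_comm v]
  ring

/-- Strong convexity at `q₁` and at `q₂` contributes `-γ |dq|²`, the Lyapunov inequality `-λ
|dx|_P²`, and `alpha`, `beta` bound the remaining terms; `form_le_psi` closes the estimate. -/
theorem ae_deriv_V_le (hcompact : IsCompact sys.Theta) {R : ℝ} (hR : 0 < R)
    (hstrong : IsStronglyConvexWith sys.Theta R) {lam : ℝ} {P : Matrix (Fin n) (Fin n) ℝ}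
    (hP : P.PosDef) (hLyap : (-lam • P - symmetrizer (P * sys.F)).PosSemidef)
    {w : ℝ → Vec m} {x₁ x₂ : ℝ → Vec n}
    {z₁ z₂ : ℝ → Vec p} (h₁ : sys.IsTrajectory w x₁ z₁) (h₂ : sys.IsTrajectory w x₂ z₂) :
    ∀ᵐ t ∂volume.restrict (Ici (0 : ℝ)), deriv (sys.V P x₁ z₁ x₂ z₂) t
      ≤ 2 * sys.psi P lam (gammaRate R z₁ z₂ t) * sys.V P x₁ z₁ x₂ z₂ t := by
  filter_upwards [h₁.ae_regular, h₂.ae_regular] with t ht₁ ht₂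
  obtain ⟨h0, hx₁, hz₁, hn₁⟩ := ht₁
  obtain ⟨-, hx₂, hz₂, hn₂⟩ := ht₂
  have hx := hx₁.sub hx₂
  have hq := (IsTrajectory.hasDerivAt_q (sys := sys) hx₁ hz₁).sub
    (IsTrajectory.hasDerivAt_q (sys := sys) hx₂ hz₂)
  have hPx : HasDerivAt (fun s => mact P (x₁ s - x₂ s)) (mact P _) t :=
    (mactL P).hasFDerivAt.comp_hasDerivAt t hx
  have hV : HasDerivAt (sys.V P x₁ z₁ x₂ z₂) _ t := (hx.inner ℝ hPx).add hq.norm_sq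
  rw [hV.deriv]
  have e1 := hstrong.inner_normal_le hR hcompact.isClosed (h₁.mem_theta t h0.le)
    (h₂.mem_theta t h0.le) hn₁
  have e2 := hstrong.inner_normal_le hR hcompact.isClosed (h₂.mem_theta t h0.le)
    (h₁.mem_theta t h0.le) hn₂
  simp only [V, gammaRate, Pi.sub_apply]
  -- The estimate at `q₂` involves `q₂ - q₁`; reversing it expresses both estimates in `dq`.
  rw [norm_sub_rev, ← neg_sub (sys.q x₁ z₁ t), inner_neg_left] at e2
  set dx := x₁ t - x₂ t with hdx
  set dq := sys.q x₁ z₁ t - sys.q x₂ z₂ t with hdq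
  have hd : mact sys.F (x₁ t) + mact sys.B (w t) + mact sys.E (sys.q x₁ z₁ t)
      - (mact sys.F (x₂ t) + mact sys.B (w t) + mact sys.E (sys.q x₂ z₂ t))
      = mact sys.F dx + mact sys.E dq := by
    simp only [hdx, hdq, map_sub]; abel
  have hd' : deriv z₁ t - mact sys.C
        (mact sys.F (x₁ t) + mact sys.B (w t) + mact sys.E (sys.q x₁ z₁ t))
      - (deriv z₂ t - mact sys.C
        (mact sys.F (x₂ t) + mact sys.B (w t) + mact sys.E (sys.q x₂ z₂ t)))
      = deriv z₁ t - deriv z₂ t - mact sys.C (mact sys.F dx + mact sys.E dq) := by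
    rw [← hd]; simp only [map_sub]; abel
  rw [hd, hd', inner_mact_comm hP.1 (mact sys.F dx + mact sys.E dq) dx]
  simp only [map_add, inner_add_right, inner_sub_right]
  have f1 := inner_mact_F_le hLyap dx
  have f2 := sys.inner_H_eq (P := P) dx dq
  have f3 := sys.inner_H_le hP dx dq
  have f4 := sys.alpha_mul_le dq
  rw [mact_mul] at f4
  have f5 := sys.form_le_psi hP lam (1 / (2 * R) * (‖deriv z₁ t‖ + ‖deriv z₂ t‖))
    (Real.sqrt (inner ℝ dx (mact P dx))) ‖dq‖
  rw [Real.sq_sqrt (hP.posSemidef.inner_mact_nonneg dx)] at f5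
  linarith

theorem gammaRate_nonneg {R : ℝ} (hR : 0 < R) (z₁ z₂ : ℝ → Vec p) (t : ℝ) :
    0 ≤ gammaRate R z₁ z₂ t := by
  unfold gammaRate
  positivity

theorem intervalIntegrable_gammaRate {w₁ w₂ : ℝ → Vec m} {x₁ x₂ : ℝ → Vec n}
    {z₁ z₂ : ℝ → Vec p} (h₁ : sys.IsTrajectory w₁ x₁ z₁) (h₂ : sys.IsTrajectory w₂ x₂ z₂)
    (R : ℝ) {t : ℝ} (ht : 0 ≤ t) :
    IntervalIntegrable (gammaRate R z₁ z₂) volume 0 t :=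
  ((h₁.ac_z t ht).intervalIntegrable_deriv_vec.norm.add
    (h₂.ac_z t ht).intervalIntegrable_deriv_vec.norm).const_mul _

/-- `ψ(γ)` lies between `ψ(0) - γ` and `ψ(0)`, and `γ` is integrable because `z₁` and `z₂` are
absolutely continuous. -/
theorem intervalIntegrable_psi {P : Matrix (Fin n) (Fin n) ℝ} (hP : P.PosDef) (lam : ℝ)
    {w₁ w₂ : ℝ → Vec m} {x₁ x₂ : ℝ → Vec n}
    {z₁ z₂ : ℝ → Vec p} (h₁ : sys.IsTrajectory w₁ x₁ z₁) (h₂ : sys.IsTrajectory w₂ x₂ z₂)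
    {R : ℝ} (hR : 0 < R) {t : ℝ} (ht : 0 ≤ t) :
    IntervalIntegrable (fun s => sys.psi P lam (gammaRate R z₁ z₂ s)) volume 0 t := by
  have hγ := intervalIntegrable_gammaRate h₁ h₂ R ht
  refine IntervalIntegrable.mono_fun
    ((intervalIntegrable_const (c := |sys.psi P lam 0|)).add hγ) ?_ (ae_of_all _ fun s => ?_)
  · exact (sys.continuous_psi P lam).comp_aestronglyMeasurable
      (intervalIntegrable_iff.1 hγ).aestronglyMeasurable
  · have h0 := gammaRate_nonneg hR z₁ z₂ s
    have h1 := sys.psi_sub_le hP lam h0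
    have h2 := sys.psi_antitone hP lam h0
    have h3 := abs_le.1 (le_refl |sys.psi P lam 0|)
    beta_reduce
    rw [Real.norm_eq_abs, Real.norm_of_nonneg (by positivity), abs_le]
    constructor <;> linarith

theorem sqrt_V_le (hcompact : IsCompact sys.Theta) {R : ℝ} (hR : 0 < R)
    (hstrong : IsStronglyConvexWith sys.Theta R) {lam : ℝ} {P : Matrix (Fin n) (Fin n) ℝ}
    (hP : P.PosDef) (hLyap : (-lam • P - symmetrizer (P * sys.F)).PosSemidef)
    {w : ℝ → Vec m} {x₁ x₂ : ℝ → Vec n}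
    {z₁ z₂ : ℝ → Vec p} (h₁ : sys.IsTrajectory w x₁ z₁) (h₂ : sys.IsTrajectory w x₂ z₂)
    {t : ℝ} (ht : 0 ≤ t) :
    Real.sqrt (sys.V P x₁ z₁ x₂ z₂ t) ≤ Real.sqrt (sys.V P x₁ z₁ x₂ z₂ 0)
      * Real.exp (∫ s in (0 : ℝ)..t, sys.psi P lam (gammaRate R z₁ z₂ s)) := by
  have h := (absolutelyContinuousOnInterval_V h₁ h₂ P ht).le_mul_exp_integral ht
    ((intervalIntegrable_psi hP lam h₁ h₂ hR ht).const_mul 2)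
    (ae_restrict_of_ae_restrict_of_subset Icc_subset_Ici_self
      (ae_deriv_V_le hcompact hR hstrong hP hLyap h₁ h₂))
  rw [intervalIntegral.integral_const_mul] at h
  refine Real.sqrt_le_iff.2 ⟨by positivity, h.trans (le_of_eq ?_)⟩
  rw [mul_pow, Real.sq_sqrt (V_nonneg hP ..), ← Real.exp_nat_mul]
  norm_num

end BacklashSystem

/-! ### The matrix exponential as a flow -/

/-- The series is transported term by term to the normed algebra of operators, where the exponential
is differentiated. -/
theorem mactL_exp {n : ℕ} (M : Matrix (Fin n) (Fin n) ℝ) :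
    mactL (NormedSpace.exp M) = NormedSpace.exp (mactL M) := by
  let e : Matrix (Fin n) (Fin n) ℝ ≃L[ℝ] (Vec n →L[ℝ] Vec n) :=
    (Matrix.toEuclideanCLM (n := Fin n) (𝕜 := ℝ)).toAlgEquiv.toLinearEquiv.toContinuousLinearEquiv
  have he : ∀ A, e A = mactL A := fun A => by
    ext v : 1
    rfl
  have hpow : ∀ k, mactL (M ^ k) = mactL M ^ k := fun k => by
    rw [← he, ← he]
    exact map_pow (Matrix.toEuclideanCLM (n := Fin n) (𝕜 := ℝ)) M k
  rw [NormedSpace.exp_eq_tsum ℝ, NormedSpace.exp_eq_tsum ℝ]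
  beta_reduce
  rw [← he, e.map_tsum]
  refine tsum_congr fun k => ?_
  rw [map_smul, he, hpow]

/-- The operator `exp(t M)` on Euclidean vectors. -/
noncomputable def expL {n : ℕ} (M : Matrix (Fin n) (Fin n) ℝ) (t : ℝ) : Vec n →L[ℝ] Vec n :=
  mactL (NormedSpace.exp (t • M))

theorem expL_eq {n : ℕ} (M : Matrix (Fin n) (Fin n) ℝ) (t : ℝ) :
    expL M t = NormedSpace.exp (t • mactL M) := by
  rw [expL, mactL_exp]
  congr 1
  ext v : 1
  exact mact_smul t M v

theorem expL_zero {n : ℕ} (M : Matrix (Fin n) (Fin n) ℝ) : expL M 0 = 1 := by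
  rw [expL, zero_smul, NormedSpace.exp_zero]
  ext1 v
  exact mact_one v

theorem expL_add {n : ℕ} (M : Matrix (Fin n) (Fin n) ℝ) (s t : ℝ) :
    expL M (s + t) = expL M s * expL M t := by
  rw [expL, add_smul, Matrix.exp_add_of_commute _ _
    (((Commute.refl M).smul_left s).smul_right t)]
  ext1 v
  exact mact_mul _ _ v

theorem expL_add_apply {n : ℕ} (M : Matrix (Fin n) (Fin n) ℝ) (s t : ℝ) (v : Vec n) :
    expL M (s + t) v = expL M s (expL M t v) := by
  rw [expL_add]; rfl

theorem expL_apply_neg {n : ℕ} (M : Matrix (Fin n) (Fin n) ℝ) (t : ℝ) (v : Vec n) :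
    expL M t (expL M (-t) v) = v := by
  rw [← expL_add_apply, add_neg_cancel, expL_zero]; rfl

theorem hasDerivAt_expL {n : ℕ} (M : Matrix (Fin n) (Fin n) ℝ) (t : ℝ) :
    HasDerivAt (expL M) (mactL M * expL M t) t := by
  have : expL M = fun t : ℝ => NormedSpace.exp (t • mactL M) := funext (expL_eq M)
  rw [this]
  exact hasDerivAt_exp_smul_const' (mactL M) t

theorem hasDerivAt_expL' {n : ℕ} (M : Matrix (Fin n) (Fin n) ℝ) (t : ℝ) :
    HasDerivAt (expL M) (expL M t * mactL M) t := by
  have : expL M = fun t : ℝ => NormedSpace.exp (t • mactL M) := funext (expL_eq M)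
  rw [this]
  exact hasDerivAt_exp_smul_const (mactL M) t

theorem continuous_expL {n : ℕ} (M : Matrix (Fin n) (Fin n) ℝ) : Continuous (expL M) :=
  continuous_iff_continuousAt.2 fun t => (hasDerivAt_expL M t).continuousAt

theorem contDiff_expL {n : ℕ} (M : Matrix (Fin n) (Fin n) ℝ) : ContDiff ℝ 1 (expL M) := by
  rw [contDiff_one_iff_deriv]
  refine ⟨fun t => (hasDerivAt_expL M t).differentiableAt, ?_⟩
  rw [funext fun t => (hasDerivAt_expL M t).deriv]
  exact continuous_const.mul (continuous_expL M)

/-- The variation of constants formula for an absolutely continuous solution. -/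
theorem eq_variation_of_constants {n : ℕ} (M : Matrix (Fin n) (Fin n) ℝ) {f g : ℝ → Vec n} {t : ℝ}
    (ht : 0 ≤ t) (hf : AbsolutelyContinuousOnInterval f 0 t)
    (hd : ∀ᵐ s ∂volume.restrict (Ici (0 : ℝ)), HasDerivAt f (mact M (f s) + g s) s) :
    f t = expL M t (f 0) + ∫ s in (0 : ℝ)..t, expL M (t - s) (g s) := by
  -- The factor `exp(-s M)` removes the linear part: the product has the derivative `exp(-s M)
  -- g(s)`.
  have hh : AbsolutelyContinuousOnInterval (fun s => expL M (-s) (f s)) 0 t := by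
    have hid : AbsolutelyContinuousOnInterval (fun s : ℝ => s) 0 t :=
      LipschitzOnWith.absolutelyContinuousOnInterval (K := 1) (LipschitzWith.id.lipschitzOnWith)
    refine (hid.prodMk hf).comp_contDiff (φ := fun u : ℝ × Vec n => expL M (-u.1) u.2) ?_
    exact ((contDiff_expL M).comp contDiff_fst.neg).clm_apply contDiff_snd
  have h1 := hh.integral_deriv_vec
  have hint := hh.intervalIntegrable_deriv_vec
  have hae : ∀ᵐ s, s ∈ uIoc 0 t → deriv (fun s => expL M (-s) (f s)) s = expL M (-s) (g s) := by
    rw [ae_restrict_iff' measurableSet_Ici] at hd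
    filter_upwards [hd] with s hs hmem
    rw [uIoc_of_le ht] at hmem
    have h2 : HasDerivAt (fun s => expL M (-s)) (-(expL M (-s) * mactL M)) s := by
      refine ((hasDerivAt_expL' M (-s)).scomp s (hasDerivAt_neg s)).congr_deriv ?_
      exact neg_one_smul ℝ _
    rw [(h2.clm_apply (hs hmem.1.le)).deriv]
    simp [mactL_apply]
  rw [intervalIntegral.integral_congr_ae hae] at h1
  have hint' : IntervalIntegrable (fun s => expL M (-s) (g s)) volume 0 t :=
    hint.congr_ae ((ae_restrict_iff' measurableSet_uIoc).2 hae)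
  have h3 := (expL M t).intervalIntegral_comp_comm hint'
  rw [h1, map_sub, expL_apply_neg, neg_zero, expL_zero] at h3
  simp only [← expL_add_apply, ← sub_eq_add_neg] at h3
  rw [h3]
  exact (add_sub_cancel _ _).symm

namespace BacklashSystem

variable {m n p : ℕ} {sys : BacklashSystem m n p}

/-- By the Lyapunov inequality the form of `P` along `exp(t F) v`, multiplied by `exp(2 lam t)`, is
nonincreasing; the form of `P` is then compared with the Euclidean norm from both sides. -/
theorem exists_norm_expL_le {lam : ℝ} {P : Matrix (Fin n) (Fin n) ℝ} (hP : P.PosDef)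
    (hLyap : (-lam • P - symmetrizer (P * sys.F)).PosSemidef) :
    ∃ c : ℝ, 0 < c ∧ ∀ t, 0 ≤ t → ‖expL sys.F t‖ ≤ c * Real.exp (-lam * t) := by
  obtain ⟨c, hc, hcP⟩ := hP.exists_norm_sq_le
  have hdecay : ∀ v : Vec n, ∀ t, 0 ≤ t → inner ℝ (expL sys.F t v) (mact P (expL sys.F t v))
      ≤ Real.exp (-lam * t) ^ 2 * inner ℝ v (mact P v) := by
    intro v
    have hd : ∀ t, HasDerivAt (fun t => expL sys.F t v) (mact sys.F (expL sys.F t v)) t := fun t =>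
      by simpa [mactL_apply] using (hasDerivAt_expL sys.F t).clm_apply (hasDerivAt_const t v)
    have hg : ∀ t, HasDerivAt (fun t => Real.exp (2 * lam * t)
        * inner ℝ (expL sys.F t v) (mact P (expL sys.F t v)))
        (Real.exp (2 * lam * t) * (2 * lam) * inner ℝ (expL sys.F t v) (mact P (expL sys.F t v))
        + Real.exp (2 * lam * t) * (2 * inner ℝ (expL sys.F t v)
          (mact P (mact sys.F (expL sys.F t v))))) t := fun t => by
      have h1 : HasDerivAt (fun t : ℝ => Real.exp (2 * lam * t))
          (Real.exp (2 * lam * t) * (2 * lam)) t := by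
        simpa using ((hasDerivAt_id t).const_mul (2 * lam)).exp
      have h2 : HasDerivAt (fun t => mact P (expL sys.F t v))
          (mact P (mact sys.F (expL sys.F t v))) t :=
        (mactL P).hasFDerivAt.comp_hasDerivAt t (hd t)
      refine (h1.mul ((hd t).inner ℝ h2)).congr_deriv ?_
      rw [inner_mact_comm hP.1 (mact sys.F _)]
      ring
    have hanti := antitone_of_deriv_nonpos (fun t => (hg t).differentiableAt) (fun t => by
      rw [(hg t).deriv]
      have := inner_mact_F_le hLyap (expL sys.F t v)
      nlinarith [Real.exp_pos (2 * lam * t)])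
    intro t ht
    have h := hanti ht
    simp only [mul_zero, Real.exp_zero, one_mul, expL_zero, one_apply_eq_self] at h
    have he : Real.exp (-lam * t) ^ 2 * Real.exp (2 * lam * t) = 1 := by
      rw [← Real.exp_nat_mul, ← Real.exp_add, Real.exp_eq_one_iff]; push_cast; ring
    have h' := mul_le_mul_of_nonneg_left h (sq_nonneg (Real.exp (-lam * t)))
    rwa [← mul_assoc, he, one_mul] at h'
  refine ⟨Real.sqrt (c * (‖mactL P‖ + 1)), Real.sqrt_pos.2 (by positivity), fun t ht => ?_⟩
  refine ContinuousLinearMap.opNorm_le_bound _ (by positivity) fun v => ?_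
  refine (abs_le_of_sq_le_sq' ?_ (by positivity)).2
  have h1 := hcP (expL sys.F t v)
  have h2 := hdecay v t ht
  have h3 : inner ℝ v (mact P v) ≤ (‖mactL P‖ + 1) * ‖v‖ ^ 2 := by
    have h4 := real_inner_le_norm v (mact P v)
    have h5 := (mactL P).le_opNorm v
    rw [mactL_apply] at h5
    nlinarith [norm_nonneg v, sq_nonneg ‖v‖]
  rw [mul_pow, mul_pow, Real.sq_sqrt (by positivity)]
  calc _ ≤ c * (Real.exp (-lam * t) ^ 2 * ((‖mactL P‖ + 1) * ‖v‖ ^ 2)) := by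
        refine h1.trans (mul_le_mul_of_nonneg_left (h2.trans ?_) hc.le)
        exact mul_le_mul_of_nonneg_left h3 (sq_nonneg _)
    _ = _ := by ring

end BacklashSystem

/-! ### Periodic functions on the half-line -/

theorem exists_sub_nat_mul_mem_Ioc {T : ℝ} (hT : 0 < T) {t : ℝ} (ht : 0 < t) :
    ∃ k : ℕ, t - k * T ∈ Ioc 0 T := by
  obtain ⟨k, hk, -⟩ := existsUnique_sub_zsmul_mem_Ioc hT t 0
  rw [zero_add, zsmul_eq_mul] at hk
  have hk0 : 0 ≤ k := by
    by_contra h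
    have h1 : (k : ℝ) ≤ -1 := by exact_mod_cast (by omega : k ≤ -1)
    nlinarith [hk.2]
  lift k to ℕ using hk0
  exact ⟨k, by simpa using hk⟩

/-- The exceptional set lies in countably many translates of a null set. Propagation is required
only from `t > 0`, so that it also applies to properties of a two-sided derivative. -/
theorem ae_restrict_Ici_of_periodic {T : ℝ} (hT : 0 < T) {p : ℝ → Prop}
    (h : ∀ᵐ t ∂volume.restrict (Icc 0 T), p t) (hp : ∀ t, 0 < t → p t → p (t + T)) :
    ∀ᵐ t ∂volume.restrict (Ici (0 : ℝ)), p t := by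
  rw [ae_restrict_iff' measurableSet_Icc] at h
  rw [← restrict_Ioi_eq_restrict_Ici, ae_restrict_iff' measurableSet_Ioi]
  have h1 : ∀ k : ℕ, ∀ᵐ t : ℝ, t - k * T ∈ Icc 0 T → p (t - k * T) := fun k =>
    (measurePreserving_sub_right volume ((k : ℝ) * T)).quasiMeasurePreserving.ae h
  filter_upwards [ae_all_iff.2 h1] with t ht h0
  obtain ⟨k, hk⟩ := exists_sub_nat_mul_mem_Ioc hT h0
  have hpk := ht k (Ioc_subset_Icc_self hk)
  have hind : ∀ j : ℕ, p (t - k * T + j * T) := fun j => by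
    induction j with
    | zero => simpa using hpk
    | succ j ih =>
      have := hp _ (by have := hk.1; positivity) ih
      rw [add_assoc] at this
      convert this using 2
      push_cast
      ring
  simpa using hind k

theorem IsPeriodicOnHalfLine.add_nat_mul {k : ℕ} {T : ℝ} {f : ℝ → Vec k}
    (hT : 0 ≤ T) (hf : IsPeriodicOnHalfLine T f) (j : ℕ) {t : ℝ} (ht : 0 ≤ t) :
    f (t + j * T) = f t := by
  induction j with
  | zero => simp
  | succ j ih =>
    rw [← ih, ← hf (t + j * T) (by positivity)]
    congr 1
    push_cast
    ring

theorem IsPeriodicOnHalfLine.intervalIntegrable {k : ℕ} {T : ℝ} (hT : 0 < T) {f : ℝ → Vec k}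
    (hf : IsPeriodicOnHalfLine T f) (hint : IntervalIntegrable f volume 0 T) {a b : ℝ}
    (ha : 0 ≤ a) (hb : 0 ≤ b) : IntervalIntegrable f volume a b := by
  -- The extension of `f` from `[0, T)` to a periodic function on the whole line; it agrees with `f`
  -- on the half-line.
  let g : ℝ → Vec k := fun t => f (toIcoMod hT 0 t)
  have hg : Function.Periodic g T := fun t => by simp [g, toIcoMod_add_right]
  have heq : ∀ t, 0 ≤ t → g t = f t := fun t ht => by
    obtain ⟨j, hj⟩ : ∃ j : ℕ, toIcoDiv hT 0 t = j := by
      refine ⟨(toIcoDiv hT 0 t).toNat, (Int.toNat_of_nonneg ?_).symm⟩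
      by_contra h
      have h1 : (toIcoDiv hT 0 t : ℝ) ≤ -1 := by
        exact_mod_cast (by omega : toIcoDiv hT 0 t ≤ -1)
      have h2 := (toIcoMod_mem_Ico hT 0 t).2
      rw [← self_sub_toIcoDiv_zsmul hT, zsmul_eq_mul] at h2
      nlinarith
    have h0 := (toIcoMod_mem_Ico hT 0 t).1
    refine (hf.add_nat_mul hT.le j h0).symm.trans ?_
    congr 1
    have := self_sub_toIcoDiv_zsmul hT 0 t
    rw [hj] at this
    simp at this
    linarith
  have h1 : IntervalIntegrable g volume 0 T := hint.congr fun t ht => by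
    rw [uIoc_of_le hT.le] at ht
    exact (heq t ht.1.le).symm
  refine (hg.intervalIntegrable₀ hT.ne' h1 a b).congr fun t ht => heq t ?_
  have := ht.1
  exact (le_min ha hb).trans this.le

theorem AEStronglyMeasurable.continuousLinearMap_apply {r s : ℕ} {μ : Measure ℝ}
    {L : ℝ → Vec r →L[ℝ] Vec s} {g : ℝ → Vec r} (hL : AEStronglyMeasurable L μ)
    (hg : AEStronglyMeasurable g μ) : AEStronglyMeasurable (fun t => L t (g t)) μ :=
  (ContinuousLinearMap.id ℝ (Vec r →L[ℝ] Vec s)).aestronglyMeasurable_comp₂ hL hg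

theorem IntervalIntegrable.continuousLinearMap_apply {r s : ℕ} {a b : ℝ}
    {L : ℝ → Vec r →L[ℝ] Vec s} {g : ℝ → Vec r} (hL : Continuous L)
    (hg : IntervalIntegrable g volume a b) :
    IntervalIntegrable (fun t => L t (g t)) volume a b := by
  obtain ⟨c, hc⟩ := (isCompact_uIcc (a := a) (b := b)).exists_bound_of_continuousOn hL.continuousOn
  have hg' := intervalIntegrable_iff.1 hg
  refine intervalIntegrable_iff.2 ((hg'.norm.const_mul c).mono' ?_ ?_)
  · exact AEStronglyMeasurable.continuousLinearMap_apply hL.aestronglyMeasurable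
      hg'.aestronglyMeasurable
  · refine (ae_restrict_iff' measurableSet_uIoc).2 (ae_of_all _ fun t ht => ?_)
    exact (L t).le_of_opNorm_le (hc t (uIoc_subset_uIcc ht)) _

theorem norm_integral_exp_le {r : ℕ} {c K lam t : ℝ} (hK : 0 ≤ c * K) (hlam : 0 < lam) (ht : 0 ≤ t)
    {f : ℝ → Vec r} (hf : ∀ᵐ s, s ∈ Ioc 0 t → ‖f s‖ ≤ c * Real.exp (-lam * (t - s)) * K) :
    ‖∫ s in (0 : ℝ)..t, f s‖ ≤ c * K / lam := by
  have hd : ∀ s : ℝ, HasDerivAt (fun s => c * K / lam * Real.exp (-lam * (t - s)))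
      (c * Real.exp (-lam * (t - s)) * K) s := fun s => by
    have h1 : HasDerivAt (fun s : ℝ => -lam * (t - s)) lam s := by
      simpa using ((hasDerivAt_id s).const_sub t).const_mul (-lam)
    refine (h1.exp.const_mul (c * K / lam)).congr_deriv ?_
    field_simp
  have hcont : Continuous fun s => c * Real.exp (-lam * (t - s)) * K := by fun_prop
  refine (intervalIntegral.norm_integral_le_of_norm_le ht hf
    (hcont.intervalIntegrable _ _)).trans ?_
  rw [intervalIntegral.integral_eq_sub_of_hasDerivAt (fun s _ => hd s)
    (hcont.intervalIntegrable _ _), sub_self, mul_zero, Real.exp_zero, mul_one]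
  have : 0 ≤ c * K / lam * Real.exp (-lam * (t - 0)) := by positivity
  linarith

/-! ### Support functions -/

theorem bddAbove_inner {r : ℕ} {S : Set (Vec r)} {M : ℝ} (hM : ∀ v ∈ S, ‖v‖ ≤ M) (u : Vec r) :
    BddAbove ((fun v => inner ℝ u v) '' S) := by
  refine ⟨‖u‖ * M, ?_⟩
  rintro _ ⟨v, hv, rfl⟩
  exact (real_inner_le_norm u v).trans (mul_le_mul_of_nonneg_left (hM v hv) (norm_nonneg u))

theorem inner_le_supportFun {r : ℕ} {S : Set (Vec r)} {M : ℝ} (hM : ∀ v ∈ S, ‖v‖ ≤ M) (u : Vec r)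
    {v : Vec r} (hv : v ∈ S) : inner ℝ u v ≤ supportFun S u :=
  le_csSup (bddAbove_inner hM u) ⟨v, hv, rfl⟩

theorem continuous_supportFun {r : ℕ} {S : Set (Vec r)} (hS : S.Nonempty) {M : ℝ}
    (hM : ∀ v ∈ S, ‖v‖ ≤ M) : Continuous (supportFun S) := by
  have hM0 : 0 ≤ M := (norm_nonneg _).trans (hM _ hS.some_mem)
  refine (LipschitzWith.of_le_add_mul M.toNNReal fun u u' => ?_).continuous
  refine csSup_le (hS.image _) ?_
  rintro _ ⟨v, hv, rfl⟩
  have h1 := inner_le_supportFun hM u' hv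
  have h2 := real_inner_le_norm (u - u') v
  rw [inner_sub_left] at h2
  have h3 := mul_le_mul_of_nonneg_left (hM v hv) (norm_nonneg (u - u'))
  rw [Real.coe_toNNReal _ hM0, dist_eq_norm]
  beta_reduce
  linarith

theorem mact_exp_transpose {n p : ℕ} (E : Matrix (Fin n) (Fin p) ℝ) (M : Matrix (Fin n) (Fin n) ℝ)
    (s : ℝ) (u : Vec n) (v : Vec p) :
    inner ℝ (mact (E.transpose * NormedSpace.exp (s • M.transpose)) u) v
      = inner ℝ u (expL M s (mact E v)) := by
  rw [mact_mul, ← inner_mact, ← Matrix.transpose_smul, Matrix.exp_transpose, ← inner_mact]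
  rfl

namespace BacklashSystem

variable {m n p : ℕ} {sys : BacklashSystem m n p}

theorem continuous_supportFun_exp (hne : sys.Theta.Nonempty) {M : ℝ}
    (hM : ∀ v ∈ sys.Theta, ‖v‖ ≤ M) (u : Vec n) :
    Continuous fun s : ℝ => supportFun sys.Theta
      (mact (sys.E.transpose * NormedSpace.exp (s • sys.F.transpose)) u) := by
  refine (continuous_supportFun hne hM).comp ?_
  have : (fun s : ℝ => mact (sys.E.transpose * NormedSpace.exp (s • sys.F.transpose)) u)
      = fun s => mactL sys.E.transpose (expL sys.F.transpose s u) := by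
    funext s
    exact mact_mul _ _ _
  rw [this]
  exact (mactL _).continuous.comp ((continuous_expL _).clm_apply continuous_const)

/-- Tested against `u` and after the reflection `s ↦ t - s`, the integrand is at most the support
function that defines `Xi`. -/
theorem integral_expL_mem_Xi (hne : sys.Theta.Nonempty) {M : ℝ} (hM : ∀ v ∈ sys.Theta, ‖v‖ ≤ M)
    {q : ℝ → Vec p} {t : ℝ} (ht : 0 ≤ t) (hq : ∀ s, 0 ≤ s → q s ∈ sys.Theta)
    (hint : IntervalIntegrable (fun s => expL sys.F (t - s) (mact sys.E (q s))) volume 0 t) :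
    ∫ s in (0 : ℝ)..t, expL sys.F (t - s) (mact sys.E (q s)) ∈ sys.Xi t := by
  intro u
  have h1 := (innerSL ℝ u).intervalIntegral_comp_comm hint
  simp only [innerSL_apply_apply] at h1
  rw [← h1]
  have hc := continuous_supportFun_exp hne hM u
  have h2 := intervalIntegral.integral_comp_sub_left (a := 0) (b := t) (fun s => supportFun sys.Theta
      (mact (sys.E.transpose * NormedSpace.exp (s • sys.F.transpose)) u)) t
  rw [sub_self, sub_zero] at h2
  rw [← h2]
  refine intervalIntegral.integral_mono_on ht ?_ ?_ fun s hs => ?_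
  · rw [intervalIntegrable_iff] at hint ⊢
    exact (innerSL ℝ u).integrable_comp hint
  · exact (hc.comp (continuous_const.sub continuous_id)).intervalIntegrable _ _
  · rw [← mact_exp_transpose]
    exact inner_le_supportFun hM _ (hq s hs.1)

/-- Testing `v` in `Xi t` against itself gives `|v|² ≤ ρ |v|`, where `ρ` is the integral over the
whole half-line of the decaying bound on the flow, hence free of `t`. -/
theorem exists_norm_le_of_mem_XiInf (hne : sys.Theta.Nonempty) {M : ℝ}
    (hM : ∀ v ∈ sys.Theta, ‖v‖ ≤ M) {c lam : ℝ} (hlam : 0 < lam) (hc0 : 0 < c)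
    (hc : ∀ t, 0 ≤ t → ‖expL sys.F t‖ ≤ c * Real.exp (-lam * t)) :
    ∃ ρ : ℝ, ∀ v ∈ sys.XiInf, ‖v‖ ≤ ρ := by
  have hM0 : 0 ≤ M := (norm_nonneg _).trans (hM _ hne.some_mem)
  set ρ := c * (M * ‖mactL sys.E‖) / lam
  have hXi : ∀ t, 0 ≤ t → sys.Xi t ⊆ Metric.closedBall 0 ρ := by
    intro t ht v hv
    have h1 := hv v
    have hcont := continuous_supportFun_exp hne hM v
    have h2 : ∫ s in (0 : ℝ)..t, supportFun sys.Theta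
        (mact (sys.E.transpose * NormedSpace.exp (s • sys.F.transpose)) v)
        ≤ ∫ s in (0 : ℝ)..t, c * Real.exp (-lam * s) * (M * ‖mactL sys.E‖ * ‖v‖) := by
      refine intervalIntegral.integral_mono_on ht (hcont.intervalIntegrable _ _)
        (Continuous.intervalIntegrable (by fun_prop) _ _) fun s hs => ?_
      refine csSup_le (hne.image _) ?_
      rintro _ ⟨θ, hθ, rfl⟩
      beta_reduce
      rw [mact_exp_transpose]
      have h3 := real_inner_le_norm v (expL sys.F s (mact sys.E θ))
      have h4 := (expL sys.F s).le_of_opNorm_le (hc s hs.1) (mact sys.E θ)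
      have h5 := (mactL sys.E).le_opNorm θ
      rw [mactL_apply] at h5
      calc _ ≤ ‖v‖ * (c * Real.exp (-lam * s) * (‖mactL sys.E‖ * M)) := by
            refine h3.trans (mul_le_mul_of_nonneg_left (h4.trans ?_) (norm_nonneg _))
            refine mul_le_mul_of_nonneg_left (h5.trans ?_) (by positivity)
            exact mul_le_mul_of_nonneg_left (hM θ hθ) (norm_nonneg _)
        _ = _ := by ring
    have hd : ∀ s : ℝ, HasDerivAt (fun s => -(ρ * ‖v‖) * Real.exp (-lam * s))
        (c * Real.exp (-lam * s) * (M * ‖mactL sys.E‖ * ‖v‖)) s := fun s => by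
      have h1 : HasDerivAt (fun s : ℝ => -lam * s) (-lam) s := by
        simpa using (hasDerivAt_id s).const_mul (-lam)
      refine (h1.exp.const_mul (-(ρ * ‖v‖))).congr_deriv ?_
      simp only [ρ]
      field_simp
    rw [intervalIntegral.integral_eq_sub_of_hasDerivAt (fun s _ => hd s)
      (Continuous.intervalIntegrable (by fun_prop) _ _), mul_zero, Real.exp_zero] at h2
    rw [real_inner_self_eq_norm_sq] at h1
    have h6 : 0 ≤ ρ * ‖v‖ * Real.exp (-lam * t) := by positivity
    rw [mem_closedBall_zero_iff]
    rcases (norm_nonneg v).eq_or_lt with h7 | h7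
    · rw [← h7]; positivity
    · nlinarith
  refine ⟨ρ, fun v hv => ?_⟩
  rw [← mem_closedBall_zero_iff]
  exact closure_minimal (iUnion₂_subset hXi) Metric.isClosed_closedBall hv

theorem mem_XiInf {t : ℝ} (ht : 0 ≤ t) {v : Vec n} (hv : v ∈ sys.Xi t) : v ∈ sys.XiInf :=
  subset_closure (mem_iUnion₂.2 ⟨t, ht, hv⟩)

/-! ### The periodic solution of the linearised system -/

theorem xiT_eq (T : ℝ) (w : ℝ → Vec m) (t : ℝ) :
    sys.xiT T w t = expL sys.F t (sys.xiT0 T w)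
      + ∫ s in (0 : ℝ)..t, expL sys.F (t - s) (mact sys.B (w s)) := by
  rw [xiT]
  congr 1
  exact intervalIntegral.integral_congr fun s _ => mact_mul _ _ _

theorem intervalIntegrable_expL_B {w : ℝ → Vec m} {a b : ℝ} (hw : IntervalIntegrable w volume a b)
    (t : ℝ) : IntervalIntegrable (fun s => expL sys.F (t - s) (mact sys.B (w s))) volume a b := by
  have h : Continuous fun s => (expL sys.F (t - s)).comp (mactL sys.B) :=
    ((continuous_expL sys.F).comp (continuous_const.sub continuous_id)).clm_comp continuous_const
  exact IntervalIntegrable.continuousLinearMap_apply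
    (L := fun s => (expL sys.F (t - s)).comp (mactL sys.B)) h hw

/-- Factoring out the flow leaves an integrand free of `t`, so the product rule and Lebesgue
differentiation apply. -/
theorem xiT_eq_expL (T : ℝ) {w : ℝ → Vec m} {t : ℝ} (hw : IntervalIntegrable w volume 0 t) :
    sys.xiT T w t = expL sys.F t (sys.xiT0 T w
      + ∫ s in (0 : ℝ)..t, expL sys.F (0 - s) (mact sys.B (w s))) := by
  rw [xiT_eq, map_add, ← (expL sys.F t).intervalIntegral_comp_comm
    (intervalIntegrable_expL_B hw 0)]
  simp only [← expL_add_apply, zero_sub, ← sub_eq_add_neg]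

theorem ae_hasDerivAt_xiT (T : ℝ) {w : ℝ → Vec m}
    (hw : ∀ t, 0 ≤ t → IntervalIntegrable w volume 0 t) :
    ∀ᵐ t ∂volume.restrict (Ici (0 : ℝ)),
      HasDerivAt (sys.xiT T w) (mact sys.F (sys.xiT T w t) + mact sys.B (w t)) t := by
  rw [← restrict_Ioi_eq_restrict_Ici, ae_restrict_iff' measurableSet_Ioi]
  have h1 := ae_all_iff.2 fun k : ℕ =>
    (intervalIntegrable_expL_B (sys := sys) (hw k k.cast_nonneg) 0).ae_hasDerivAt_integral
  filter_upwards [h1] with t ht h0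
  obtain ⟨k, hk⟩ := exists_nat_gt t
  have hk0 : (0 : ℝ) ≤ k := k.cast_nonneg
  have h2 := ht k (by rw [uIcc_of_le hk0]; exact ⟨le_of_lt h0, hk.le⟩) 0 left_mem_uIcc
  have h3 := (hasDerivAt_expL sys.F t).clm_apply (h2.const_add (sys.xiT0 T w))
  have h4 : sys.xiT T w =ᶠ[𝓝 t] fun t => expL sys.F t (sys.xiT0 T w
      + ∫ s in (0 : ℝ)..t, expL sys.F (0 - s) (mact sys.B (w s))) := by
    filter_upwards [eventually_gt_nhds (show 0 < t from h0)] with s hs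
    exact xiT_eq_expL T (hw s hs.le)
  refine (h3.congr_of_eventuallyEq h4).congr_deriv ?_
  rw [← expL_add_apply, zero_sub, add_neg_cancel, expL_zero, xiT_eq_expL T (hw t (le_of_lt h0))]
  rfl

/-- The initial value is fixed by the period map. The matrix inverse in `xiT0` is genuine: a vector
fixed by `exp(T F)` is fixed by all its powers, which tend to zero. -/
theorem expL_xiT0_add {c lam : ℝ} (hlam : 0 < lam)
    (hc : ∀ t, 0 ≤ t → ‖expL sys.F t‖ ≤ c * Real.exp (-lam * t)) {T : ℝ} (hT : 0 < T)
    (w : ℝ → Vec m) :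
    expL sys.F T (sys.xiT0 T w) + ∫ s in (0 : ℝ)..T, expL sys.F (T - s) (mact sys.B (w s))
      = sys.xiT0 T w := by
  have hinj : Function.Injective (1 - NormedSpace.exp (T • sys.F)).mulVec := by
    refine (injective_iff_map_eq_zero (Matrix.mulVecLin (1 - NormedSpace.exp (T • sys.F)))).2 ?_
    intro v hv
    have h1 : expL sys.F T (WithLp.toLp 2 v) = WithLp.toLp 2 v := by
      have h2 : mact (1 - NormedSpace.exp (T • sys.F)) (WithLp.toLp 2 v) = 0 := by
        rw [mact, Matrix.toLpLin_apply]
        exact (congrArg (WithLp.toLp 2) hv).trans (WithLp.toLp_zero 2)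
      rw [mact_sub, mact_one, sub_eq_zero] at h2
      exact h2.symm
    have h3 : ∀ k : ℕ, expL sys.F (k * T) (WithLp.toLp 2 v) = WithLp.toLp 2 v := fun k => by
      induction k with
      | zero => simp [expL_zero]
      | succ k ih => rw [Nat.cast_succ, add_mul, one_mul, expL_add_apply, h1, ih]
    have h4 : Tendsto (fun k : ℕ => c * Real.exp (-lam * (k * T)) * ‖WithLp.toLp 2 v‖) atTop
        (𝓝 (c * 0 * ‖WithLp.toLp 2 v‖)) := by
      refine (Tendsto.const_mul c ?_).mul_const _
      refine Real.tendsto_exp_atBot.comp ?_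
      exact (tendsto_natCast_atTop_atTop.atTop_mul_const hT).const_mul_atTop_of_neg
        (neg_lt_zero.2 hlam)
    have h5 : ‖WithLp.toLp 2 v‖ ≤ c * 0 * ‖WithLp.toLp 2 v‖ := ge_of_tendsto' h4 fun k => by
      calc ‖WithLp.toLp 2 v‖ = ‖expL sys.F (k * T) (WithLp.toLp 2 v)‖ := by rw [h3]
        _ ≤ _ := (expL sys.F (k * T)).le_of_opNorm_le (hc _ (by positivity)) _
    have h6 : WithLp.toLp 2 v = 0 := by
      rw [← norm_le_zero_iff]
      simpa using h5
    simpa using h6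
  have hunit := (Matrix.isUnit_iff_isUnit_det _).1 (Matrix.mulVec_injective_iff_isUnit.1 hinj)
  have h1 : mact (1 - NormedSpace.exp (T • sys.F)) (sys.xiT0 T w)
      = ∫ s in (0 : ℝ)..T, expL sys.F (T - s) (mact sys.B (w s)) := by
    rw [xiT0, ← mact_mul, Matrix.mul_nonsing_inv _ hunit, mact_one]
    exact intervalIntegral.integral_congr fun s _ => mact_mul _ _ _
  rw [← h1, mact_sub, mact_one]
  exact add_sub_cancel _ _

theorem xiT_periodic {c lam : ℝ} (hlam : 0 < lam)
    (hc : ∀ t, 0 ≤ t → ‖expL sys.F t‖ ≤ c * Real.exp (-lam * t)) {T : ℝ} (hT : 0 < T)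
    {w : ℝ → Vec m} (hper : IsPeriodicOnHalfLine T w) (hwT : IntervalIntegrable w volume 0 T) :
    IsPeriodicOnHalfLine T (sys.xiT T w) := by
  intro t ht
  have hw := fun a b => hper.intervalIntegrable hT hwT (a := a) (b := b)
  have hi := fun a b ha hb => intervalIntegrable_expL_B (sys := sys) (hw a b ha hb) (t + T)
  rw [xiT_eq, xiT_eq, ← intervalIntegral.integral_add_adjacent_intervals (hi 0 T le_rfl hT.le)
    (hi T (t + T) hT.le (by positivity))]
  nth_rw 2 [← expL_xiT0_add hlam hc hT w]
  rw [map_add, ← expL_add_apply, ← (expL sys.F t).intervalIntegral_comp_comm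
    (intervalIntegrable_expL_B (hw 0 T le_rfl hT.le) T), add_assoc]
  congr 1
  congr 1
  · refine intervalIntegral.integral_congr fun s _ => ?_
    beta_reduce
    rw [← expL_add_apply, add_sub_assoc]
  · have h2 := intervalIntegral.integral_comp_add_right (a := 0) (b := t)
      (fun s => expL sys.F (t + T - s) (mact sys.B (w s))) T
    rw [zero_add] at h2
    rw [← h2]
    refine intervalIntegral.integral_congr fun s hs => ?_
    rw [uIcc_of_le ht] at hs
    beta_reduce
    rw [hper s hs.1, add_sub_add_right_eq_sub]

end BacklashSystem

namespace BacklashSystem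

variable {m n p : ℕ} {sys : BacklashSystem m n p}

/-! ### Trajectories under bounded periodic inputs -/

/-- `w` is periodic with period `T > 0`, integrable over a period and bounded by `Mw` almost
everywhere on the half-line. -/
structure IsBoundedPeriodicInput (T Mw : ℝ) (w : ℝ → Vec m) : Prop where
  pos : 0 < T
  periodic : IsPeriodicOnHalfLine T w
  integrable : IntervalIntegrable w volume 0 T
  bound : ∀ᵐ t ∂volume.restrict (Ici (0 : ℝ)), ‖w t‖ ≤ Mw

theorem IsBoundedPeriodicInput.nonneg {T Mw : ℝ} {w : ℝ → Vec m}
    (h : IsBoundedPeriodicInput T Mw w) : 0 ≤ Mw := by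
  have : (ae (volume.restrict (Ici (0 : ℝ)))).NeBot := by
    rw [ae_neBot, Ne, Measure.restrict_eq_zero]
    simp
  obtain ⟨t, ht⟩ := h.bound.exists
  exact (norm_nonneg _).trans ht

theorem IsBoundedPeriodicInput.intervalIntegrable {T Mw : ℝ} {w : ℝ → Vec m}
    (h : IsBoundedPeriodicInput T Mw w) {a b : ℝ} (ha : 0 ≤ a) (hb : 0 ≤ b) :
    IntervalIntegrable w volume a b :=
  h.periodic.intervalIntegrable h.pos h.integrable ha hb

theorem exists_isBoundedPeriodicInput {T : ℝ} (hT : 0 < T) {w : ℝ → Vec m}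
    (hper : IsPeriodicOnHalfLine T w) (hw : MemLp w ⊤ (volume.restrict (Icc 0 T))) :
    ∃ Mw, IsBoundedPeriodicInput T Mw w := by
  refine ⟨(eLpNorm w ⊤ (volume.restrict (Icc 0 T))).toReal, hT, hper, ?_, ?_⟩
  · rw [intervalIntegrable_iff_integrableOn_Icc_of_le hT.le]
    exact hw.integrable le_top
  · refine ae_restrict_Ici_of_periodic hT ?_ fun t ht h => by rwa [hper t ht.le]
    have hfin := hw.eLpNorm_ne_top
    rw [eLpNorm_exponent_top] at hfin ⊢
    filter_upwards [ae_le_eLpNormEssSup (f := w) (μ := volume.restrict (Icc 0 T))] with t ht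
    rw [← toReal_enorm]
    exact ENNReal.toReal_mono hfin ht

/-- The flow of the linearised system decays as `c exp(-lam t)`, and `Θ` is a nonempty set bounded
by `M`. -/
structure IsExpStable (sys : BacklashSystem m n p) (c lam M : ℝ) : Prop where
  lam_pos : 0 < lam
  c_pos : 0 < c
  norm_expL_le : ∀ t, 0 ≤ t → ‖expL sys.F t‖ ≤ c * Real.exp (-lam * t)
  nonempty : sys.Theta.Nonempty
  bound : ∀ v ∈ sys.Theta, ‖v‖ ≤ M

namespace IsExpStable

variable {c lam M : ℝ}

theorem M_nonneg (hs : sys.IsExpStable c lam M) : 0 ≤ M :=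
  (norm_nonneg _).trans (hs.bound _ hs.nonempty.some_mem)

theorem tendsto_expL (hs : sys.IsExpStable c lam M) (v : Vec n) :
    Tendsto (fun t => expL sys.F t v) atTop (𝓝 0) := by
  have h : Tendsto (fun t : ℝ => c * Real.exp (-lam * t) * ‖v‖) atTop (𝓝 (c * 0 * ‖v‖)) := by
    refine (Tendsto.const_mul c (Real.tendsto_exp_atBot.comp ?_)).mul_const _
    exact tendsto_id.const_mul_atTop_of_neg (neg_lt_zero.2 hs.lam_pos)
  rw [mul_zero, zero_mul] at h
  refine squeeze_zero_norm' ?_ h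
  filter_upwards [eventually_ge_atTop 0] with t ht
  exact (expL sys.F t).le_of_opNorm_le (hs.norm_expL_le t ht) v

theorem norm_expL_apply_le (hs : sys.IsExpStable c lam M) {t : ℝ} (ht : 0 ≤ t) (v : Vec n) :
    ‖expL sys.F t v‖ ≤ c * ‖v‖ := by
  refine ((expL sys.F t).le_of_opNorm_le (hs.norm_expL_le t ht) v).trans ?_
  have : Real.exp (-lam * t) ≤ 1 := Real.exp_le_one_iff.2 (by nlinarith [hs.lam_pos])
  nlinarith [mul_le_mul_of_nonneg_right this (mul_nonneg hs.c_pos.le (norm_nonneg v))]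

theorem norm_integral_expL_le (hs : sys.IsExpStable c lam M) {t K : ℝ} (ht : 0 ≤ t) (hK : 0 ≤ K)
    {g : ℝ → Vec n} (hg : ∀ᵐ s ∂volume.restrict (Ici (0 : ℝ)), ‖g s‖ ≤ K) :
    ‖∫ s in (0 : ℝ)..t, expL sys.F (t - s) (g s)‖ ≤ c * K / lam := by
  rw [ae_restrict_iff' measurableSet_Ici] at hg
  refine norm_integral_exp_le (mul_nonneg hs.c_pos.le hK) hs.lam_pos ht ?_
  filter_upwards [hg] with s hg hmem
  refine ((expL sys.F (t - s)).le_of_opNorm_le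
    (hs.norm_expL_le _ (sub_nonneg.2 hmem.2)) (g s)).trans ?_
  exact mul_le_mul_of_nonneg_left (hg hmem.1.le) (mul_nonneg hs.c_pos.le (Real.exp_pos _).le)

theorem norm_E_le (hs : sys.IsExpStable c lam M) {v : Vec p} (hv : v ∈ sys.Theta) :
    ‖mact sys.E v‖ ≤ ‖mactL sys.E‖ * M :=
  ((mactL sys.E).le_opNorm v).trans (mul_le_mul_of_nonneg_left (hs.bound v hv) (norm_nonneg _))

end IsExpStable

variable {c lam M T Mw : ℝ} {w : ℝ → Vec m}

theorem IsBoundedPeriodicInput.ae_norm_B_le (hw : IsBoundedPeriodicInput T Mw w) :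
    ∀ᵐ t ∂volume.restrict (Ici (0 : ℝ)), ‖mact sys.B (w t)‖ ≤ ‖mactL sys.B‖ * Mw := by
  filter_upwards [hw.bound] with t ht
  exact ((mactL sys.B).le_opNorm _).trans (mul_le_mul_of_nonneg_left ht (norm_nonneg _))

theorem IsExpStable.exists_norm_xiT_le (hs : sys.IsExpStable c lam M)
    (hw : IsBoundedPeriodicInput T Mw w) : ∃ X, ∀ t, 0 ≤ t → ‖sys.xiT T w t‖ ≤ X := by
  refine ⟨c * ‖sys.xiT0 T w‖ + c * (‖mactL sys.B‖ * Mw) / lam, fun t ht => ?_⟩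
  rw [xiT_eq]
  refine (norm_add_le _ _).trans (add_le_add (hs.norm_expL_apply_le ht _) ?_)
  exact hs.norm_integral_expL_le ht (mul_nonneg (norm_nonneg _) hw.nonneg) hw.ae_norm_B_le

namespace IsTrajectory

variable {x : ℝ → Vec n} {z : ℝ → Vec p}

theorem continuousOn_x (h : sys.IsTrajectory w x z) {t : ℝ} (ht : 0 ≤ t) :
    ContinuousOn x (Icc 0 t) := by
  simpa [uIcc_of_le ht] using (h.ac_x t ht).continuousOn

theorem continuousOn_q (h : sys.IsTrajectory w x z) {t : ℝ} (ht : 0 ≤ t) :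
    ContinuousOn (sys.q x z) (Icc 0 t) := by
  have hz : ContinuousOn z (Icc 0 t) := by simpa [uIcc_of_le ht] using (h.ac_z t ht).continuousOn
  exact hz.sub ((mactL sys.C).continuous.comp_continuousOn (h.continuousOn_x ht))

theorem intervalIntegrable_expL_E (h : sys.IsTrajectory w x z) {t : ℝ} (ht : 0 ≤ t) :
    IntervalIntegrable (fun s => expL sys.F (t - s) (mact sys.E (sys.q x z s))) volume 0 t := by
  have hL : Continuous fun s => (expL sys.F (t - s)).comp (mactL sys.E) :=
    ((continuous_expL sys.F).comp (continuous_const.sub continuous_id)).clm_comp continuous_const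
  refine IntervalIntegrable.continuousLinearMap_apply
    (L := fun s => (expL sys.F (t - s)).comp (mactL sys.E)) hL ?_
  exact ContinuousOn.intervalIntegrable_of_Icc ht (h.continuousOn_q ht)

theorem x_eq (h : sys.IsTrajectory w x z) {t : ℝ} (ht : 0 ≤ t) :
    x t = expL sys.F t (x 0) + ∫ s in (0 : ℝ)..t,
      expL sys.F (t - s) (mact sys.B (w s) + mact sys.E (sys.q x z s)) := by
  refine eq_variation_of_constants sys.F ht (h.ac_x t ht) ?_
  filter_upwards [h.ae_regular] with s hs
  rw [← add_assoc]
  exact hs.2.1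

theorem exists_norm_x_le (hs : sys.IsExpStable c lam M) (hw : IsBoundedPeriodicInput T Mw w)
    (h : sys.IsTrajectory w x z) : ∃ X, ∀ t, 0 ≤ t → ‖x t‖ ≤ X := by
  refine ⟨c * ‖x 0‖ + c * (‖mactL sys.B‖ * Mw + ‖mactL sys.E‖ * M) / lam, fun t ht => ?_⟩
  rw [h.x_eq ht]
  refine (norm_add_le _ _).trans (add_le_add (hs.norm_expL_apply_le ht _) ?_)
  have hM := hs.M_nonneg
  have hMw := hw.nonneg
  refine hs.norm_integral_expL_le ht (by positivity) ?_
  filter_upwards [hw.ae_norm_B_le, ae_restrict_mem measurableSet_Ici] with s hB hmem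
  exact (norm_add_le _ _).trans (add_le_add hB (hs.norm_E_le (h.mem_theta s hmem)))

/-- By variation of constants, `r` is the response to the `Θ`-valued forcing `q` from zero initial
state, and the middle term is the transient due to the mismatch with `xiT0`. -/
theorem exists_mem_XiInf (hs : sys.IsExpStable c lam M) (hw : IsBoundedPeriodicInput T Mw w)
    (h : sys.IsTrajectory w x z) {t : ℝ} (ht : 0 ≤ t) :
    ∃ r ∈ sys.XiInf, x t = sys.xiT T w t + expL sys.F t (x 0 - sys.xiT0 T w) + r := by
  have hE := h.intervalIntegrable_expL_E ht
  refine ⟨_, mem_XiInf ht (integral_expL_mem_Xi hs.nonempty hs.bound ht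
    (fun s hs => h.mem_theta s hs) hE), ?_⟩
  rw [h.x_eq ht, xiT_eq, map_sub]
  simp only [map_add]
  rw [intervalIntegral.integral_add (intervalIntegrable_expL_B (hw.intervalIntegrable le_rfl ht) t)
    hE]
  abel

theorem intervalIntegrable_norm_deriv_z (h : sys.IsTrajectory w x z) {a b : ℝ} (ha : 0 ≤ a)
    (hb : 0 ≤ b) : IntervalIntegrable (fun t => ‖deriv z t‖) volume a b :=
  (((h.ac_z a ha).intervalIntegrable_deriv_vec.symm).trans
    (h.ac_z b hb).intervalIntegrable_deriv_vec).norm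

theorem norm_z_sub_le (h : sys.IsTrajectory w x z) {a b s t : ℝ} (ha : 0 ≤ a)
    (has : a ≤ s) (hst : s ≤ t) (htb : t ≤ b) :
    ‖z t - z s‖ ≤ ∫ r in a..b, ‖deriv z r‖ := by
  have hs := ha.trans has
  have hac : AbsolutelyContinuousOnInterval z s t := (h.ac_z t (hs.trans hst)).mono (by
    rw [uIcc_of_le hst, uIcc_of_le (hs.trans hst)]
    exact Icc_subset_Icc_left hs)
  rw [← hac.integral_deriv_vec]
  refine (intervalIntegral.norm_integral_le_integral_norm hst).trans ?_
  exact intervalIntegral.integral_mono_interval has hst htb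
    (ae_of_all _ fun r => norm_nonneg _)
    (h.intervalIntegrable_norm_deriv_z ha (by linarith))

end IsTrajectory

theorem IsExpStable.exists_norm_XiInf_le (hs : sys.IsExpStable c lam M) :
    ∃ ρ : ℝ, ∀ v ∈ sys.XiInf, ‖v‖ ≤ ρ :=
  exists_norm_le_of_mem_XiInf hs.nonempty hs.bound hs.lam_pos hs.c_pos hs.norm_expL_le

theorem IsExpStable.dist_le_d (hs : sys.IsExpStable c lam M) {r₁ r₂ : Vec n} {q₁ q₂ : Vec p}
    (hr₁ : r₁ ∈ sys.XiInf) (hr₂ : r₂ ∈ sys.XiInf) (hq₁ : q₁ ∈ sys.Theta) (hq₂ : q₂ ∈ sys.Theta) :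
    ‖(mact sys.C r₁ + q₁) - (mact sys.C r₂ + q₂)‖ ≤ sys.d := by
  obtain ⟨ρ, hρ⟩ := hs.exists_norm_XiInf_le
  rw [← dist_eq_norm]
  refine Metric.dist_le_diam_of_mem ?_ (add_mem_add (mem_image_of_mem _ hr₁) hq₁)
    (add_mem_add (mem_image_of_mem _ hr₂) hq₂)
  -- Boundedness is essential: `Metric.diam` of an unbounded set is `0`.
  refine Bornology.IsBounded.add ?_ (isBounded_iff_forall_norm_le.2 ⟨M, hs.bound⟩)
  refine isBounded_iff_forall_norm_le.2 ⟨‖mactL sys.C‖ * ρ, ?_⟩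
  rintro _ ⟨v, hv, rfl⟩
  exact ((mactL sys.C).le_opNorm v).trans
    (mul_le_mul_of_nonneg_left (hρ v hv) (norm_nonneg _))

theorem IsExpStable.norm_le_hausdorffDeviation (hs : sys.IsExpStable c lam M) {r : Vec n}
    {q : Vec p} (hr : r ∈ sys.XiInf) (hq : q ∈ sys.Theta) :
    ‖mact sys.C (mact sys.F r + mact sys.E q)‖ ≤ hausdorffDeviation
        (mact sys.C '' (mact sys.F '' sys.XiInf + mact sys.E '' sys.Theta)) {0} := by
  obtain ⟨ρ, hρ⟩ := hs.exists_norm_XiInf_le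
  refine le_csSup ⟨‖mactL sys.C‖ * (‖mactL sys.F‖ * ρ + ‖mactL sys.E‖ * M), ?_⟩ ⟨_,
    mem_image_of_mem _ (add_mem_add (mem_image_of_mem _ hr) (mem_image_of_mem _ hq)), ?_⟩
  · rintro _ ⟨_, ⟨_, ⟨_, ⟨v, hv, rfl⟩, _, ⟨u, hu, rfl⟩, rfl⟩, rfl⟩, rfl⟩
    simp only [Metric.infDist_singleton, dist_zero_right]
    refine ((mactL sys.C).le_opNorm _).trans (mul_le_mul_of_nonneg_left ?_ (norm_nonneg _))
    refine (norm_add_le _ _).trans (add_le_add ?_ (hs.norm_E_le hu))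
    exact ((mactL sys.F).le_opNorm v).trans
      (mul_le_mul_of_nonneg_left (hρ v hv) (norm_nonneg _))
  · simp only [Metric.infDist_singleton, dist_zero_right]

theorem IsExpStable.etaT_periodic (hs : sys.IsExpStable c lam M)
    (hw : IsBoundedPeriodicInput T Mw w) : IsPeriodicOnHalfLine T (sys.etaT T w) := fun t ht => by
  rw [etaT, etaT, xiT_periodic hs.lam_pos hs.norm_expL_le hw.pos hw.periodic hw.integrable t ht]

theorem ae_hasDerivAt_etaT (hw : IsBoundedPeriodicInput T Mw w) :
    ∀ᵐ t ∂volume.restrict (Ici (0 : ℝ)), HasDerivAt (sys.etaT T w)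
      (mact sys.C (mact sys.F (sys.xiT T w t) + mact sys.B (w t))) t := by
  filter_upwards [ae_hasDerivAt_xiT (sys := sys) T
    fun t ht => hw.intervalIntegrable le_rfl ht] with t ht
  exact (mactL sys.C).hasFDerivAt.comp_hasDerivAt t ht

theorem IsExpStable.ae_norm_deriv_etaT_le (hs : sys.IsExpStable c lam M)
    (hw : IsBoundedPeriodicInput T Mw w) :
    ∀ᵐ t ∂volume.restrict (Ici (0 : ℝ)), ‖deriv (sys.etaT T w) t‖
      ≤ (eLpNorm (deriv (sys.etaT T w)) ⊤ (volume.restrict (Icc 0 T))).toReal := by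
  refine ae_restrict_Ici_of_periodic hw.pos ?_ fun t ht h => ?_
  · obtain ⟨X, hX⟩ := hs.exists_norm_xiT_le hw
    -- Finiteness must be known first, since `toReal` sends `⊤` to `0`.
    have hfin : eLpNorm (deriv (sys.etaT T w)) ⊤ (volume.restrict (Icc 0 T)) ≠ ⊤ := by
      rw [eLpNorm_exponent_top]
      refine ne_top_of_le_ne_top ENNReal.ofReal_ne_top (eLpNormEssSup_le_of_ae_bound
        (C := ‖mactL sys.C‖ * (‖mactL sys.F‖ * X + ‖mactL sys.B‖ * Mw)) ?_)
      refine ae_restrict_of_ae_restrict_of_subset Icc_subset_Ici_self ?_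
      filter_upwards [ae_hasDerivAt_etaT (sys := sys) hw, hw.ae_norm_B_le (sys := sys),
        ae_restrict_mem measurableSet_Ici] with t ht hB hmem
      rw [ht.deriv]
      refine ((mactL sys.C).le_opNorm _).trans (mul_le_mul_of_nonneg_left ?_ (norm_nonneg _))
      refine (norm_add_le _ _).trans (add_le_add ?_ hB)
      exact ((mactL sys.F).le_opNorm _).trans
        (mul_le_mul_of_nonneg_left (hX t hmem) (norm_nonneg _))
    rw [eLpNorm_exponent_top] at hfin ⊢
    filter_upwards [ae_le_eLpNormEssSup (f := deriv (sys.etaT T w))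
      (μ := volume.restrict (Icc 0 T))] with t ht
    rw [← toReal_enorm]
    exact ENNReal.toReal_mono hfin ht
  · have h1 : (fun s => sys.etaT T w (s + T)) =ᶠ[𝓝 t] sys.etaT T w := by
      filter_upwards [eventually_gt_nhds ht] with s hs'
      exact hs.etaT_periodic hw s hs'.le
    rwa [← deriv_comp_add_const, h1.deriv_eq]

/-! ### Asymptotic bounds on the variation and the speed of `z`. -/

namespace IsTrajectory

variable {x : ℝ → Vec n} {z : ℝ → Vec p}

/-- Up to a transient, `η_T` is `z` minus a point of `C Ξ_∞ + Θ`. So two values of `η_T` taken in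
the window differ by at most the variation of `z` there, plus `d`, plus two transients of size `ε /
2`. -/
theorem eventually_mho_le (hs : sys.IsExpStable c lam M) (hw : IsBoundedPeriodicInput T Mw w)
    (h : sys.IsTrajectory w x z) {ε : ℝ} (hε : 0 < ε) :
    ∀ᶠ τ : ℝ in atTop, sys.mho T w - sys.d - ε ≤ ∫ t in τ..(τ + T), ‖deriv z t‖ := by
  have hT := hw.pos
  have hδ : Tendsto (fun t => mact sys.C (expL sys.F t (x 0 - sys.xiT0 T w))) atTop (𝓝 0) := by
    have := ((mactL sys.C).continuous.tendsto 0).comp (hs.tendsto_expL (x 0 - sys.xiT0 T w))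
    rwa [map_zero] at this
  obtain ⟨τ₀, hτ₀⟩ := eventually_atTop.1
    (hδ.norm.eventually_lt_const (show ‖(0 : Vec p)‖ < ε / 2 by simpa using hε))
  filter_upwards [eventually_ge_atTop τ₀, eventually_ge_atTop T] with τ h1 h2
  have hτ : 0 ≤ τ := hT.le.trans h2
  have hI : 0 ≤ ∫ t in τ..(τ + T), ‖deriv z t‖ :=
    intervalIntegral.integral_nonneg (by linarith) fun t _ => norm_nonneg _
  suffices hsuff : sys.mho T w ≤ (∫ t in τ..(τ + T), ‖deriv z t‖) + sys.d + ε by linarith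
  refine Metric.diam_le_of_forall_dist_le
    (add_nonneg (add_nonneg hI Metric.diam_nonneg) hε.le) ?_
  -- By periodicity every value over `[0, T]` recurs in the window. As `τ ≥ T`, the number of
  -- periods shifted is nonnegative.
  have hshift : ∀ a ∈ Icc 0 T, ∃ a' ∈ Icc τ (τ + T), sys.etaT T w a' = sys.etaT T w a := by
    intro a ha
    obtain ⟨k, hk, -⟩ := existsUnique_add_zsmul_mem_Ico hT a τ
    have hk0 : 0 ≤ k := by
      by_contra hneg
      have h3 : (k : ℝ) ≤ -1 := by exact_mod_cast (by omega : k ≤ -1)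
      have h4 := hk.1
      rw [zsmul_eq_mul] at h4
      nlinarith [ha.2]
    lift k to ℕ using hk0
    refine ⟨_, Ico_subset_Icc_self hk, ?_⟩
    rw [zsmul_eq_mul]
    exact (hs.etaT_periodic hw).add_nat_mul hT.le k ha.1
  have hdec : ∀ a, 0 ≤ a → ∃ r ∈ sys.XiInf, sys.etaT T w a
      = z a - mact sys.C (expL sys.F a (x 0 - sys.xiT0 T w))
        - (mact sys.C r + sys.q x z a) := by
    intro a ha
    obtain ⟨r, hr, hxr⟩ := h.exists_mem_XiInf hs hw ha
    refine ⟨r, hr, ?_⟩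
    rw [etaT, q, y, hxr]
    simp only [map_add]
    abel
  have hle : ∀ a' ∈ Icc τ (τ + T), ∀ b' ∈ Icc τ (τ + T), a' ≤ b' →
      ‖sys.etaT T w b' - sys.etaT T w a'‖
        ≤ (∫ t in τ..(τ + T), ‖deriv z t‖) + sys.d + ε := by
    intro a' ha' b' hb' hab
    obtain ⟨r₁, hr₁, e₁⟩ := hdec a' (hτ.trans ha'.1)
    obtain ⟨r₂, hr₂, e₂⟩ := hdec b' (hτ.trans hb'.1)
    have hd := hs.dist_le_d hr₂ hr₁ (h.mem_theta b' (hτ.trans hb'.1))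
      (h.mem_theta a' (hτ.trans ha'.1))
    have hz := h.norm_z_sub_le hτ ha'.1 hab hb'.2
    have hε₁ := hτ₀ a' (h1.trans ha'.1)
    have hε₂ := hτ₀ b' (h1.trans hb'.1)
    have heq : sys.etaT T w b' - sys.etaT T w a' = (z b' - z a')
      - mact sys.C (expL sys.F b' (x 0 - sys.xiT0 T w))
      + mact sys.C (expL sys.F a' (x 0 - sys.xiT0 T w))
      - ((mact sys.C r₂ + sys.q x z b') - (mact sys.C r₁ + sys.q x z a')) := by
      rw [e₁, e₂]; abel
    rw [heq]
    refine (norm_sub_le _ _).trans ?_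
    have h5 := norm_add_le ((z b' - z a') - mact sys.C (expL sys.F b' (x 0 - sys.xiT0 T w)))
      (mact sys.C (expL sys.F a' (x 0 - sys.xiT0 T w)))
    have h6 := norm_sub_le (z b' - z a') (mact sys.C (expL sys.F b' (x 0 - sys.xiT0 T w)))
    linarith
  rintro _ ⟨a, ha, rfl⟩ _ ⟨b, hb, rfl⟩
  obtain ⟨a', ha', ea⟩ := hshift a ha
  obtain ⟨b', hb', eb⟩ := hshift b hb
  rw [← ea, ← eb, dist_eq_norm]
  rcases le_total a' b' with hab | hab
  · rw [norm_sub_rev]; exact hle a' ha' b' hb' hab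
  · exact hle b' hb' a' ha' hab

/-- Since `|z'| ≤ |y'|` and `y'` is `η_T'` plus a transient plus a point of `C (F Ξ_∞ + E Θ)`, the
two persistent terms are exactly those of `R γ_∞`. -/
theorem exists_ae_norm_deriv_z_le (hs : sys.IsExpStable c lam M)
    (hw : IsBoundedPeriodicInput T Mw w) (h : sys.IsTrajectory w x z) {R : ℝ} (hR : 0 < R) {ε : ℝ}
    (hε : 0 < ε) : ∃ τ₀, 0 ≤ τ₀ ∧ ∀ᵐ t ∂volume.restrict (Ici τ₀),
      ‖deriv z t‖ ≤ R * sys.gammaInf R T w + ε := by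
  have hδ : Tendsto (fun t => mact sys.C (mact sys.F (expL sys.F t (x 0 - sys.xiT0 T w))))
      atTop (𝓝 0) := by
    have := (((mactL sys.C).comp (mactL sys.F)).continuous.tendsto 0).comp
      (hs.tendsto_expL (x 0 - sys.xiT0 T w))
    rwa [map_zero] at this
  obtain ⟨τ₀, hτ₀⟩ := eventually_atTop.1 (hδ.norm.eventually_lt_const
    (show ‖(0 : Vec p)‖ < ε by simpa using hε))
  refine ⟨max τ₀ 0, le_max_right _ _, ?_⟩
  have hsub : Ici (max τ₀ 0) ⊆ Ici (0 : ℝ) := Ici_subset_Ici.2 (le_max_right _ _)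
  filter_upwards [ae_restrict_of_ae_restrict_of_subset hsub h.ae_norm_deriv_z_le,
    ae_restrict_of_ae_restrict_of_subset hsub (hs.ae_norm_deriv_etaT_le hw),
    ae_restrict_of_ae_restrict_of_subset hsub (ae_hasDerivAt_etaT (sys := sys) hw),
    ae_restrict_mem measurableSet_Ici] with t h1 h2 h3 hmem
  have ht : 0 ≤ t := (le_max_right _ _).trans hmem
  obtain ⟨r, hr, hxr⟩ := h.exists_mem_XiInf hs hw ht
  have h4 := hs.norm_le_hausdorffDeviation hr (h.mem_theta t ht)
  have h5 := hτ₀ t ((le_max_left _ _).trans hmem)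
  rw [h3.deriv] at h2
  have heq : mact sys.C (mact sys.F (x t) + mact sys.B (w t) + mact sys.E (sys.q x z t))
      = mact sys.C (mact sys.F (sys.xiT T w t) + mact sys.B (w t))
        + mact sys.C (mact sys.F (expL sys.F t (x 0 - sys.xiT0 T w)))
        + mact sys.C (mact sys.F r + mact sys.E (sys.q x z t)) := by
    conv_lhs => rw [hxr]
    simp only [map_add]
    abel
  rw [heq] at h1
  have h6 := norm_add₃_le (a := mact sys.C (mact sys.F (sys.xiT T w t) + mact sys.B (w t)))
    (b := mact sys.C (mact sys.F (expL sys.F t (x 0 - sys.xiT0 T w))))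
    (c := mact sys.C (mact sys.F r + mact sys.E (sys.q x z t)))
  rw [gammaInf, ← mul_assoc, mul_one_div_cancel hR.ne', one_mul]
  linarith

end IsTrajectory

end BacklashSystem

/-! ### Mean rates and Lyapunov exponents. -/

theorem exists_integral_le_add_mul {f : ℝ → ℝ} {b κ T τ₀ : ℝ} (hT : 0 < T) (hτ₀ : 0 ≤ τ₀)
    (hf : ∀ t, 0 ≤ t → IntervalIntegrable f volume 0 t) (hb0 : 0 ≤ b) (hb : ∀ t, f t ≤ b)
    (hmean : ∀ τ, τ₀ ≤ τ → ∫ t in τ..(τ + T), f t ≤ T * κ) :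
    ∃ c, ∀ t, 0 ≤ t → ∫ s in (0 : ℝ)..t, f s ≤ c + κ * t := by
  -- Windows of length `T` are peeled off the right end until `t ≤ τ₀ + T`; there `f ≤ b`, and the
  -- constant absorbs both `b t` and `-κ t`.
  refine ⟨(b + |κ|) * (τ₀ + T), fun t ht => ?_⟩
  obtain ⟨k, hk⟩ : ∃ k : ℕ, t ≤ τ₀ + (k + 1) * T := by
    obtain ⟨k, hk⟩ := exists_nat_ge (t / T)
    rw [div_le_iff₀ hT] at hk
    exact ⟨k, by nlinarith⟩
  induction k generalizing t with
  | zero =>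
    have h1 : ∫ s in (0 : ℝ)..t, f s ≤ ∫ s in (0 : ℝ)..t, b :=
      intervalIntegral.integral_mono_on ht (hf t ht) intervalIntegrable_const fun s _ => hb s
    rw [intervalIntegral.integral_const, smul_eq_mul, sub_zero] at h1
    have h2 : t ≤ τ₀ + T := by simpa using hk
    have h3 := neg_abs_le κ
    nlinarith [abs_nonneg κ, mul_le_mul_of_nonneg_right h2 hb0,
      mul_le_mul_of_nonneg_right h2 (abs_nonneg κ)]
  | succ k ih =>
    rcases le_or_gt t (τ₀ + (k + 1) * T) with h | h
    · exact ih t ht h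
    · have h0 : τ₀ ≤ t - T := by nlinarith [mul_nonneg k.cast_nonneg hT.le]
      have h1 := ih (t - T) (hτ₀.trans h0) (by push_cast at hk; linarith)
      have h2 := hmean (t - T) h0
      rw [sub_add_cancel] at h2
      have h3 := hf (t - T) (hτ₀.trans h0)
      rw [← intervalIntegral.integral_add_adjacent_intervals h3 (h3.symm.trans (hf t ht))]
      linarith

theorem limsup_le_coe_of_forall_lt {u : ℝ → EReal} {a : ℝ}
    (h : ∀ κ : ℝ, a < κ → ∀ᶠ t in atTop, u t ≤ (κ : EReal)) :
    limsup u atTop ≤ (a : EReal) := by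
  refine EReal.le_of_forall_lt_iff_le.1 fun κ hκ => ?_
  exact limsup_le_of_le (by isBoundedDefault) (h κ (EReal.coe_lt_coe_iff.1 hκ))

namespace BacklashSystem

variable {m n p : ℕ} {sys : BacklashSystem m n p} {c lam M T Mw R : ℝ} {w : ℝ → Vec m}
  {P : Matrix (Fin n) (Fin n) ℝ} {x₁ x₂ : ℝ → Vec n} {z₁ z₂ : ℝ → Vec p}

theorem gammaInf_nonneg (hR : 0 < R) : 0 ≤ sys.gammaInf R T w := by
  have : 0 ≤ hausdorffDeviation
      (mact sys.C '' (mact sys.F '' sys.XiInf + mact sys.E '' sys.Theta)) {0} := by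
    refine Real.sSup_nonneg ?_
    rintro _ ⟨v, -, rfl⟩
    exact Metric.infDist_nonneg
  unfold gammaInf
  positivity

theorem IsExpStable.eventually_ae_gammaRate_le (hs : sys.IsExpStable c lam M)
    (hw : IsBoundedPeriodicInput T Mw w) (h₁ : sys.IsTrajectory w x₁ z₁)
    (h₂ : sys.IsTrajectory w x₂ z₂) (hR : 0 < R) {ε : ℝ} (hε : 0 < ε) :
    ∃ τ₀, 0 ≤ τ₀ ∧ ∀ᵐ t ∂volume.restrict (Ici τ₀),
      gammaRate R z₁ z₂ t ≤ sys.gammaInf R T w + ε := by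
  obtain ⟨τ₁, hτ₁, h₁⟩ := h₁.exists_ae_norm_deriv_z_le hs hw hR (mul_pos hR hε)
  obtain ⟨τ₂, hτ₂, h₂⟩ := h₂.exists_ae_norm_deriv_z_le hs hw hR (mul_pos hR hε)
  refine ⟨max τ₁ τ₂, le_max_of_le_left hτ₁, ?_⟩
  filter_upwards [ae_restrict_of_ae_restrict_of_subset (Ici_subset_Ici.2 (le_max_left τ₁ τ₂)) h₁,
    ae_restrict_of_ae_restrict_of_subset (Ici_subset_Ici.2 (le_max_right τ₁ τ₂)) h₂] with t e₁ e₂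
  calc gammaRate R z₁ z₂ t ≤ 1 / (2 * R) * ((R * sys.gammaInf R T w + R * ε)
        + (R * sys.gammaInf R T w + R * ε)) := by unfold gammaRate; gcongr
    _ = _ := by field_simp; ring

theorem IsExpStable.eventually_gamma1_le (hs : sys.IsExpStable c lam M)
    (hw : IsBoundedPeriodicInput T Mw w) (h₁ : sys.IsTrajectory w x₁ z₁)
    (h₂ : sys.IsTrajectory w x₂ z₂) (hR : 0 < R) {ε : ℝ} (hε : 0 < ε) :
    ∀ᶠ τ in atTop, T * (sys.gamma1 R T w - ε) ≤ ∫ t in τ..(τ + T), gammaRate R z₁ z₂ t := by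
  have hT := hw.pos
  have hε' : 0 < T * R * ε := by positivity
  filter_upwards [h₁.eventually_mho_le hs hw hε', h₂.eventually_mho_le hs hw hε',
    eventually_ge_atTop 0] with τ e₁ e₂ hτ
  have hτT : 0 ≤ τ + T := by linarith
  have hnn : ∀ z : ℝ → Vec p, 0 ≤ ∫ t in τ..(τ + T), ‖deriv z t‖ := fun z =>
    intervalIntegral.integral_nonneg (by linarith) fun t _ => norm_nonneg _
  have hmax : ∀ z : ℝ → Vec p, sys.mho T w - sys.d - T * R * ε
      ≤ ∫ t in τ..(τ + T), ‖deriv z t‖ →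
      max (sys.mho T w - sys.d) 0 - T * R * ε ≤ ∫ t in τ..(τ + T), ‖deriv z t‖ := fun z hz => by
    rw [sub_le_iff_le_add, max_le_iff]
    constructor <;> linarith [hnn z]
  unfold gammaRate
  rw [intervalIntegral.integral_const_mul, intervalIntegral.integral_add
    (h₁.intervalIntegrable_norm_deriv_z hτ hτT) (h₂.intervalIntegrable_norm_deriv_z hτ hτT)]
  have e := add_le_add (hmax z₁ e₁) (hmax z₂ e₂)
  calc T * (sys.gamma1 R T w - ε) = 1 / (2 * R) * ((max (sys.mho T w - sys.d) 0 - T * R * ε)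
        + (max (sys.mho T w - sys.d) 0 - T * R * ε)) := by unfold gamma1; field_simp; ring
    _ ≤ _ := by gcongr

theorem intervalIntegrable_psi' (hP : P.PosDef) (lam : ℝ) (h₁ : sys.IsTrajectory w x₁ z₁)
    (h₂ : sys.IsTrajectory w x₂ z₂) (hR : 0 < R) {a b : ℝ} (ha : 0 ≤ a) (hb : 0 ≤ b) :
    IntervalIntegrable (fun s => sys.psi P lam (gammaRate R z₁ z₂ s)) volume a b :=
  (intervalIntegrable_psi hP lam h₁ h₂ hR ha).symm.trans (intervalIntegrable_psi hP lam h₁ h₂ hR hb)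

/-- The chord is affine in `u`, so a lower bound on the mean of `γ` yields an upper bound on the
mean of `ψ(γ)`. -/
theorem psi_le_chord (hP : P.PosDef) (lam : ℝ) {u G : ℝ} (hG : 0 < G) (hu : 0 ≤ u) (huG : u ≤ G) :
    sys.psi P lam u ≤ sys.psi P lam 0 - u * ((sys.psi P lam 0 - sys.psi P lam G) / G) := by
  have h := (sys.psi_convexOn hP lam).2 (mem_Ici.2 le_rfl) (mem_Ici.2 hG.le)
    (sub_nonneg.2 ((div_le_one hG).2 huG)) (div_nonneg hu hG.le) (sub_add_cancel 1 (u / G))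
  simp only [smul_eq_mul, mul_zero, zero_add, div_mul_cancel₀ u hG.ne'] at h
  refine h.trans (le_of_eq ?_)
  field_simp
  ring

/-- Eventually `γ ≤ γ_∞ + ε` almost everywhere and the mean of `γ` is at least `γ₁ - ε`; averaging
the chord over `[0, γ_∞ + ε]` gives a bound that tends to `θ` with `ε`. -/
theorem IsExpStable.eventually_mean_psi_le (hs : sys.IsExpStable c lam M)
    (hw : IsBoundedPeriodicInput T Mw w) (hP : P.PosDef) (h₁ : sys.IsTrajectory w x₁ z₁)
    (h₂ : sys.IsTrajectory w x₂ z₂) (hR : 0 < R) {κ : ℝ} (hκ : sys.theta P lam R T w < κ) :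
    ∀ᶠ τ in atTop, ∫ t in τ..(τ + T), sys.psi P lam (gammaRate R z₁ z₂ t) ≤ T * κ := by
  have hT := hw.pos
  rcases (gammaInf_nonneg (sys := sys) (T := T) (w := w) hR).eq_or_lt with h0 | h0
  -- For `γ_∞ = 0` the convention on division makes `θ = ψ(0)`, and monotonicity of `ψ` suffices.
  · rw [theta, ← h0, div_zero, zero_mul, sub_zero] at hκ
    filter_upwards [eventually_ge_atTop 0] with τ hτ
    have h3 : ∫ t in τ..(τ + T), sys.psi P lam (gammaRate R z₁ z₂ t)
        ≤ ∫ t in τ..(τ + T), sys.psi P lam 0 :=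
      intervalIntegral.integral_mono_on (by linarith)
        (intervalIntegrable_psi' hP lam h₁ h₂ hR hτ (by linarith)) intervalIntegrable_const
        fun t _ => sys.psi_antitone hP lam (gammaRate_nonneg hR z₁ z₂ t)
    rw [intervalIntegral.integral_const, smul_eq_mul, add_sub_cancel_left] at h3
    nlinarith
  · set g := sys.gammaInf R T w
    set g₁ := sys.gamma1 R T w
    -- The bound depends continuously on `ε` and equals `θ < κ` at `0`, so some `ε > 0` keeps it
    -- below `κ`.
    have hcont : ContinuousAt (fun ε : ℝ => sys.psi P lam 0 - (g₁ - ε) / (g + ε)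
        * (sys.psi P lam 0 - sys.psi P lam (g + ε))) 0 := by
      have h1 : ContinuousAt (fun ε : ℝ => sys.psi P lam (g + ε)) 0 :=
        ((sys.continuous_psi P lam).comp (continuous_const.add continuous_id)).continuousAt
      have h2 : ContinuousAt (fun ε : ℝ => (g₁ - ε) / (g + ε)) 0 :=
        ContinuousAt.div (by fun_prop) (by fun_prop) (by simpa using h0.ne')
      exact continuousAt_const.sub (h2.mul (continuousAt_const.sub h1))
    have hlt : sys.psi P lam 0 - (g₁ - 0) / (g + 0)
        * (sys.psi P lam 0 - sys.psi P lam (g + 0)) < κ := by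
      rw [sub_zero, add_zero]; exact hκ
    obtain ⟨ε, hεκ, hε⟩ := (((hcont.eventually_lt_const hlt).filter_mono
      (nhdsWithin_le_nhds (s := Ioi 0))).and self_mem_nhdsWithin).exists
    have hε : 0 < ε := hε
    have hG : 0 < g + ε := add_pos h0 hε
    obtain ⟨τ₀, hτ₀, hγ⟩ := hs.eventually_ae_gammaRate_le hw h₁ h₂ hR hε
    filter_upwards [hs.eventually_gamma1_le hw h₁ h₂ hR hε, eventually_ge_atTop τ₀] with τ e hτ
    have hτ0 : 0 ≤ τ := hτ₀.trans hτ
    have hγi : IntervalIntegrable (gammaRate R z₁ z₂) volume τ (τ + T) :=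
      (intervalIntegrable_gammaRate h₁ h₂ R hτ0).symm.trans
        (intervalIntegrable_gammaRate h₁ h₂ R (by linarith))
    set D := (sys.psi P lam 0 - sys.psi P lam (g + ε)) / (g + ε) with hD
    have hD0 : 0 ≤ D := div_nonneg (sub_nonneg.2 (sys.psi_antitone hP lam hG.le)) hG.le
    have h3 : ∫ t in τ..(τ + T), sys.psi P lam (gammaRate R z₁ z₂ t)
        ≤ ∫ t in τ..(τ + T), (sys.psi P lam 0 - gammaRate R z₁ z₂ t * D) := by
      refine intervalIntegral.integral_mono_ae_restrict (by linarith)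
        (intervalIntegrable_psi' hP lam h₁ h₂ hR hτ0 (by linarith))
        (intervalIntegrable_const.sub (hγi.mul_const D)) ?_
      filter_upwards [ae_restrict_of_ae_restrict_of_subset
        (Icc_subset_Ici_self.trans (Ici_subset_Ici.2 hτ)) hγ] with t ht
      exact psi_le_chord hP lam hG (gammaRate_nonneg hR z₁ z₂ t) ht
    rw [intervalIntegral.integral_sub intervalIntegrable_const (hγi.mul_const D),
      intervalIntegral.integral_mul_const, intervalIntegral.integral_const, smul_eq_mul,
      add_sub_cancel_left] at h3
    have h4 : sys.psi P lam 0 - (g₁ - ε) * D < κ := by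
      refine lt_of_eq_of_lt ?_ hεκ
      rw [hD]; ring
    nlinarith [mul_le_mul_of_nonneg_right e hD0]

theorem IsExpStable.exists_integral_psi_le (hs : sys.IsExpStable c lam M)
    (hw : IsBoundedPeriodicInput T Mw w) (hP : P.PosDef) (h₁ : sys.IsTrajectory w x₁ z₁)
    (h₂ : sys.IsTrajectory w x₂ z₂) (hR : 0 < R) {κ : ℝ} (hκ : sys.theta P lam R T w < κ) :
    ∃ b, ∀ t, 0 ≤ t → ∫ s in (0 : ℝ)..t, sys.psi P lam (gammaRate R z₁ z₂ s) ≤ b + κ * t := by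
  obtain ⟨τ₀, hτ₀⟩ := eventually_atTop.1 (hs.eventually_mean_psi_le hw hP h₁ h₂ hR hκ)
  exact exists_integral_le_add_mul hw.pos (le_max_right τ₀ 0)
    (fun t ht => intervalIntegrable_psi hP lam h₁ h₂ hR ht) (abs_nonneg (sys.psi P lam 0))
    (fun t => (sys.psi_antitone hP lam (gammaRate_nonneg hR z₁ z₂ t)).trans (le_abs_self _))
    fun τ hτ => hτ₀ τ ((le_max_left _ _).trans hτ)

theorem IsExpStable.limsup_mean_window_le (hs : sys.IsExpStable c lam M)
    (hw : IsBoundedPeriodicInput T Mw w) (hP : P.PosDef) (h₁ : sys.IsTrajectory w x₁ z₁)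
    (h₂ : sys.IsTrajectory w x₂ z₂) (hR : 0 < R) :
    limsup (fun τ : ℝ =>
      (((1 / T) * ∫ t in τ..(τ + T), sys.psi P lam (gammaRate R z₁ z₂ t) : ℝ) : EReal)) atTop
      ≤ ((sys.theta P lam R T w : ℝ) : EReal) := by
  refine limsup_le_coe_of_forall_lt fun κ hκ => ?_
  filter_upwards [hs.eventually_mean_psi_le hw hP h₁ h₂ hR hκ] with τ hτ
  rw [EReal.coe_le_coe_iff, one_div, inv_mul_le_iff₀ hw.pos]
  exact hτ

theorem IsExpStable.limsup_mean_le (hs : sys.IsExpStable c lam M)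
    (hw : IsBoundedPeriodicInput T Mw w) (hP : P.PosDef) (h₁ : sys.IsTrajectory w x₁ z₁)
    (h₂ : sys.IsTrajectory w x₂ z₂) (hR : 0 < R) :
    limsup (fun t : ℝ =>
      (((1 / t) * ∫ s in (0 : ℝ)..t, sys.psi P lam (gammaRate R z₁ z₂ s) : ℝ) : EReal)) atTop
      ≤ ((sys.theta P lam R T w : ℝ) : EReal) := by
  refine limsup_le_coe_of_forall_lt fun κ hκ => ?_
  obtain ⟨κ', h1, h2⟩ := exists_between hκ
  obtain ⟨b, hb⟩ := hs.exists_integral_psi_le hw hP h₁ h₂ hR h1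
  filter_upwards [eventually_gt_atTop 0, eventually_ge_atTop (b / (κ - κ'))] with t ht htb
  rw [EReal.coe_le_coe_iff, one_div, inv_mul_le_iff₀ ht]
  rw [div_le_iff₀ (sub_pos.2 h2)] at htb
  linarith [hb t ht.le]

theorem half_limsup_log_V_le {V g : ℝ → ℝ} (hV : ∀ t, 0 ≤ V t)
    (h : ∀ t, 0 ≤ t → Real.sqrt (V t) ≤ Real.sqrt (V 0) * Real.exp (g t)) :
    ((1 / 2 : ℝ) : EReal) * limsup (fun t : ℝ =>
        ((1 / t : ℝ) : EReal) * ENNReal.log (ENNReal.ofReal (V t))) atTop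
      ≤ limsup (fun t : ℝ => (((1 / t) * g t : ℝ) : EReal)) atTop := by
  refine EReal.le_of_forall_lt_iff_le.1 fun κ hκ => ?_
  obtain ⟨κ', h1, h2⟩ := EReal.lt_iff_exists_real_btwn.1 hκ
  have h2 : κ' < κ := EReal.coe_lt_coe_iff.1 h2
  have hev := eventually_lt_of_limsup_lt h1
  have hle : limsup (fun t : ℝ =>
      ((1 / t : ℝ) : EReal) * ENNReal.log (ENNReal.ofReal (V t))) atTop ≤ ((2 * κ : ℝ) : EReal) := by
    refine limsup_le_of_le (by isBoundedDefault) ?_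
    filter_upwards [hev, eventually_gt_atTop 0,
      -- Beyond this time `ln V(0) / 2` is absorbed by the gap `(κ - κ') t`.
      eventually_ge_atTop (Real.log (V 0) / (2 * (κ - κ')))] with t hg ht htb
    rw [EReal.coe_lt_coe_iff, one_div, inv_mul_lt_iff₀ ht] at hg
    rw [div_le_iff₀ (by linarith)] at htb
    have hpos : 0 < 1 / t := by positivity
    rw [ENNReal.log_ofReal]
    split_ifs with hVt
    -- Where `V(t) = 0` the extended logarithm is `⊥`, and a positive factor preserves it.
    · rw [EReal.coe_mul_bot_of_pos hpos]
      exact bot_le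
    · rw [not_le] at hVt
      have h3 := h t ht.le
      have hV0 : 0 < V 0 := by
        refine (hV 0).lt_of_ne fun h0 => ?_
        rw [← h0, Real.sqrt_zero, zero_mul] at h3
        exact absurd h3 (not_le.2 (Real.sqrt_pos.2 hVt))
      have h4 := Real.log_le_log (Real.sqrt_pos.2 hVt) h3
      rw [Real.log_mul (Real.sqrt_pos.2 hV0).ne' (Real.exp_pos _).ne', Real.log_exp,
        Real.log_sqrt (hV t), Real.log_sqrt (hV 0)] at h4
      rw [← EReal.coe_mul, EReal.coe_le_coe_iff, one_div, inv_mul_le_iff₀ ht]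
      nlinarith
  calc _ ≤ ((1 / 2 : ℝ) : EReal) * ((2 * κ : ℝ) : EReal) := by
        refine mul_le_mul_of_nonneg_left hle ?_
        exact_mod_cast (by norm_num : (0 : ℝ) ≤ 1 / 2)
    _ = _ := by
        rw [← EReal.coe_mul]
        congr 1
        ring

/-- Any two trajectories approach each other at every exponential rate above `θ`. -/
theorem IsExpStable.exists_norm_sub_le (hs : sys.IsExpStable c lam M)
    (hw : IsBoundedPeriodicInput T Mw w) (hcompact : IsCompact sys.Theta)
    (hstrong : IsStronglyConvexWith sys.Theta R)
    (hLyap : (-lam • P - symmetrizer (P * sys.F)).PosSemidef)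
    (hP : P.PosDef) (h₁ : sys.IsTrajectory w x₁ z₁)
    (h₂ : sys.IsTrajectory w x₂ z₂) (hR : 0 < R) {κ : ℝ} (hκ : sys.theta P lam R T w < κ) :
    ∃ K, ∀ t, 0 ≤ t → ‖x₁ t - x₂ t‖ + ‖z₁ t - z₂ t‖ ≤ K * Real.exp (κ * t) := by
  obtain ⟨b, hb⟩ := hs.exists_integral_psi_le hw hP h₁ h₂ hR hκ
  obtain ⟨k, hk, hkP⟩ := hP.exists_norm_sq_le
  refine ⟨(Real.sqrt k * (1 + ‖mactL sys.C‖) + 1)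
    * (Real.sqrt (sys.V P x₁ z₁ x₂ z₂ 0) * Real.exp b), fun t ht => ?_⟩
  have hV := sqrt_V_le hcompact hR hstrong hP hLyap h₁ h₂ ht
  have hV' : Real.sqrt (sys.V P x₁ z₁ x₂ z₂ t)
      ≤ Real.sqrt (sys.V P x₁ z₁ x₂ z₂ 0) * Real.exp b * Real.exp (κ * t) := by
    rw [mul_assoc, ← Real.exp_add]
    exact hV.trans (mul_le_mul_of_nonneg_left (Real.exp_le_exp.2 (hb t ht)) (Real.sqrt_nonneg _))
  have hx : ‖x₁ t - x₂ t‖ ≤ Real.sqrt k * Real.sqrt (sys.V P x₁ z₁ x₂ z₂ t) := by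
    rw [← Real.sqrt_mul hk.le]
    refine Real.le_sqrt_of_sq_le ((hkP _).trans (mul_le_mul_of_nonneg_left ?_ hk.le))
    exact le_add_of_nonneg_right (sq_nonneg _)
  have hq : ‖sys.q x₁ z₁ t - sys.q x₂ z₂ t‖ ≤ Real.sqrt (sys.V P x₁ z₁ x₂ z₂ t) :=
    Real.le_sqrt_of_sq_le (le_add_of_nonneg_left (hP.posSemidef.inner_mact_nonneg _))
  have hz : ‖z₁ t - z₂ t‖ ≤ ‖sys.q x₁ z₁ t - sys.q x₂ z₂ t‖ + ‖mactL sys.C‖ * ‖x₁ t - x₂ t‖ := by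
    have h3 : z₁ t - z₂ t = (sys.q x₁ z₁ t - sys.q x₂ z₂ t) + mactL sys.C (x₁ t - x₂ t) := by
      simp only [q, y, mactL_apply, map_sub]; abel
    rw [h3]
    exact (norm_add_le _ _).trans (add_le_add le_rfl ((mactL sys.C).le_opNorm _))
  calc ‖x₁ t - x₂ t‖ + ‖z₁ t - z₂ t‖
      ≤ (1 + ‖mactL sys.C‖) * ‖x₁ t - x₂ t‖ + ‖sys.q x₁ z₁ t - sys.q x₂ z₂ t‖ := by linarith
    _ ≤ (1 + ‖mactL sys.C‖) * (Real.sqrt k * Real.sqrt (sys.V P x₁ z₁ x₂ z₂ t))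
        + Real.sqrt (sys.V P x₁ z₁ x₂ z₂ t) := by gcongr
    _ = (Real.sqrt k * (1 + ‖mactL sys.C‖) + 1) * Real.sqrt (sys.V P x₁ z₁ x₂ z₂ t) := by ring
    _ ≤ (Real.sqrt k * (1 + ‖mactL sys.C‖) + 1)
        * (Real.sqrt (sys.V P x₁ z₁ x₂ z₂ 0) * Real.exp b * Real.exp (κ * t)) := by gcongr
    _ = _ := by ring

end BacklashSystem

namespace BacklashSystem

variable {m n p : ℕ} {sys : BacklashSystem m n p}

/-! ### Trajectories characterised by quadratic estimates -/

/-- The pair `(x, z)` satisfies, up to errors quadratic in the increments of the time `τ`, the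
discretised system with the integrated input `W`. For `τ = id` this characterises Lipschitz
trajectories, and the estimates pass to pointwise limits. -/
structure IsQuadraticSolution (sys : BacklashSystem m n p) (W : ℝ → Vec n) (K τ : ℝ → ℝ)
    (x : ℝ → Vec n) (z : ℝ → Vec p) : Prop where
  mem_theta : ∀ t, 0 ≤ t → sys.q x z t ∈ sys.Theta
  norm_x_sub_le : ∀ S s t, 0 ≤ s → s ≤ t → t ≤ S → ‖x t - x s‖ ≤ K S * (τ t - τ s)
  norm_z_sub_le : ∀ S s t, 0 ≤ s → s ≤ t → t ≤ S → ‖z t - z s‖ ≤ K S * (τ t - τ s)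
  norm_x_sub_sub_le : ∀ S s t, 0 ≤ s → s ≤ t → t ≤ S →
    ‖x t - x s - (τ t - τ s) • (mact sys.F (x s) + mact sys.E (sys.q x z s))
      - (W (τ t) - W (τ s))‖ ≤ K S * (τ t - τ s) ^ 2
  le_inner : ∀ S s t, 0 ≤ s → s ≤ t → t ≤ S → ∀ v ∈ sys.Theta,
    -(K S * (τ t - τ s) ^ 2) ≤ inner ℝ (z t - z s) (v - sys.q x z s)

namespace IsQuadraticSolution

variable {W : ℝ → Vec n} {K : ℝ → ℝ} {x : ℝ → Vec n} {z : ℝ → Vec p}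

/-- Each condition involves values at only one or two times and is closed, so pointwise convergence
suffices without any control of derivatives. The constants must not depend on the index. -/
theorem of_tendsto {ι : Type*} {l : Filter ι} [l.NeBot] (hclosed : IsClosed sys.Theta)
    {τi : ι → ℝ → ℝ} {xi : ι → ℝ → Vec n} {zi : ι → ℝ → Vec p}
    (h : ∀ i, sys.IsQuadraticSolution W K (τi i) (xi i) (zi i))
    (hx : ∀ t, 0 ≤ t → Tendsto (fun i => xi i t) l (𝓝 (x t)))
    (hz : ∀ t, 0 ≤ t → Tendsto (fun i => zi i t) l (𝓝 (z t)))
    (hτ : ∀ t, 0 ≤ t → Tendsto (fun i => τi i t) l (𝓝 t))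
    (hW : ∀ t, 0 ≤ t → Tendsto (fun i => W (τi i t)) l (𝓝 (W t))) :
    sys.IsQuadraticSolution W K id x z := by
  have hC : ∀ {r s : ℕ} (N : Matrix (Fin r) (Fin s) ℝ) {f : ι → Vec s} {a : Vec s},
      Tendsto f l (𝓝 a) → Tendsto (fun i => mact N (f i)) l (𝓝 (mact N a)) := fun N _ a hf =>
    ((mactL N).continuous.tendsto a).comp hf
  have hq : ∀ t, 0 ≤ t → Tendsto (fun i => sys.q (xi i) (zi i) t) l (𝓝 (sys.q x z t)) :=
    fun t ht => (hz t ht).sub (hC _ (hx t ht))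
  refine ⟨fun t ht => hclosed.mem_of_tendsto (hq t ht) (Eventually.of_forall fun i =>
    (h i).mem_theta t ht), fun S s t hs hst hS => ?_, fun S s t hs hst hS => ?_,
    fun S s t hs hst hS => ?_, fun S s t hs hst hS v hv => ?_⟩ <;>
    have ht := hs.trans hst <;> have hd := (hτ t ht).sub (hτ s hs)
  · exact le_of_tendsto_of_tendsto' ((hx t ht).sub (hx s hs)).norm (hd.const_mul (K S))
      fun i => (h i).norm_x_sub_le S s t hs hst hS
  · exact le_of_tendsto_of_tendsto' ((hz t ht).sub (hz s hs)).norm (hd.const_mul (K S))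
      fun i => (h i).norm_z_sub_le S s t hs hst hS
  · exact le_of_tendsto_of_tendsto' ((((hx t ht).sub (hx s hs)).sub
      (hd.smul ((hC _ (hx s hs)).add (hC _ (hq s hs))))).sub ((hW t ht).sub (hW s hs))).norm
      ((hd.pow 2).const_mul (K S)) fun i => (h i).norm_x_sub_sub_le S s t hs hst hS
  · exact le_of_tendsto_of_tendsto' ((hd.pow 2).const_mul (K S)).neg
      (((hz t ht).sub (hz s hs)).inner (tendsto_const_nhds.sub (hq s hs)))
      fun i => (h i).le_inner S s t hs hst hS v hv

/-- The constant is independent of the horizon because the shift moves the horizon from `S` to `S +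
T`. -/
theorem comp_add_const {k T : ℝ} (hT : 0 ≤ T)
    (h : sys.IsQuadraticSolution W (fun _ => k) id x z)
    (hW : ∀ s t, 0 ≤ s → s ≤ t → W (t + T) - W (s + T) = W t - W s) :
    sys.IsQuadraticSolution W (fun _ => k) id (fun t => x (t + T)) (fun t => z (t + T)) := by
  refine ⟨fun t ht => h.mem_theta _ (by positivity), fun S s t hs hst hS => ?_,
    fun S s t hs hst hS => ?_, fun S s t hs hst hS => ?_, fun S s t hs hst hS v hv => ?_⟩ <;>
    have hs' : 0 ≤ s + T := by positivity
  · simpa using h.norm_x_sub_le (S + T) (s + T) (t + T) hs' (by linarith) (by linarith)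
  · simpa using h.norm_z_sub_le (S + T) (s + T) (t + T) hs' (by linarith) (by linarith)
  · have := h.norm_x_sub_sub_le (S + T) (s + T) (t + T) hs' (by linarith) (by linarith)
    simp only [id, add_sub_add_right_eq_sub, hW s t hs hst] at this
    exact this
  · have := h.le_inner (S + T) (s + T) (t + T) hs' (by linarith) (by linarith) v hv
    simp only [id, add_sub_add_right_eq_sub] at this
    exact this

end IsQuadraticSolution

theorem lipschitzOnWith_of_norm_sub_le {r : ℕ} {f : ℝ → Vec r} {k S : ℝ}
    (h : ∀ s t, 0 ≤ s → s ≤ t → t ≤ S → ‖f t - f s‖ ≤ k * (t - s)) :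
    LipschitzOnWith k.toNNReal f (Icc 0 S) := by
  have key : ∀ s t, 0 ≤ s → s ≤ t → t ≤ S → dist (f t) (f s) ≤ k.toNNReal * dist t s :=
    fun s t hs hst hS => by
      rw [dist_eq_norm, Real.dist_eq, abs_of_nonneg (sub_nonneg.2 hst)]
      exact (h s t hs hst hS).trans (mul_le_mul_of_nonneg_right (Real.le_coe_toNNReal k)
        (sub_nonneg.2 hst))
  refine LipschitzOnWith.of_dist_le_mul fun a ha b hb => ?_
  rcases le_total a b with hab | hab
  · rw [dist_comm, dist_comm a b]
    exact key a b ha.1 hab hb.2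
  · exact key b a hb.1 hab ha.2

theorem ae_differentiableAt_of_lipschitzOnWith {r : ℕ} {f : ℝ → Vec r} {k : ℝ → NNReal}
    (h : ∀ S, 0 ≤ S → LipschitzOnWith (k S) f (Icc 0 S)) :
    ∀ᵐ t ∂volume.restrict (Ici (0 : ℝ)), DifferentiableAt ℝ f t := by
  rw [← restrict_Ioi_eq_restrict_Ici, ae_restrict_iff' measurableSet_Ioi]
  filter_upwards [ae_all_iff.2 fun j : ℕ =>
    (h j j.cast_nonneg).ae_differentiableWithinAt_of_mem_real] with t ht h0
  obtain ⟨j, hj⟩ := exists_nat_gt t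
  exact (ht j ⟨le_of_lt h0, hj.le⟩).differentiableAt (Icc_mem_nhds h0 hj)

/-- The quadratic error is `o(s - t)`, so `f - W` has the right derivative `g`. -/
theorem hasDerivWithinAt_of_norm_sub_sub_le {r : ℕ} {f W : ℝ → Vec r} {g b : Vec r} {t k : ℝ}
    (hW : HasDerivAt W b t)
    (h : ∀ s, t ≤ s → s ≤ t + 1 → ‖f s - f t - (s - t) • g - (W s - W t)‖ ≤ k * (s - t) ^ 2) :
    HasDerivWithinAt f (g + b) (Ici t) t := by
  have h1 : HasDerivWithinAt (fun s => f s - W s) g (Ici t) t := by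
    rw [hasDerivWithinAt_iff_isLittleO]
    have hO : (fun s => (f s - W s) - (f t - W t) - (s - t) • g) =O[𝓝[Ici t] t]
        fun s => (s - t) ^ 2 := by
      refine Asymptotics.IsBigO.of_bound k ?_
      filter_upwards [self_mem_nhdsWithin, nhdsWithin_le_nhds
        (eventually_lt_nhds (show t < t + 1 by linarith))] with s hs hs1
      have := h s hs hs1.le
      rw [Real.norm_of_nonneg (sq_nonneg (s - t))]
      refine le_of_eq_of_le (congrArg norm ?_) this
      abel
    refine hO.trans_isLittleO ?_
    have h2 : (fun s : ℝ => (s - t) ^ 2) =o[𝓝 t] fun s => s - t := by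
      have h3 := Asymptotics.isLittleO_pow_id (𝕜 := ℝ) (n := 2) (by norm_num)
      refine h3.comp_tendsto (k := fun s : ℝ => s - t) ?_
      have : Continuous fun s : ℝ => s - t := by fun_prop
      simpa using this.tendsto t
    exact h2.mono nhdsWithin_le_nhds
  have h2 := h1.add hW.hasDerivWithinAt
  refine h2.congr (fun s _ => ?_) ?_ <;> simp

/-- Lipschitz functions are differentiable almost everywhere, and dividing the estimates by the
increment gives the state equation and puts `z'` in the normal cone. The projection property is then
automatic: `q` stays in `Θ`, so every normal at `q` is orthogonal to `q' = z' - y'`, and Pythagoras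
makes `z'` the closest point of the cone to `y'`. -/
theorem IsQuadraticSolution.isTrajectory {w : ℝ → Vec m} {W : ℝ → Vec n} {K : ℝ → ℝ}
    {x : ℝ → Vec n} {z : ℝ → Vec p} (h : sys.IsQuadraticSolution W K id x z)
    (hW : ∀ᵐ t ∂volume.restrict (Ici (0 : ℝ)), HasDerivAt W (mact sys.B (w t)) t) :
    sys.IsTrajectory w x z := by
  have hlx : ∀ S, 0 ≤ S → LipschitzOnWith (K S).toNNReal x (Icc 0 S) := fun S _ =>
    lipschitzOnWith_of_norm_sub_le (h.norm_x_sub_le S)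
  have hlz : ∀ S, 0 ≤ S → LipschitzOnWith (K S).toNNReal z (Icc 0 S) := fun S _ =>
    lipschitzOnWith_of_norm_sub_le (h.norm_z_sub_le S)
  have hx : ∀ᵐ t ∂volume.restrict (Ici (0 : ℝ)), HasDerivAt x
      ((mact sys.F (x t) + mact sys.E (sys.q x z t)) + mact sys.B (w t)) t := by
    filter_upwards [hW, ae_differentiableAt_of_lipschitzOnWith hlx,
      ae_restrict_mem measurableSet_Ici] with t hW hdx ht
    have h1 := hasDerivWithinAt_of_norm_sub_sub_le hW fun s hts hs =>
      h.norm_x_sub_sub_le (t + 1) t s ht hts hs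
    have h2 := (uniqueDiffWithinAt_Ici t).eq_deriv _ hdx.hasDerivAt.hasDerivWithinAt h1
    rw [← h2]
    exact hdx.hasDerivAt
  have h0 : ∀ᵐ t ∂volume.restrict (Ici (0 : ℝ)), 0 < t := by
    rw [← restrict_Ioi_eq_restrict_Ici]
    exact ae_restrict_mem measurableSet_Ioi
  refine ⟨fun t ht => ?_, fun t ht => ?_, h.mem_theta, ?_, ?_⟩
  · exact LipschitzOnWith.absolutelyContinuousOnInterval (by rw [uIcc_of_le ht]; exact hlx t ht)
  · exact LipschitzOnWith.absolutelyContinuousOnInterval (by rw [uIcc_of_le ht]; exact hlz t ht)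
  · filter_upwards [hx] with t ht
    convert ht using 1
    simp only [F, mact_add, mact_mul, q, y, map_sub]
    abel
  · filter_upwards [hx, ae_differentiableAt_of_lipschitzOnWith hlz, h0] with t hx hz ht
    have hdy := hasDerivAt_y (sys := sys) hx
    have hdq := IsTrajectory.hasDerivAt_q (sys := sys) hx hz.hasDerivAt
    have hcone : deriv z t ∈ inwardNormalCone sys.Theta (sys.q x z t) := by
      intro v hv
      have h1 : Tendsto (fun s => inner ℝ (slope z t s) (v - sys.q x z t)) (𝓝[>] t)
          (𝓝 (inner ℝ (deriv z t) (v - sys.q x z t))) :=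
        (hz.hasDerivAt.tendsto_slope.mono_left
          (nhdsWithin_mono t fun s hs => ne_of_gt hs)).inner tendsto_const_nhds
      have h2 : Tendsto (fun s => -(K (t + 1) * (s - t))) (𝓝[>] t) (𝓝 0) := by
        have : Continuous fun s => -(K (t + 1) * (s - t)) := by fun_prop
        simpa using (this.tendsto t).mono_left nhdsWithin_le_nhds
      refine le_of_tendsto_of_tendsto h2 h1 ?_
      filter_upwards [self_mem_nhdsWithin, nhdsWithin_le_nhds
        (eventually_lt_nhds (show t < t + 1 by linarith))] with s hs hs1
      have hst : 0 < s - t := sub_pos.2 hs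
      have h3 := h.le_inner (t + 1) t s ht.le (le_of_lt hs) hs1.le v hv
      rw [slope_def_module, inner_smul_left, conj_trivial, ← div_eq_inv_mul, le_div_iff₀ hst]
      simp only [id] at h3
      linarith
    refine ⟨hz, hcone, fun s hs => ?_⟩
    rw [hdy.deriv]
    set y' := mact sys.C ((mact sys.F (x t) + mact sys.E (sys.q x z t)) + mact sys.B (w t))
    have horth : ∀ u ∈ inwardNormalCone sys.Theta (sys.q x z t),
        inner ℝ u (deriv z t - y') = 0 := fun u hu =>
      inwardNormalCone_orthogonal_deriv hdq
        ((eventually_gt_nhds ht).mono fun r hr => h.mem_theta r hr.le) hu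
    have h4 := horth _ hcone
    have h5 := horth _ hs
    refine (abs_le_of_sq_le_sq' ?_ (norm_nonneg _)).2
    have h6 : ‖y' - s‖ ^ 2 = ‖y' - deriv z t‖ ^ 2 + ‖deriv z t - s‖ ^ 2 := by
      rw [← sub_add_sub_cancel y' (deriv z t) s, norm_add_sq_real, ← neg_sub (deriv z t) y',
        inner_neg_left, inner_sub_right, real_inner_comm, h4, real_inner_comm, h5]
      ring
    rw [h6]
    exact le_add_of_nonneg_right (sq_nonneg _)

/-! ### The integrated input -/

/-- The integral of `B w`. -/
noncomputable def inputIntegral (sys : BacklashSystem m n p) (w : ℝ → Vec m) (t : ℝ) : Vec n :=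
  ∫ s in (0 : ℝ)..t, mact sys.B (w s)

variable {c lam M T Mw : ℝ} {w : ℝ → Vec m}

theorem IsBoundedPeriodicInput.intervalIntegrable_B (hw : IsBoundedPeriodicInput T Mw w) {a b : ℝ}
    (ha : 0 ≤ a) (hb : 0 ≤ b) :
    IntervalIntegrable (fun s => mact sys.B (w s)) volume a b :=
  IntervalIntegrable.continuousLinearMap_apply (L := fun _ => mactL sys.B) continuous_const
    (hw.intervalIntegrable ha hb)

theorem IsBoundedPeriodicInput.inputIntegral_sub (hw : IsBoundedPeriodicInput T Mw w) {s t : ℝ}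
    (hs : 0 ≤ s) (ht : 0 ≤ t) :
    sys.inputIntegral w t - sys.inputIntegral w s = ∫ r in s..t, mact sys.B (w r) :=
  intervalIntegral.integral_interval_sub_left (hw.intervalIntegrable_B le_rfl ht)
    (hw.intervalIntegrable_B le_rfl hs)

theorem IsBoundedPeriodicInput.norm_inputIntegral_sub_le (hw : IsBoundedPeriodicInput T Mw w)
    {s t : ℝ} (hs : 0 ≤ s) (hst : s ≤ t) :
    ‖sys.inputIntegral w t - sys.inputIntegral w s‖ ≤ ‖mactL sys.B‖ * Mw * (t - s) := by
  rw [hw.inputIntegral_sub hs (hs.trans hst), ← abs_of_nonneg (sub_nonneg.2 hst)]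
  refine intervalIntegral.norm_integral_le_of_norm_le_const_ae ?_
  have := hw.ae_norm_B_le (sys := sys)
  rw [ae_restrict_iff' measurableSet_Ici] at this
  filter_upwards [this] with r hr hmem
  rw [uIoc_of_le hst] at hmem
  exact hr (hs.trans hmem.1.le)

theorem IsBoundedPeriodicInput.inputIntegral_add_period (hw : IsBoundedPeriodicInput T Mw w)
    {s t : ℝ} (hs : 0 ≤ s) (hst : s ≤ t) :
    sys.inputIntegral w (t + T) - sys.inputIntegral w (s + T)
      = sys.inputIntegral w t - sys.inputIntegral w s := by
  have hT := hw.pos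
  rw [hw.inputIntegral_sub hs (hs.trans hst), hw.inputIntegral_sub (by linarith) (by linarith),
    ← intervalIntegral.integral_comp_add_right]
  refine intervalIntegral.integral_congr fun r hr => ?_
  rw [uIcc_of_le hst] at hr
  rw [hw.periodic r (hs.trans hr.1)]

theorem IsBoundedPeriodicInput.ae_hasDerivAt_inputIntegral
    (hw : IsBoundedPeriodicInput T Mw w) :
    ∀ᵐ t ∂volume.restrict (Ici (0 : ℝ)),
      HasDerivAt (sys.inputIntegral w) (mact sys.B (w t)) t := by
  rw [ae_restrict_iff' measurableSet_Ici]
  filter_upwards [ae_all_iff.2 fun k : ℕ => (hw.intervalIntegrable_B (sys := sys) le_rfl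
    (k.cast_nonneg : (0 : ℝ) ≤ k)).ae_hasDerivAt_integral] with t ht h0
  obtain ⟨k, hk⟩ := exists_nat_gt t
  have hk0 : (0 : ℝ) ≤ k := k.cast_nonneg
  exact ht k (by rw [uIcc_of_le hk0]; exact ⟨h0, hk.le⟩) 0 left_mem_uIcc

/-- A bounded trajectory satisfies the quadratic estimates with a constant factor. -/
theorem IsTrajectory.exists_isQuadraticSolution (hs : sys.IsExpStable c lam M)
    (hw : IsBoundedPeriodicInput T Mw w) {x : ℝ → Vec n} {z : ℝ → Vec p}
    (h : sys.IsTrajectory w x z) :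
    ∃ k, sys.IsQuadraticSolution (sys.inputIntegral w) (fun _ => k) id x z := by
  obtain ⟨X, hX⟩ := h.exists_norm_x_le hs hw
  have hX0 : 0 ≤ X := (norm_nonneg _).trans (hX 0 le_rfl)
  have hM := hs.M_nonneg
  have hMw := hw.nonneg
  -- `L` bounds `|x'|`; consequently `Cn * L` bounds `|z'|` and `2 * Cn * L` is a Lipschitz constant
  -- of `q`.
  set L := ‖mactL sys.F‖ * X + ‖mactL sys.B‖ * Mw + ‖mactL sys.E‖ * M with hL
  set Cn := ‖mactL sys.C‖ with hCn
  have hL0 : 0 ≤ L := by positivity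
  have hCn0 : 0 ≤ Cn := norm_nonneg _
  have hbx : ∀ᵐ t ∂volume.restrict (Ici (0 : ℝ)), ‖deriv x t‖ ≤ L ∧ ‖deriv z t‖ ≤ Cn * L := by
    filter_upwards [h.ae_regular, h.ae_norm_deriv_z_le, hw.ae_norm_B_le (sys := sys)] with t hr hz hB
    have h1 : ‖mact sys.F (x t) + mact sys.B (w t) + mact sys.E (sys.q x z t)‖ ≤ L := by
      refine norm_add₃_le.trans (add_le_add (add_le_add ?_ hB)
        (hs.norm_E_le (h.mem_theta t hr.1.le)))
      exact ((mactL sys.F).le_opNorm _).trans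
        (mul_le_mul_of_nonneg_left (hX t hr.1.le) (norm_nonneg _))
    rw [hr.2.1.deriv]
    exact ⟨h1, hz.trans (((mactL sys.C).le_opNorm _).trans
      (mul_le_mul_of_nonneg_left h1 (norm_nonneg _)))⟩
  have hreg := h.ae_regular
  rw [ae_restrict_iff' measurableSet_Ici] at hbx hreg
  have hac : ∀ {r : ℕ} {f : ℝ → Vec r}, (∀ t, 0 ≤ t → AbsolutelyContinuousOnInterval f 0 t) →
      ∀ s t, 0 ≤ s → s ≤ t → AbsolutelyContinuousOnInterval f s t := fun hf s t h0 hst =>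
    (hf t (h0.trans hst)).mono (by
      rw [uIcc_of_le hst, uIcc_of_le (h0.trans hst)]; exact Icc_subset_Icc_left h0)
  have hx : ∀ s t, 0 ≤ s → s ≤ t → ‖x t - x s‖ ≤ L * (t - s) := fun s t h0 hst => by
    rw [← (hac h.ac_x s t h0 hst).integral_deriv_vec, ← abs_of_nonneg (sub_nonneg.2 hst)]
    refine intervalIntegral.norm_integral_le_of_norm_le_const_ae ?_
    filter_upwards [hbx] with r hr hmem
    rw [uIoc_of_le hst] at hmem
    exact (hr (h0.trans hmem.1.le)).1
  have hz : ∀ s t, 0 ≤ s → s ≤ t → ‖z t - z s‖ ≤ Cn * L * (t - s) := fun s t h0 hst => by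
    rw [← (hac h.ac_z s t h0 hst).integral_deriv_vec, ← abs_of_nonneg (sub_nonneg.2 hst)]
    refine intervalIntegral.norm_integral_le_of_norm_le_const_ae ?_
    filter_upwards [hbx] with r hr hmem
    rw [uIoc_of_le hst] at hmem
    exact (hr (h0.trans hmem.1.le)).2
  have hq : ∀ s t, 0 ≤ s → s ≤ t → ‖sys.q x z t - sys.q x z s‖ ≤ 2 * Cn * L * (t - s) :=
    fun s t h0 hst => by
      have h1 : sys.q x z t - sys.q x z s = (z t - z s) - mactL sys.C (x t - x s) := by
        simp only [q, y, mactL_apply, map_sub]; abel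
      have h2 := (mactL sys.C).le_opNorm (x t - x s)
      have h3 := mul_le_mul_of_nonneg_left (hx s t h0 hst) hCn0
      rw [h1]
      refine (norm_sub_le _ _).trans ?_
      linarith [hz s t h0 hst]
  -- `K₁` is a Lipschitz constant of the drift `F x + E q`; `K₂` is the product of the bound on
  -- `|z'|` and the Lipschitz constant of `q`.
  set K₁ := ‖mactL sys.F‖ * L + ‖mactL sys.E‖ * (2 * Cn * L) with hK₁
  set K₂ := Cn * L * (2 * Cn * L) with hK₂
  have hK₁0 : 0 ≤ K₁ := by positivity
  have hK₂0 : 0 ≤ K₂ := by positivity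
  have hCL : 0 ≤ Cn * L := by positivity
  refine ⟨L + Cn * L + K₁ + K₂, h.mem_theta, fun S s t h0 hst _ => ?_, fun S s t h0 hst _ => ?_,
    fun S s t h0 hst _ => ?_, fun S s t h0 hst _ v hv => ?_⟩ <;> simp only [id] <;>
    have hts := sub_nonneg.2 hst
  · refine (hx s t h0 hst).trans (mul_le_mul_of_nonneg_right ?_ hts)
    linarith
  · refine (hz s t h0 hst).trans (mul_le_mul_of_nonneg_right ?_ hts)
    linarith
  · have hi := (hac h.ac_x s t h0 hst).intervalIntegrable_deriv_vec
    rw [hw.inputIntegral_sub h0 (h0.trans hst), ← (hac h.ac_x s t h0 hst).integral_deriv_vec,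
      ← intervalIntegral.integral_const, ← intervalIntegral.integral_sub hi
      intervalIntegrable_const, ← intervalIntegral.integral_sub (hi.sub intervalIntegrable_const)
      (hw.intervalIntegrable_B h0 (h0.trans hst))]
    calc _ ≤ K₁ * (t - s) * |t - s| := by
          refine intervalIntegral.norm_integral_le_of_norm_le_const_ae ?_
          filter_upwards [hreg] with r hr hmem
          rw [uIoc_of_le hst] at hmem
          have hr0 := h0.trans hmem.1.le
          rw [(hr hr0).2.1.deriv]
          have heq : mact sys.F (x r) + mact sys.B (w r) + mact sys.E (sys.q x z r)
              - (mact sys.F (x s) + mact sys.E (sys.q x z s)) - mact sys.B (w r)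
              = mactL sys.F (x r - x s) + mactL sys.E (sys.q x z r - sys.q x z s) := by
            simp only [mactL_apply, map_sub]; abel
          rw [heq]
          have e1 := (mactL sys.F).le_opNorm (x r - x s)
          have e2 := (mactL sys.E).le_opNorm (sys.q x z r - sys.q x z s)
          have e3 := mul_le_mul_of_nonneg_left (hx s r h0 hmem.1.le) (norm_nonneg (mactL sys.F))
          have e4 := mul_le_mul_of_nonneg_left (hq s r h0 hmem.1.le) (norm_nonneg (mactL sys.E))
          have e5 : K₁ * (r - s) ≤ K₁ * (t - s) :=
            mul_le_mul_of_nonneg_left (by linarith [hmem.2]) hK₁0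
          refine (norm_add_le _ _).trans ?_
          rw [hK₁] at e5 ⊢
          linarith
      _ = K₁ * (t - s) ^ 2 := by rw [abs_of_nonneg hts]; ring
      _ ≤ _ := mul_le_mul_of_nonneg_right (by linarith) (sq_nonneg _)
  · have hi := (hac h.ac_z s t h0 hst).intervalIntegrable_deriv_vec
    have h1 := (innerSL ℝ (v - sys.q x z s)).intervalIntegral_comp_comm hi
    simp only [innerSL_apply_apply] at h1
    rw [← (hac h.ac_z s t h0 hst).integral_deriv_vec, real_inner_comm, ← h1]
    have hii : IntervalIntegrable (fun r => inner ℝ (v - sys.q x z s) (deriv z r)) volume s t :=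
      intervalIntegrable_iff.2 ((innerSL ℝ (v - sys.q x z s)).integrable_comp
        (intervalIntegrable_iff.1 hi))
    have h2 : ∫ r in s..t, -(K₂ * (t - s))
        ≤ ∫ r in s..t, inner ℝ (v - sys.q x z s) (deriv z r) := by
      refine intervalIntegral.integral_mono_ae_restrict hst intervalIntegrable_const hii
        ((ae_restrict_iff' measurableSet_Icc).2 ?_)
      filter_upwards [hreg, hbx] with r hr hb hmem
      have hr0 := h0.trans hmem.1
      have e1 := (hr hr0).2.2.2 v hv
      have e2 := abs_le.1 (abs_real_inner_le_norm (deriv z r) (sys.q x z r - sys.q x z s))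
      have e3 : ‖deriv z r‖ * ‖sys.q x z r - sys.q x z s‖ ≤ Cn * L * (2 * Cn * L * (t - s)) := by
        refine mul_le_mul (hb hr0).2 ((hq s r h0 hmem.1).trans ?_) (norm_nonneg _) hCL
        exact mul_le_mul_of_nonneg_left (by linarith [hmem.2]) (by positivity)
      -- Normality of `z'` holds at `q(r)`; replacing `q(r)` by `q(s)` costs the speed of `z` times
      -- the displacement of `q`.
      rw [real_inner_comm, ← sub_add_sub_cancel v (sys.q x z r) (sys.q x z s), inner_add_right]
      rw [hK₂]
      linarith [e2.1]
    rw [intervalIntegral.integral_const, smul_eq_mul] at h2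
    refine le_trans ?_ h2
    have : K₂ * (t - s) ^ 2 ≤ (L + Cn * L + K₁ + K₂) * (t - s) ^ 2 :=
      mul_le_mul_of_nonneg_right (by linarith) (sq_nonneg _)
    linarith

end BacklashSystem

namespace BacklashSystem

variable {m n p : ℕ} {sys : BacklashSystem m n p}

/-! ### Existence of trajectories by the catching-up scheme -/

/-- The sequences `(X, Z)` are generated by the catching-up scheme with the time step `h`. -/
structure IsCatchingUp (sys : BacklashSystem m n p) (W : ℝ → Vec n) (h : ℝ) (X : ℕ → Vec n)
    (Z : ℕ → Vec p) : Prop where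
  zero : X 0 = 0
  mem_theta : ∀ k, Z k - mact sys.C (X k) ∈ sys.Theta
  step_x : ∀ k : ℕ, X (k + 1) - X k
    = h • (mact sys.F (X k) + mact sys.E (Z k - mact sys.C (X k)))
      + (W ((k + 1 : ℕ) * h) - W (k * h))
  norm_step_z_le : ∀ k, ‖Z (k + 1) - Z k‖ ≤ ‖mactL sys.C‖ * ‖X (k + 1) - X k‖
  inner_nonneg : ∀ k, ∀ v ∈ sys.Theta,
    0 ≤ inner ℝ (Z (k + 1) - Z k) (v - (Z (k + 1) - mact sys.C (X (k + 1))))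

/-- An Euler step moves `x`, and the new `q` is the projection on `Θ` of the old `q` minus the
increment of `y`. The increment of `z` is then the projection minus the projected point: the
variational inequality makes it an inward normal, and comparison with the old `q` bounds it by the
increment of `y`. -/
theorem exists_isCatchingUp (hcompact : IsCompact sys.Theta) (hconvex : Convex ℝ sys.Theta)
    (hne : sys.Theta.Nonempty) (W : ℝ → Vec n) (h : ℝ) :
    ∃ X Z, sys.IsCatchingUp W h X Z := by
  have hproj : ∀ u : Vec p, ∃ v ∈ sys.Theta, ∀ s ∈ sys.Theta, inner ℝ (u - v) (s - v) ≤ 0 :=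
    fun u => by
      obtain ⟨v, hv, huv⟩ := exists_norm_eq_iInf_of_complete_convex hne hcompact.isComplete hconvex u
      exact ⟨v, hv, (norm_eq_iInf_iff_real_inner_le_zero hconvex hv).1 huv⟩
  choose π hπ hπ' using hproj
  obtain ⟨q₀, hq₀⟩ := hne
  let incr : ℕ → Vec n × Vec p → Vec n := fun k s =>
    h • (mact sys.F s.1 + mact sys.E s.2) + (W ((k + 1 : ℕ) * h) - W (k * h))
  let S : ℕ → Vec n × Vec p := fun k => Nat.rec (0, q₀)
    (fun k s => (s.1 + incr k s, π (s.2 - mact sys.C (incr k s)))) k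
  have hS1 : ∀ k, (S (k + 1)).1 - (S k).1 = incr k (S k) := fun k => add_sub_cancel_left _ _
  have hS2 : ∀ k, (S (k + 1)).2 = π ((S k).2 - mact sys.C (incr k (S k))) := fun k => rfl
  have hmem : ∀ k, (S k).2 ∈ sys.Theta := fun k => by
    cases k with
    | zero => exact hq₀
    | succ k => exact hπ _
  have hdz : ∀ k, (S (k + 1)).2 + mact sys.C (S (k + 1)).1 - ((S k).2 + mact sys.C (S k).1)
      = π ((S k).2 - mact sys.C (incr k (S k))) - ((S k).2 - mact sys.C (incr k (S k))) :=
    fun k => by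
      rw [← hS2, ← hS1]
      simp only [map_sub]
      abel
  refine ⟨fun k => (S k).1, fun k => (S k).2 + mact sys.C (S k).1, rfl, fun k => ?_, fun k => ?_,
    fun k => ?_, fun k v hv => ?_⟩
  · simpa using hmem k
  · simp only [add_sub_cancel_right]
    exact hS1 k
  · beta_reduce
    rw [hdz, hS1]
    set u := (S k).2 - mact sys.C (incr k (S k)) with hu
    have h1 := hπ' u _ (hmem k)
    have h2 : ‖u - π u‖ ^ 2 ≤ ‖u - π u‖ * ‖u - (S k).2‖ := by
      have h3 := real_inner_le_norm (u - π u) (u - (S k).2)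
      have h4 : inner ℝ (u - π u) (u - (S k).2) + inner ℝ (u - π u) ((S k).2 - π u)
          = ‖u - π u‖ ^ 2 := by
        rw [← inner_add_right, sub_add_sub_cancel, real_inner_self_eq_norm_sq]
      linarith
    have h5 : ‖u - π u‖ ≤ ‖u - (S k).2‖ := by
      rcases (norm_nonneg (u - π u)).eq_or_lt with h6 | h6
      · rw [← h6]; positivity
      · nlinarith
    rw [norm_sub_rev]
    refine h5.trans ?_
    rw [hu, sub_sub_cancel_left, norm_neg]
    exact (mactL sys.C).le_opNorm _
  · simp only [add_sub_cancel_right]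
    rw [hdz, hS2, ← neg_sub (_ - mact sys.C _), inner_neg_left]
    exact neg_nonneg.2 (hπ' _ v hv)

namespace IsCatchingUp

variable {W : ℝ → Vec n} {h LW M : ℝ} {X : ℕ → Vec n} {Z : ℕ → Vec p}

theorem norm_step_x_le (hX : sys.IsCatchingUp W h X Z) (hh : 0 < h)
    (hW : ∀ s t, 0 ≤ s → s ≤ t → ‖W t - W s‖ ≤ LW * (t - s)) (hM : ∀ v ∈ sys.Theta, ‖v‖ ≤ M)
    (k : ℕ) : ‖X (k + 1) - X k‖
      ≤ h * (‖mactL sys.F‖ * ‖X k‖ + (‖mactL sys.E‖ * M + LW)) := by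
  rw [hX.step_x k]
  have e1 := (mactL sys.F).le_opNorm (X k)
  have e2 := (mactL sys.E).le_opNorm (Z k - mact sys.C (X k))
  have e3 := mul_le_mul_of_nonneg_left (hM _ (hX.mem_theta k)) (norm_nonneg (mactL sys.E))
  have e4 := hW (k * h) ((k + 1 : ℕ) * h) (by positivity) (by gcongr; omega)
  have e5 := norm_add_le (mact sys.F (X k)) (mact sys.E (Z k - mact sys.C (X k)))
  simp only [mactL_apply] at e1 e2
  refine (norm_add_le _ _).trans ?_
  rw [norm_smul, Real.norm_of_nonneg hh.le]
  have e6 : LW * ((k + 1 : ℕ) * h - k * h) = h * LW := by push_cast; ring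
  rw [e6] at e4
  nlinarith [mul_le_mul_of_nonneg_left (e5.trans (add_le_add e1 (e2.trans e3))) hh.le]

/-- A discrete Gronwall inequality, by `1 + h a ≤ exp(h a)`; the bound depends on the elapsed time
`k h` but not on the step. -/
theorem norm_x_le (hX : sys.IsCatchingUp W h X Z) (hh : 0 < h)
    (hW : ∀ s t, 0 ≤ s → s ≤ t → ‖W t - W s‖ ≤ LW * (t - s)) (hM : ∀ v ∈ sys.Theta, ‖v‖ ≤ M)
    (hM0 : 0 ≤ M) (hLW : 0 ≤ LW) (k : ℕ) :
    ‖X k‖ ≤ (‖mactL sys.E‖ * M + LW) * (k * h) * Real.exp (‖mactL sys.F‖ * (k * h)) := by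
  induction k with
  | zero => simp [hX.zero]
  | succ k ih =>
    set a := ‖mactL sys.F‖ with ha
    set b := ‖mactL sys.E‖ * M + LW with hb
    have ha0 : 0 ≤ a := norm_nonneg _
    have hb0 : 0 ≤ b := by positivity
    have h1 : ‖X (k + 1)‖ ≤ ‖X k‖ + ‖X (k + 1) - X k‖ := by
      have := norm_add_le (X k) (X (k + 1) - X k)
      rwa [add_sub_cancel] at this
    have h2 := hX.norm_step_x_le hh hW hM k
    have h3 : 1 + h * a ≤ Real.exp (a * h) := by linarith [Real.add_one_le_exp (a * h)]
    have h4 : 1 ≤ Real.exp (a * ((k + 1 : ℕ) * h)) := Real.one_le_exp (by positivity)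
    have h5 : Real.exp (a * ((k + 1 : ℕ) * h)) = Real.exp (a * (k * h)) * Real.exp (a * h) := by
      rw [← Real.exp_add]; congr 1; push_cast; ring
    calc ‖X (k + 1)‖ ≤ (1 + h * a) * ‖X k‖ + h * b := by linarith
      _ ≤ Real.exp (a * h) * (b * (k * h) * Real.exp (a * (k * h)))
          + h * b * Real.exp (a * ((k + 1 : ℕ) * h)) := by
          refine add_le_add (mul_le_mul h3 ih (norm_nonneg _) (Real.exp_pos _).le) ?_
          exact le_mul_of_one_le_right (by positivity) h4
      _ = _ := by rw [h5]; push_cast; ring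

/-- Induction on `j`. One more step adds an error of at most a constant times `j h · h + h²`, which
is covered by `(j h + h)² - (j h)² = 2 j h · h + h²`. Hence the constants do not depend on `h`. -/
theorem estimates (hX : sys.IsCatchingUp W h X Z) (hh : 0 < h) {L S : ℝ} (hL0 : 0 ≤ L)
    (hL : ∀ k : ℕ, k * h ≤ S → ‖X (k + 1) - X k‖ ≤ L * h) (k j : ℕ) (hkj : (k + j : ℕ) * h ≤ S) :
    ‖X (k + j) - X k‖ ≤ L * (j * h) ∧ ‖Z (k + j) - Z k‖ ≤ ‖mactL sys.C‖ * L * (j * h) ∧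
    ‖X (k + j) - X k - (j * h) • (mact sys.F (X k) + mact sys.E (Z k - mact sys.C (X k)))
      - (W ((k + j : ℕ) * h) - W (k * h))‖
      ≤ (‖mactL sys.F‖ * L + ‖mactL sys.E‖ * (2 * ‖mactL sys.C‖ * L)) * (j * h) ^ 2 ∧
    ∀ v ∈ sys.Theta, -(‖mactL sys.C‖ * L * (2 * ‖mactL sys.C‖ * L) * (j * h) ^ 2)
      ≤ inner ℝ (Z (k + j) - Z k) (v - (Z k - mact sys.C (X k))) := by
  set a := ‖mactL sys.F‖ with ha
  set e := ‖mactL sys.E‖ with he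
  set c := ‖mactL sys.C‖ with hc
  have ha0 : 0 ≤ a := norm_nonneg _
  have he0 : 0 ≤ e := norm_nonneg _
  have hc0 : 0 ≤ c := norm_nonneg _
  have hq : ∀ i : ℕ, ∀ d : ℝ, ‖X (k + i) - X k‖ ≤ L * d → ‖Z (k + i) - Z k‖ ≤ c * L * d →
      ‖(Z (k + i) - mact sys.C (X (k + i))) - (Z k - mact sys.C (X k))‖ ≤ 2 * c * L * d :=
    fun i d h1 h2 => by
      have h3 : (Z (k + i) - mact sys.C (X (k + i))) - (Z k - mact sys.C (X k))
          = (Z (k + i) - Z k) - mactL sys.C (X (k + i) - X k) := by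
        simp only [mactL_apply, map_sub]; abel
      have h4 := (mactL sys.C).le_opNorm (X (k + i) - X k)
      have h5 := mul_le_mul_of_nonneg_left h1 hc0
      rw [h3]
      refine (norm_sub_le _ _).trans ?_
      linarith
  induction j with
  | zero => simp
  | succ j ih =>
    have hle : ((k + j : ℕ) : ℝ) * h ≤ S := le_trans (by gcongr; omega) hkj
    obtain ⟨i1, i2, i3, i4⟩ := ih hle
    have hjh : (0 : ℝ) ≤ j * h := by positivity
    have hcast : ((j + 1 : ℕ) : ℝ) * h = j * h + h := by push_cast; ring
    have hsx := hL (k + j) hle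
    have hsz : ‖Z (k + j + 1) - Z (k + j)‖ ≤ c * L * h := by
      refine (hX.norm_step_z_le (k + j)).trans ?_
      rw [mul_assoc]
      exact mul_le_mul_of_nonneg_left hsx hc0
    have f1 : ‖X (k + (j + 1)) - X k‖ ≤ L * (j * h + h) := by
      rw [← add_assoc, ← sub_add_sub_cancel _ (X (k + j))]
      exact (norm_add_le _ _).trans (by linarith)
    have f2 : ‖Z (k + (j + 1)) - Z k‖ ≤ c * L * (j * h + h) := by
      rw [← add_assoc, ← sub_add_sub_cancel _ (Z (k + j))]
      exact (norm_add_le _ _).trans (by linarith)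
    rw [hcast]
    refine ⟨f1, f2, ?_, fun v hv => ?_⟩
    · have g1 : X (k + (j + 1)) - X k
          - (j * h + h) • (mact sys.F (X k) + mact sys.E (Z k - mact sys.C (X k)))
          - (W ((k + (j + 1) : ℕ) * h) - W (k * h))
          = (X (k + j) - X k - (j * h) • (mact sys.F (X k) + mact sys.E (Z k - mact sys.C (X k)))
            - (W ((k + j : ℕ) * h) - W (k * h)))
          + h • (mactL sys.F (X (k + j) - X k) + mactL sys.E
            ((Z (k + j) - mact sys.C (X (k + j))) - (Z k - mact sys.C (X k)))) := by
        have g2 := hX.step_x (k + j)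
        rw [sub_eq_iff_eq_add] at g2
        rw [← add_assoc, g2, add_smul, map_sub, map_sub]
        simp only [mactL_apply, smul_add, smul_sub]
        abel
      have e1 := (mactL sys.F).le_opNorm (X (k + j) - X k)
      have e2 := (mactL sys.E).le_opNorm
        ((Z (k + j) - mact sys.C (X (k + j))) - (Z k - mact sys.C (X k)))
      have e3 := mul_le_mul_of_nonneg_left i1 ha0
      have e4 := mul_le_mul_of_nonneg_left (hq j _ i1 i2) he0
      have e5 : h * (a * (L * (j * h)) + e * (2 * c * L * (j * h)))
          = (a * L + e * (2 * c * L)) * (j * h * h) := by ring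
      have e6 : 0 ≤ (a * L + e * (2 * c * L)) * (j * h * h + h ^ 2) := by positivity
      rw [g1]
      refine (norm_add_le _ _).trans ((add_le_add i3 ?_).trans
        (b := (a * L + e * (2 * c * L)) * (j * h) ^ 2 + (a * L + e * (2 * c * L)) * (j * h * h)) ?_)
      · rw [norm_smul, Real.norm_of_nonneg hh.le, ← e5]
        refine mul_le_mul_of_nonneg_left ((norm_add_le _ _).trans ?_) hh.le
        linarith
      · nlinarith
    -- The last step is normal at the end of that step, so the middle term is nonnegative; the third
    -- is the price of returning to the base point `q` at index `k`.
    · have g1 : inner ℝ (Z (k + (j + 1)) - Z k) (v - (Z k - mact sys.C (X k)))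
          = inner ℝ (Z (k + j) - Z k) (v - (Z k - mact sys.C (X k)))
          + inner ℝ (Z (k + j + 1) - Z (k + j))
            (v - (Z (k + j + 1) - mact sys.C (X (k + j + 1))))
          + inner ℝ (Z (k + j + 1) - Z (k + j))
            ((Z (k + (j + 1)) - mact sys.C (X (k + (j + 1)))) - (Z k - mact sys.C (X k))) := by
        rw [add_assoc, ← inner_add_right, add_assoc k j 1, sub_add_sub_cancel, ← inner_add_left]
        congr 1
        abel
      have e1 := hX.inner_nonneg (k + j) v hv
      have e2 := (abs_le.1 (abs_real_inner_le_norm (Z (k + j + 1) - Z (k + j))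
        ((Z (k + (j + 1)) - mact sys.C (X (k + (j + 1)))) - (Z k - mact sys.C (X k))))).1
      have e3 := mul_le_mul hsz (hq (j + 1) _ f1 f2) (norm_nonneg _) (by positivity)
      have e4 : c * L * h * (2 * c * L * (j * h + h))
          = c * L * (2 * c * L) * (j * h * h + h ^ 2) := by ring
      have e5 := i4 v hv
      have e6 : 0 ≤ c * L * (2 * c * L) * (j * h * h) := by positivity
      rw [g1]
      nlinarith

/-- The piecewise constant interpolants of the catching-up scheme satisfy quadratic estimates that
are uniform in the time step. -/
theorem isQuadraticSolution (hX : sys.IsCatchingUp W h X Z) (hh : 0 < h)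
    (hW : ∀ s t, 0 ≤ s → s ≤ t → ‖W t - W s‖ ≤ LW * (t - s)) (hM : ∀ v ∈ sys.Theta, ‖v‖ ≤ M)
    (hM0 : 0 ≤ M) (hLW : 0 ≤ LW) {L : ℝ → ℝ} (hL : ∀ S, L S = ‖mactL sys.F‖
      * ((‖mactL sys.E‖ * M + LW) * S * Real.exp (‖mactL sys.F‖ * S)) + (‖mactL sys.E‖ * M + LW)) :
    sys.IsQuadraticSolution W (fun S => L S + ‖mactL sys.C‖ * L S
      + (‖mactL sys.F‖ * L S + ‖mactL sys.E‖ * (2 * ‖mactL sys.C‖ * L S))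
      + ‖mactL sys.C‖ * L S * (2 * ‖mactL sys.C‖ * L S)) (fun t => ⌊t / h⌋₊ * h)
      (fun t => X ⌊t / h⌋₊) (fun t => Z ⌊t / h⌋₊) := by
  have hb : 0 ≤ ‖mactL sys.E‖ * M + LW := by positivity
  -- `L S` bounds the discrete speed at every grid time up to `S`, by inserting the growth bound on
  -- `X` into the one-step estimate.
  have hmain : ∀ S s t, 0 ≤ s → s ≤ t → t ≤ S → 0 ≤ L S ∧ ∃ j : ℕ, ⌊t / h⌋₊ = ⌊s / h⌋₊ + j ∧
      ((⌊s / h⌋₊ + j : ℕ) : ℝ) * h ≤ S ∧ (⌊t / h⌋₊ : ℝ) * h - ⌊s / h⌋₊ * h = j * h ∧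
      ∀ k : ℕ, k * h ≤ S → ‖X (k + 1) - X k‖ ≤ L S * h := by
    intro S s t hs hst hS
    have ht := hs.trans hst
    have hS0 := ht.trans hS
    refine ⟨by rw [hL]; positivity, ⌊t / h⌋₊ - ⌊s / h⌋₊, ?_⟩
    have hfl : ⌊s / h⌋₊ ≤ ⌊t / h⌋₊ := Nat.floor_le_floor (by gcongr)
    rw [Nat.add_sub_cancel' hfl]
    refine ⟨rfl, ?_, by rw [Nat.cast_sub hfl]; ring, fun k hk => ?_⟩
    · have := Nat.floor_le (show 0 ≤ t / h by positivity)
      rw [le_div_iff₀ hh] at this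
      exact this.trans hS
    · refine (hX.norm_step_x_le hh hW hM k).trans ?_
      rw [hL, mul_comm _ h]
      have := hX.norm_x_le hh hW hM hM0 hLW k
      gcongr
      exact this.trans (by gcongr)
  refine ⟨fun t _ => hX.mem_theta _, fun S s t hs hst hS => ?_, fun S s t hs hst hS => ?_,
    fun S s t hs hst hS => ?_, fun S s t hs hst hS v hv => ?_⟩ <;>
    obtain ⟨hL0, j, hj, hjS, hjh, hLS⟩ := hmain S s t hs hst hS <;>
    obtain ⟨e1, e2, e3, e4⟩ := hX.estimates hh hL0 hLS ⌊s / h⌋₊ j hjS <;>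
    beta_reduce <;> rw [hjh, hj] <;>
    have hjh0 : (0 : ℝ) ≤ j * h := by positivity
  · refine e1.trans (mul_le_mul_of_nonneg_right ?_ hjh0)
    have : 0 ≤ ‖mactL sys.C‖ * L S
      + (‖mactL sys.F‖ * L S + ‖mactL sys.E‖ * (2 * ‖mactL sys.C‖ * L S))
      + ‖mactL sys.C‖ * L S * (2 * ‖mactL sys.C‖ * L S) := by positivity
    linarith
  · refine e2.trans (mul_le_mul_of_nonneg_right ?_ hjh0)
    have : 0 ≤ L S + (‖mactL sys.F‖ * L S + ‖mactL sys.E‖ * (2 * ‖mactL sys.C‖ * L S))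
      + ‖mactL sys.C‖ * L S * (2 * ‖mactL sys.C‖ * L S) := by positivity
    linarith
  · refine e3.trans (mul_le_mul_of_nonneg_right ?_ (sq_nonneg _))
    have : 0 ≤ L S + ‖mactL sys.C‖ * L S
      + ‖mactL sys.C‖ * L S * (2 * ‖mactL sys.C‖ * L S) := by positivity
    linarith
  · refine le_trans (neg_le_neg (mul_le_mul_of_nonneg_right ?_ (sq_nonneg _))) (e4 v hv)
    have : 0 ≤ L S + ‖mactL sys.C‖ * L S
      + (‖mactL sys.F‖ * L S + ‖mactL sys.E‖ * (2 * ‖mactL sys.C‖ * L S)) := by positivity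
    linarith

end IsCatchingUp

variable {c lam M T Mw : ℝ} {w : ℝ → Vec m}

/-- The system has a trajectory under every bounded periodic input. -/
theorem IsExpStable.exists_isTrajectory (hs : sys.IsExpStable c lam M)
    (hw : IsBoundedPeriodicInput T Mw w) (hcompact : IsCompact sys.Theta)
    (hconvex : Convex ℝ sys.Theta) : ∃ x z, sys.IsTrajectory w x z := by
  set W := sys.inputIntegral w
  have hM0 := hs.M_nonneg
  have hLW : 0 ≤ ‖mactL sys.B‖ * Mw := mul_nonneg (norm_nonneg _) hw.nonneg
  have hW : ∀ s t, 0 ≤ s → s ≤ t → ‖W t - W s‖ ≤ ‖mactL sys.B‖ * Mw * (t - s) :=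
    fun s t => hw.norm_inputIntegral_sub_le
  set h : ℕ → ℝ := fun N => 1 / ((N : ℝ) + 1) with hh
  have hh0 : ∀ N, 0 < h N := fun N => Nat.one_div_pos_of_nat
  choose X Z hXZ using fun N => exists_isCatchingUp hcompact hconvex hs.nonempty W (h N)
  have hquad := fun N => (hXZ N).isQuadraticSolution (hh0 N) hW hs.bound hM0 hLW (fun S => rfl)
  -- Along a nonprincipal ultrafilter every bounded sequence converges, so the limit exists at all
  -- times at once, without extracting subsequences.
  let U : Ultrafilter ℕ := hyperfilter ℕ
  have hU : (U : Filter ℕ) ≤ atTop := by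
    rw [← Nat.cofinite_eq_atTop]; exact hyperfilter_le_cofinite
  have hlim : ∀ {r : ℕ} (f : ℕ → Vec r) (b : ℝ), (∀ N, ‖f N‖ ≤ b) →
      ∃ a, Tendsto f U (𝓝 a) := fun {r} f b hf => by
    obtain ⟨a, -, ha⟩ := (isCompact_closedBall (0 : Vec r) b).ultrafilter_le_nhds (U.map f)
      (by
        rw [le_principal_iff, Ultrafilter.mem_coe, Ultrafilter.mem_map]
        exact Filter.univ_mem' fun N => by simpa using hf N)
    exact ⟨a, ha⟩
  have hXb : ∀ t, 0 ≤ t → ∃ b, ∀ N, ‖X N ⌊t / h N⌋₊‖ ≤ b := fun t ht => by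
    refine ⟨(‖mactL sys.E‖ * M + ‖mactL sys.B‖ * Mw) * t * Real.exp (‖mactL sys.F‖ * t),
      fun N => ?_⟩
    have h1 : (⌊t / h N⌋₊ : ℝ) * h N ≤ t := by
      have := Nat.floor_le (div_nonneg ht (hh0 N).le)
      rwa [le_div_iff₀ (hh0 N)] at this
    refine ((hXZ N).norm_x_le (hh0 N) hW hs.bound hM0 hLW _).trans ?_
    gcongr
  have hZb : ∀ t, 0 ≤ t → ∃ b, ∀ N, ‖Z N ⌊t / h N⌋₊‖ ≤ b := fun t ht => by
    obtain ⟨b, hb⟩ := hXb t ht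
    refine ⟨M + ‖mactL sys.C‖ * b, fun N => ?_⟩
    have h1 := hs.bound _ ((hXZ N).mem_theta ⌊t / h N⌋₊)
    have h2 := (mactL sys.C).le_opNorm (X N ⌊t / h N⌋₊)
    have h3 := norm_add_le (Z N ⌊t / h N⌋₊ - mact sys.C (X N ⌊t / h N⌋₊))
      (mact sys.C (X N ⌊t / h N⌋₊))
    rw [sub_add_cancel] at h3
    exact h3.trans (add_le_add h1 (h2.trans (mul_le_mul_of_nonneg_left (hb N) (norm_nonneg _))))
  -- The value `0` at negative times is arbitrary.
  have hx : ∀ t, ∃ a, 0 ≤ t → Tendsto (fun N => X N ⌊t / h N⌋₊) U (𝓝 a) := fun t => by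
    by_cases ht : 0 ≤ t
    · obtain ⟨b, hb⟩ := hXb t ht
      obtain ⟨a, ha⟩ := hlim _ b hb
      exact ⟨a, fun _ => ha⟩
    · exact ⟨0, fun h => absurd h ht⟩
  have hz : ∀ t, ∃ a, 0 ≤ t → Tendsto (fun N => Z N ⌊t / h N⌋₊) U (𝓝 a) := fun t => by
    by_cases ht : 0 ≤ t
    · obtain ⟨b, hb⟩ := hZb t ht
      obtain ⟨a, ha⟩ := hlim _ b hb
      exact ⟨a, fun _ => ha⟩
    · exact ⟨0, fun h => absurd h ht⟩
  choose x hx using hx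
  choose z hz using hz
  have hτ : ∀ t, 0 ≤ t → Tendsto (fun N => (⌊t / h N⌋₊ : ℝ) * h N) atTop (𝓝 t) := fun t ht => by
    have h0 : Tendsto h atTop (𝓝 0) := tendsto_one_div_add_atTop_nhds_zero_nat
    refine tendsto_of_tendsto_of_tendsto_of_le_of_le (g := fun N => t - h N) (h := fun _ => t)
      (by simpa using h0.const_sub t) tendsto_const_nhds (fun N => ?_) fun N => ?_
    · have := Nat.lt_floor_add_one (t / h N)
      rw [div_lt_iff₀ (hh0 N)] at this
      beta_reduce
      linarith
    · have := Nat.floor_le (div_nonneg ht (hh0 N).le)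
      rwa [le_div_iff₀ (hh0 N)] at this
  have hWc : ∀ t, 0 ≤ t → Tendsto (fun N => W (⌊t / h N⌋₊ * h N)) atTop (𝓝 (W t)) := fun t ht => by
    have h1 := ((hτ t ht).const_sub t).const_mul (‖mactL sys.B‖ * Mw)
    rw [sub_self, mul_zero] at h1
    rw [tendsto_iff_norm_sub_tendsto_zero]
    refine squeeze_zero (fun N => norm_nonneg _) (fun N => ?_) h1
    rw [norm_sub_rev]
    refine hW _ _ (mul_nonneg (Nat.cast_nonneg _) (hh0 N).le) ?_
    have := Nat.floor_le (div_nonneg ht (hh0 N).le)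
    rwa [le_div_iff₀ (hh0 N)] at this
  exact ⟨x, z, (IsQuadraticSolution.of_tendsto (l := (U : Filter ℕ)) hcompact.isClosed hquad hx hz
    (fun t ht => (hτ t ht).mono_left hU) fun t ht => (hWc t ht).mono_left hU).isTrajectory
    hw.ae_hasDerivAt_inputIntegral⟩

/-- If `θ < 0` then there is a periodic trajectory. -/
theorem IsExpStable.exists_periodic_isTrajectory (hs : sys.IsExpStable c lam M)
    (hw : IsBoundedPeriodicInput T Mw w) (hcompact : IsCompact sys.Theta)
    (hconvex : Convex ℝ sys.Theta) {R : ℝ} (hR : 0 < R)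
    (hstrong : IsStronglyConvexWith sys.Theta R) {P : Matrix (Fin n) (Fin n) ℝ} (hP : P.PosDef)
    (hLyap : (-lam • P - symmetrizer (P * sys.F)).PosSemidef)
    (hθ : sys.theta P lam R T w < 0) :
    ∃ x z, sys.IsTrajectory w x z ∧ IsPeriodicOnHalfLine T x ∧ IsPeriodicOnHalfLine T z := by
  have hT := hw.pos
  obtain ⟨x, z, hxz⟩ := hs.exists_isTrajectory hw hcompact hconvex
  obtain ⟨k, hk⟩ := hxz.exists_isQuadraticSolution hs hw
  -- All shifts share the constant `k`, as required for passing to the limit.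
  have hshift : ∀ j : ℕ, sys.IsQuadraticSolution (sys.inputIntegral w) (fun _ => k) id
      (fun t => x (t + j * T)) (fun t => z (t + j * T)) := fun j => by
    induction j with
    | zero => simpa using hk
    | succ j ih =>
      have := ih.comp_add_const hT.le fun s t => hw.inputIntegral_add_period
      convert this using 2 <;> · push_cast; congr 1; ring
  obtain ⟨κ, hκ, hκ0⟩ := exists_between hθ
  have h1 : sys.IsTrajectory w (fun t => x (t + (1 : ℕ) * T)) (fun t => z (t + (1 : ℕ) * T)) :=
    (hshift 1).isTrajectory hw.ae_hasDerivAt_inputIntegral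
  obtain ⟨K, hK⟩ := hs.exists_norm_sub_le hw hcompact hstrong hLyap hP h1 hxz hR hκ
  have hr : Real.exp (κ * T) < 1 := by
    rw [← Real.exp_zero]
    exact Real.exp_lt_exp.2 (mul_neg_of_neg_of_pos hκ0 hT)
  have hlim : ∀ {r : ℕ} (f : ℝ → Vec r),
      (∀ t, 0 ≤ t → ‖f (t + (1 : ℕ) * T) - f t‖ ≤ K * Real.exp (κ * t)) →
      ∀ t, ∃ a, 0 ≤ t → Tendsto (fun j : ℕ => f (t + j * T)) atTop (𝓝 a) := fun f hf t => by
    by_cases ht : 0 ≤ t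
    -- Consecutive shifts are the trajectory and its one-period shift, both evaluated `j T` later,
    -- so their distance decays geometrically with ratio `exp(κ T) < 1`.
    · have hc : CauchySeq fun j : ℕ => f (t + j * T) := by
        refine cauchySeq_of_le_geometric _ (K * Real.exp (κ * t)) hr fun j => ?_
        have := hf (t + j * T) (by positivity)
        have e1 : t + (j + 1 : ℕ) * T = t + j * T + (1 : ℕ) * T := by push_cast; ring
        have e2 : K * Real.exp (κ * t) * Real.exp (κ * T) ^ j = K * Real.exp (κ * (t + j * T)) := by
          rw [mul_assoc, ← Real.exp_nat_mul, ← Real.exp_add]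
          congr 2
          ring
        rw [dist_comm, dist_eq_norm, e1, e2]
        exact this
      obtain ⟨a, ha⟩ := cauchySeq_tendsto_of_complete hc
      exact ⟨a, fun _ => ha⟩
    · exact ⟨0, fun h => absurd h ht⟩
  choose xT hxT using hlim x fun t ht =>
    (le_add_of_nonneg_right (norm_nonneg _)).trans (hK t ht)
  choose zT hzT using hlim z fun t ht =>
    (le_add_of_nonneg_left (norm_nonneg _)).trans (hK t ht)
  have hper : ∀ {r : ℕ} {f g : ℝ → Vec r},
      (∀ t, 0 ≤ t → Tendsto (fun j : ℕ => f (t + j * T)) atTop (𝓝 (g t))) →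
      IsPeriodicOnHalfLine T g := fun {r f g} hfg t ht => by
    refine tendsto_nhds_unique (hfg (t + T) (by positivity)) ?_
    have := (hfg t ht).comp (tendsto_add_atTop_nat 1)
    refine this.congr fun j => ?_
    simp only [Function.comp_apply]
    congr 1
    push_cast
    ring
  exact ⟨xT, zT, (IsQuadraticSolution.of_tendsto (l := atTop) hcompact.isClosed hshift hxT hzT
    (fun t _ => tendsto_const_nhds) fun t _ => tendsto_const_nhds).isTrajectory
    hw.ae_hasDerivAt_inputIntegral, hper hxT, hper hzT⟩

end BacklashSystem

/-! ### Uniqueness of the periodic regime and the main theorem. -/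

theorem IsPeriodicOnHalfLine.eqOn_of_norm_sub_le {r : ℕ} {T K κ : ℝ} (hT : 0 < T) (hκ : κ < 0)
    {f g : ℝ → Vec r} (hf : IsPeriodicOnHalfLine T f) (hg : IsPeriodicOnHalfLine T g)
    (h : ∀ t, 0 ≤ t → ‖f t - g t‖ ≤ K * Real.exp (κ * t)) : EqOn f g (Ici 0) := by
  intro t ht
  have ht : 0 ≤ t := ht
  have h1 : Tendsto (fun j : ℕ => K * Real.exp (κ * (t + j * T))) atTop (𝓝 (K * 0)) := by
    refine Tendsto.const_mul K (Real.tendsto_exp_atBot.comp ?_)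
    exact (tendsto_atTop_add_const_left _ t
      (tendsto_natCast_atTop_atTop.atTop_mul_const hT)).const_mul_atTop_of_neg hκ
  rw [mul_zero] at h1
  -- The difference is the same at all times `t + j T`, while its bound there tends to zero.
  have h2 : ‖f t - g t‖ ≤ 0 := ge_of_tendsto' h1 fun j => by
    have := h (t + j * T) (by positivity)
    rwa [hf.add_nat_mul hT.le j ht, hg.add_nat_mul hT.le j ht] at this
  exact sub_eq_zero.1 (norm_le_zero_iff.1 h2)

theorem mainTheorem1 {m n p : ℕ} (sys : BacklashSystem m n p)
    (hcompact : IsCompact sys.Theta) (hconvex : Convex ℝ sys.Theta)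
    (R : ℝ) (hR : 0 < R) (hstrong : IsStronglyConvexWith sys.Theta R)
    (hF : IsHurwitz sys.F)
    (lam : ℝ) (hlam : 0 < lam) (hlam_mu : lam < |spectralAbscissa sys.F|)
    (P : Matrix (Fin n) (Fin n) ℝ) (hP : P.PosDef)
    (hLyap : (-lam • P - symmetrizer (P * sys.F)).PosSemidef) :
    -- the rate function is convex and nonincreasing on the half-line
    ConvexOn ℝ (Ici 0) (sys.psi P lam) ∧ AntitoneOn (sys.psi P lam) (Ici 0) ∧
    -- the bound on the Lyapunov function for an arbitrary locally integrable input
    (∀ w : ℝ → Vec m, LocallyIntegrableOn w (Ici 0) volume →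
      ∀ (x₁ : ℝ → Vec n) (z₁ : ℝ → Vec p) (x₂ : ℝ → Vec n) (z₂ : ℝ → Vec p),
      sys.IsTrajectory w x₁ z₁ → sys.IsTrajectory w x₂ z₂ →
      ∀ t : ℝ, 0 ≤ t →
        IntervalIntegrable (fun s => sys.psi P lam (gammaRate R z₁ z₂ s)) volume 0 t ∧
        Real.sqrt (sys.V P x₁ z₁ x₂ z₂ t) ≤ Real.sqrt (sys.V P x₁ z₁ x₂ z₂ 0)
          * Real.exp (∫ s in (0 : ℝ)..t, sys.psi P lam (gammaRate R z₁ z₂ s))) ∧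
    -- bounded periodic inputs
    ((0 : Vec p) ∈ sys.Theta →
      ∀ T : ℝ, 0 < T → ∀ w : ℝ → Vec m, IsPeriodicOnHalfLine T w →
      MemLp w ⊤ (volume.restrict (Icc 0 T)) →
      -- bounds on the mean rate over a period and on the Lyapunov exponent
      (∀ (x₁ : ℝ → Vec n) (z₁ : ℝ → Vec p) (x₂ : ℝ → Vec n) (z₂ : ℝ → Vec p),
        sys.IsTrajectory w x₁ z₁ → sys.IsTrajectory w x₂ z₂ →
        limsup (fun τ : ℝ =>
            (((1 / T) * ∫ t in τ..(τ + T), sys.psi P lam (gammaRate R z₁ z₂ t) : ℝ) : EReal))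
          atTop ≤ ((sys.theta P lam R T w : ℝ) : EReal) ∧
        ((1 / 2 : ℝ) : EReal) * limsup (fun t : ℝ =>
            ((1 / t : ℝ) : EReal) * ENNReal.log (ENNReal.ofReal (sys.V P x₁ z₁ x₂ z₂ t))) atTop
          ≤ limsup (fun t : ℝ =>
            (((1 / t) * ∫ s in (0 : ℝ)..t, sys.psi P lam (gammaRate R z₁ z₂ s) : ℝ) : EReal))
          atTop ∧
        limsup (fun t : ℝ =>
            (((1 / t) * ∫ s in (0 : ℝ)..t, sys.psi P lam (gammaRate R z₁ z₂ s) : ℝ) : EReal))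
          atTop ≤ ((sys.theta P lam R T w : ℝ) : EReal)) ∧
      -- a unique periodic regime, which attracts all trajectories at an exponential rate
      (sys.theta P lam R T w < 0 →
        ∃ (xT : ℝ → Vec n) (zT : ℝ → Vec p),
          sys.IsTrajectory w xT zT ∧ IsPeriodicOnHalfLine T xT ∧ IsPeriodicOnHalfLine T zT ∧
          (∀ (x : ℝ → Vec n) (z : ℝ → Vec p), sys.IsTrajectory w x z →
            IsPeriodicOnHalfLine T x → IsPeriodicOnHalfLine T z →
            EqOn x xT (Ici 0) ∧ EqOn z zT (Ici 0)) ∧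
          (∀ (x : ℝ → Vec n) (z : ℝ → Vec p), sys.IsTrajectory w x z →
            ∀ κ : ℝ, sys.theta P lam R T w < κ →
              ∃ K : ℝ, ∀ t : ℝ, 0 ≤ t →
                ‖x t - xT t‖ + ‖z t - zT t‖ ≤ K * Real.exp (κ * t)))) := by
  refine ⟨sys.psi_convexOn hP lam, (sys.psi_antitone hP lam).antitoneOn _,
    fun w _ x₁ z₁ x₂ z₂ h₁ h₂ t ht => ⟨BacklashSystem.intervalIntegrable_psi hP lam h₁ h₂ hR ht,
      BacklashSystem.sqrt_V_le hcompact hR hstrong hP hLyap h₁ h₂ ht⟩, ?_⟩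
  intro h0 T hT w hper hmem
  obtain ⟨Mw, hw⟩ := BacklashSystem.exists_isBoundedPeriodicInput hT hper hmem
  obtain ⟨c, hc0, hc⟩ := BacklashSystem.exists_norm_expL_le hP hLyap
  obtain ⟨M, hM⟩ := hcompact.isBounded.exists_norm_le
  have hs : sys.IsExpStable c lam M := ⟨hlam, hc0, hc, ⟨0, h0⟩, hM⟩
  refine ⟨fun x₁ z₁ x₂ z₂ h₁ h₂ => ⟨hs.limsup_mean_window_le hw hP h₁ h₂ hR,
    BacklashSystem.half_limsup_log_V_le (fun t => BacklashSystem.V_nonneg hP ..)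
      fun t ht => BacklashSystem.sqrt_V_le hcompact hR hstrong hP hLyap h₁ h₂ ht,
    hs.limsup_mean_le hw hP h₁ h₂ hR⟩, fun hθ => ?_⟩
  obtain ⟨xT, zT, htr, hpx, hpz⟩ :=
    hs.exists_periodic_isTrajectory hw hcompact hconvex hR hstrong hP hLyap hθ
  refine ⟨xT, zT, htr, hpx, hpz, fun x z h hx hz => ?_, fun x z h κ hκ =>
    hs.exists_norm_sub_le hw hcompact hstrong hLyap hP h htr hR hκ⟩
  -- Any rate strictly between `θ` and `0` serves: it is admissible for contraction and still forces
  -- decay.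
  obtain ⟨κ, hκ, hκ0⟩ := exists_between hθ
  obtain ⟨K, hK⟩ := hs.exists_norm_sub_le hw hcompact hstrong hLyap hP h htr hR hκ
  exact ⟨hx.eqOn_of_norm_sub_le hT hκ0 hpx fun t ht =>
      (le_add_of_nonneg_right (norm_nonneg _)).trans (hK t ht),
    hz.eqOn_of_norm_sub_le hT hκ0 hpz fun t ht =>
      (le_add_of_nonneg_left (norm_nonneg _)).trans (hK t ht)⟩
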